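/- Let $\Omega=\mathbb{R}^2$ or $\Omega=\mathbb{T}^2=\mathbb{R}^2/\mathbb{Z}^2$. Functions on $\Omega$ are real-valued, measurable and identified a.e.; $Q$ denotes open cubes with sides parallel to the coordinate axes (on $\mathbb{T}^2$: images of such cubes of $\mathbb{R}^2$), and $f^*(t)=\inf\{s\ge 0: |\{|f|>s\}|\le t\}$ is the non-increasing rearrangement. For $\alpha>0$ let $$M^{\#}_{\Omega}f(x)=\sup_{\Omega\supset Q\ni x}\ \inf_{c\in\mathbb{R}}\ \big((f-c)\chi_Q\big)^*(\alpha|Q|),\qquad \|f\|_{(L^p)^{\#}(\Omega)}=\|M^{\#}_\Omega f\|_{L^p(\Omega)},$$ and let $(L^p)^{\#}(\Omega)$ be the space of all $f$ for which this is finite. Let $\|f\|_{\mathrm{BMO}(\Omega)}=\sup_Q \frac1{|Q|}\int_Q|f-f_Q|$, where $f_Q=\frac1{|Q|}\int_Q f$. Spaces are understood modulo constants; in particular $L^{p_0}(\Omega)$ carries the norm $\inf_{c}\|f-c\|_{L^{p_0}(\Omega)}$ when it is paired with $\mathrm{BMO}(\Omega)$. For a pair $(A_0,A_1)$, $\theta\in(0,1)$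 and $p\in[1,\infty)$, the normalized real interpolation space $(A_0,A_1)^{\blacktriangleleft}_{\theta,p}$ consists of all $f\in A_0+A_1$ with $$\|f\|_{(A_0,A_1)^{\blacktriangleleft}_{\theta,p}}=(\theta(1-\theta)p)^{1/p}\Big(\int_0^\infty[t^{-\theta}K(t,f;A_0,A_1)]^p\,\frac{dt}{t}\Big)^{1/p}<\infty,$$ where $K(t,f;A_0,A_1)=\inf\{\|f_0\|_{A_0}+t\|f_1\|_{A_1}: f=f_0+f_1,\ f_i\in A_i\}$. A growth function is a non-decreasing function $\Theta:(1,\infty)\to(0,\infty)$ that is doubling, i.e. $\sup_{p>1}\Theta(2p)/\Theta(p)<\infty$. The sharp Yudovich space $Y^{\#\Theta}_{p_0}(\Omega)$ consists of all $f\in\bigcap_{p>p_0}(L^p)^{\#}(\Omega)$ with $$\|f\|_{Y^{\#\Theta}_{p_0}(\Omega)}=\sup_{p>p_0}\frac{\|f\|_{(L^p)^{\#}(\Omega)}}{\Theta(p)}<\infty.$$ **Theorem.** There is $\alpha_0>0$ such that for every $\alpha\in(0,\alpha_0]$ and every $p_0\in[1,\infty)$ there is a constant $C$, depending only on $\alpha$,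 $p_0$ and $\Omega$, with the following properties. (i) For every $\theta\in(0,1)$, with $\frac1{p(\theta)}=\frac{1-\theta}{p_0}$, $$(L^{p_0}(\Omega),\mathrm{BMO}(\Omega))^{\blacktriangleleft}_{\theta,p(\theta)}=(L^{p(\theta)})^{\#}(\Omega),$$ each of the two norms being at most $C$ times the other; in particular the equivalence constants do not depend on $\theta$. (ii) Consequently, for every growth function $\Theta$, the space $Y^{\#\Theta}_{p_0}(\Omega)$ coincides with the $\Delta$-extrapolation space $$\Delta_{\theta\in(0,1)}\bigg\{\frac{(L^{p_0}(\Omega),\mathrm{BMO}(\Omega))^{\blacktriangleleft}_{\theta,p(\theta)}}{\Theta\big(\frac{p_0}{1-\theta}\big)}\bigg\},$$ that is, the set of all $f$ in $\bigcap_{\theta\in(0,1)}(L^{p_0}(\Omega),\mathrm{BMO}(\Omega))^{\blacktriangleleft}_{\theta,p(\theta)}$ for which the norm $$\sup_{\theta\in(0,1)}\frac{\|f\|_{(L^{p_0}(\Omega),\mathrm{BMO}(\Omega))^{\blacktriangleleft}_{\theta,p(\theta)}}}{\Theta(p_0/(1-\theta))}$$ is finite, again with each norm at most $C$ times the other. 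-/

import Mathlib

open MeasureTheory Set
open scoped ENNReal NNReal

noncomputable section

namespace SharpYudovich

/-! ### Real interpolation and extrapolation

A (semi)normed space `A` inside an ambient group `E` is described by its extended norm
`N : E → ℝ≥0∞`, which is `∞` exactly outside `A`. -/

section Abstract

variable {E : Type*} [AddCommGroup E]

/-- Peetre's `K`-functional of the pair with extended norms `N₀`, `N₁`
(decompositions with a part outside its space contribute `∞` to the infimum). -/
def peetreK (N₀ N₁ : E → ℝ≥0∞) (t : ℝ) (f : E) : ℝ≥0∞ :=
  ⨅ (f₀ : E) (f₁ : E) (_ : f₀ + f₁ = f), N₀ f₀ + ENNReal.ofReal t * N₁ f₁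

/-- The norm of the real interpolation space with parameters `θ` and `p < ∞`. -/
def interpNorm (N₀ N₁ : E → ℝ≥0∞) (θ p : ℝ) (f : E) : ℝ≥0∞ :=
  (∫⁻ t in Ioi (0 : ℝ),
    (ENNReal.ofReal (t ^ (-θ)) * peetreK N₀ N₁ t f) ^ p / ENNReal.ofReal t) ^ (1 / p)

/-- The norm of the normalized real interpolation space: `c_{θ,p} = (θ (1 - θ) p)^{1/p}`
times the real interpolation norm. -/
def normInterpNorm (N₀ N₁ : E → ℝ≥0∞) (θ p : ℝ) (f : E) : ℝ≥0∞ :=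
  ENNReal.ofReal ((θ * (1 - θ) * p) ^ (1 / p)) * interpNorm N₀ N₁ θ p f

/-- The normalized real interpolation space, as a subset of the sum of the two spaces. -/
def normInterpSpace (N₀ N₁ : E → ℝ≥0∞) (θ p : ℝ) : Set E :=
  {f | (∃ f₀ f₁ : E, f₀ + f₁ = f ∧ N₀ f₀ < ∞ ∧ N₁ f₁ < ∞) ∧ normInterpNorm N₀ N₁ θ p f < ∞}

/-- The norm of the `Δ`-extrapolation space of the family `A θ / w θ`, `θ ∈ (0,1)`, where
`N θ` is the norm of `A θ`. -/
def deltaNorm (N : ℝ → E → ℝ≥0∞) (w : ℝ → ℝ) (f : E) : ℝ≥0∞ :=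
  ⨆ θ ∈ Ioo (0 : ℝ) 1, N θ f / ENNReal.ofReal (w θ)

/-- The `Δ`-extrapolation space of the family `A θ / w θ`, `θ ∈ (0,1)`: the elements of the
intersection of all the `A θ` with finite `Δ`-norm. -/
def deltaSpace (A : ℝ → Set E) (N : ℝ → E → ℝ≥0∞) (w : ℝ → ℝ) : Set E :=
  {f | (∀ θ ∈ Ioo (0 : ℝ) 1, f ∈ A θ) ∧ deltaNorm N w f < ∞}

end Abstract

/-- Growth functions: positive, non-decreasing and doubling on `(1,∞)`
(the values of `Θ` elsewhere are irrelevant). -/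
structure IsGrowthFunction (Θ : ℝ → ℝ) : Prop where
  pos : ∀ p, 1 < p → 0 < Θ p
  mono : MonotoneOn Θ (Ioi 1)
  doubling : ∃ D : ℝ, ∀ p, 1 < p → Θ (2 * p) ≤ D * Θ p

/-- The non-increasing rearrangement `f^*(t) = inf {s ≥ 0 : μ {|f| > s} ≤ t}`. -/
def rearrangement {S : Type*} [MeasurableSpace S] (μ : Measure S) (f : S → ℝ) (t : ℝ≥0∞) :
    ℝ≥0∞ :=
  sInf {s : ℝ≥0∞ | μ {x | s < ‖f x‖ₑ} ≤ t}

/-! ### Function spaces on `X × X`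

Below `X` is either `ℝ`, so that `Fin 2 → X` is the plane, or `UnitAddCircle = ℝ / ℤ`, so that
`Fin 2 → X` is the torus `𝕋²`; `volume` is Lebesgue measure. -/

section Spaces

variable {X : Type*} [PseudoMetricSpace X] [MeasureSpace X]

/-- The open cube with sides parallel to the axes, centre `c` and side length `2 r`.
For `X = ℝ / ℤ` it is the image in `𝕋²` of the cube of the plane with the same side length. -/
def cube (c : Fin 2 → X) (r : ℝ) : Set (Fin 2 → X) :=
  {x | ∀ i, dist (x i) (c i) < r}

/-- The Strömberg–Jawerth–Torchinsky maximal function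
`sup_{Q ∋ x} inf_{a ∈ ℝ} ((f - a) χ_Q)^* (α |Q|)`. -/
def sharpMax (α : ℝ) (f : (Fin 2 → X) → ℝ) (x : Fin 2 → X) : ℝ≥0∞ :=
  ⨆ (c : Fin 2 → X) (r : ℝ) (_ : 0 < r) (_ : x ∈ cube c r),
    ⨅ a : ℝ, rearrangement volume ((cube c r).indicator fun y => f y - a)
      (ENNReal.ofReal α * volume (cube c r))

/-- The norm of `(L^p)^#`, that is the `L^p` norm of the maximal function. -/
def sharpNorm (α p : ℝ) (f : (Fin 2 → X) →ₘ[volume] ℝ) : ℝ≥0∞ :=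
  eLpNorm (sharpMax α f) (ENNReal.ofReal p) volume

/-- The space `(L^p)^#`. -/
def sharpSpace (X : Type*) [PseudoMetricSpace X] [MeasureSpace X] (α p : ℝ) :
    Set ((Fin 2 → X) →ₘ[volume] ℝ) :=
  {f | sharpNorm α p f < ∞}

/-- The norm of `L^p` modulo constants, `inf_c ‖f - c‖_{L^p}`. -/
def lpNormModConst (p : ℝ) (f : (Fin 2 → X) →ₘ[volume] ℝ) : ℝ≥0∞ :=
  ⨅ c : ℝ, eLpNorm (fun x => f x - c) (ENNReal.ofReal p) volume

/-- The norm of `BMO`: supremum over cubes of the mean oscillation. It is `∞` if `f` is not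
integrable over some cube, since then so is `f` minus any constant. -/
def bmoNorm (f : (Fin 2 → X) →ₘ[volume] ℝ) : ℝ≥0∞ :=
  ⨆ (c : Fin 2 → X) (r : ℝ) (_ : 0 < r),
    ⨍⁻ y in cube c r, ‖f y - ⨍ z in cube c r, f z ∂volume‖ₑ ∂volume

/-- The norm of the normalized real interpolation space of `(L^{p₀}, BMO)` with parameters
`θ` and `p`. -/
def lpBmoNorm (p₀ θ p : ℝ) (f : (Fin 2 → X) →ₘ[volume] ℝ) : ℝ≥0∞ :=
  normInterpNorm (lpNormModConst p₀) bmoNorm θ p f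

/-- The normalized real interpolation space of `(L^{p₀}, BMO)` with parameters `θ` and `p`. -/
def lpBmoSpace (X : Type*) [PseudoMetricSpace X] [MeasureSpace X] (p₀ θ p : ℝ) :
    Set ((Fin 2 → X) →ₘ[volume] ℝ) :=
  normInterpSpace (lpNormModConst p₀) bmoNorm θ p

/-- The norm of the sharp Yudovich space. -/
def sharpYudovichNorm (α p₀ : ℝ) (Θ : ℝ → ℝ) (f : (Fin 2 → X) →ₘ[volume] ℝ) : ℝ≥0∞ :=
  ⨆ p ∈ Ioi p₀, sharpNorm α p f / ENNReal.ofReal (Θ p)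

/-- The sharp Yudovich space. -/
def sharpYudovichSpace (X : Type*) [PseudoMetricSpace X] [MeasureSpace X] (α p₀ : ℝ)
    (Θ : ℝ → ℝ) : Set ((Fin 2 → X) →ₘ[volume] ℝ) :=
  {f | (∀ p ∈ Ioi p₀, f ∈ sharpSpace X α p) ∧ sharpYudovichNorm α p₀ Θ f < ∞}

/-- The norm of the `Δ`-extrapolation space of `(L^{p₀}, BMO)` with `p(θ) = p₀ / (1 - θ)` and
weights `Θ (p₀ / (1 - θ))`. -/
def lpBmoDeltaNorm (p₀ : ℝ) (Θ : ℝ → ℝ) (f : (Fin 2 → X) →ₘ[volume] ℝ) : ℝ≥0∞ :=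
  deltaNorm (fun θ => lpBmoNorm p₀ θ (p₀ / (1 - θ))) (fun θ => Θ (p₀ / (1 - θ))) f

/-- The `Δ`-extrapolation space of `(L^{p₀}, BMO)` with `p(θ) = p₀ / (1 - θ)` and weights
`Θ (p₀ / (1 - θ))`. -/
def lpBmoDeltaSpace (X : Type*) [PseudoMetricSpace X] [MeasureSpace X] (p₀ : ℝ) (Θ : ℝ → ℝ) :
    Set ((Fin 2 → X) →ₘ[volume] ℝ) :=
  deltaSpace (fun θ => lpBmoSpace X p₀ θ (p₀ / (1 - θ)))
    (fun θ => lpBmoNorm p₀ θ (p₀ / (1 - θ))) (fun θ => Θ (p₀ / (1 - θ)))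

end Spaces

/-- Two spaces with extended norms coincide as sets, and their norms are equivalent with
constant `C`. -/
def EqWithConst {E : Type*} (A : Set E) (N : E → ℝ≥0∞) (B : Set E) (M : E → ℝ≥0∞) (C : ℝ≥0) :
    Prop :=
  A = B ∧ ∀ f ∈ A, N f ≤ C * M f ∧ M f ≤ C * N f

end SharpYudovich

end

noncomputable section

namespace SharpYudovich

/-! ### Power integrals, the layer cake formula and Hardy's inequalities -/

/-! The theorem rests on a formula for the `K`-functional. With `G` the sharp maximal function of
`f`, `K(t, f; L^{p₀}, BMO)` is comparable to `(∫₀^{t^{p₀}} (G^*)^{p₀})^{1/p₀}`, with constants that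
do not involve `θ`.

Lower bound for `K` (`rearr_sharpMax_le_peetreK`): if `f = f₀ + f₁`, then `G` is at most the sharp
maximal function of `f₀` with parameter `α/2`, plus `(2/α) ‖f₁‖_BMO` (Chebyshev on each cube). The
first term exceeds `s` only where the maximal function of the set `{|f₀ - a| > s}` exceeds `α/2`, so
a Vitali covering bounds its `L^{p₀}` norm. Minkowski on `(0, t^{p₀})` concludes.

Upper bound (`peetreK_le_rearr_sharpMax`): put `Λ = G^*(t^{p₀})` and `Ω = {G > Λ}`, an open set of
measure at most `t^{p₀}`. Replace `f` on each Whitney cell of `Ω` by its median there. The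
difference is controlled in `L^{p₀}` by `∫_Ω G^{p₀}`, through the local Fefferman–Stein inequality
`lintegral_sub_med_le`, whose core is the good-lambda estimate `good_lambda`. The modified function
has local oscillation at most `Λ` on every cube (`oscBound_whitneyFun`), hence `BMO` norm `≲ Λ` by
John–Strömberg (`exists_lintegral_sub_le`). If `Ω` is everything, the measure is finite, one cell
fills the space, and `f₁ = 0` works.

Substituting `s = t^{p₀}` turns the interpolation norm of this expression into a Hardy integral of
`(G^*)^{p₀}` with exponent `q = 1/(1-θ)`. Hardy's inequality and its converse for non-increasing
functions compare it with `‖G‖_p`; the normalizing factor cancels the blow-up of the Hardy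
constants, leaving `3` and `2` after the `p`-th root. Part (ii) is (i) under the bijection `θ ↦
p₀/(1-θ)` from `(0,1)` to `(p₀,∞)`.

All geometric arguments use only a doubling measure with a dyadic grid (`DyadicGrid`) and medians in
place of means, so no local integrability of `f` is assumed. The plane and the torus enter only by
supplying such a grid. -/

lemma lintegral_rpow_Ioo {a s : ℝ} (ha : -1 < a) (hs : 0 < s) :
    ∫⁻ u in Ioo 0 s, ENNReal.ofReal (u ^ a) = ENNReal.ofReal (s ^ (a + 1) / (a + 1)) := by
  have hi : IntegrableOn (fun u : ℝ => u ^ a) (Ioc 0 s) := by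
    have := intervalIntegral.intervalIntegrable_rpow' (a := 0) (b := s) ha
    rwa [intervalIntegrable_iff_integrableOn_Ioc_of_le hs.le] at this
  rw [IntegrableOn, ← restrict_Ioo_eq_restrict_Ioc] at hi
  rw [← ofReal_integral_eq_lintegral_ofReal hi]
  · rw [restrict_Ioo_eq_restrict_Ioc, ← intervalIntegral.integral_of_le hs.le,
      integral_rpow (Or.inl ha), Real.zero_rpow (by linarith), sub_zero]
  · filter_upwards [ae_restrict_mem measurableSet_Ioo] with u hu
    exact Real.rpow_nonneg hu.1.le _

lemma lintegral_rpow_Ioi {a c : ℝ} (ha : a < -1) (hc : 0 < c) :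
    ∫⁻ u in Ioi c, ENNReal.ofReal (u ^ a) = ENNReal.ofReal (c ^ (a + 1) / (-(a + 1))) := by
  rw [← ofReal_integral_eq_lintegral_ofReal (integrableOn_Ioi_rpow_of_lt ha hc),
    integral_Ioi_rpow_of_lt ha hc, div_neg, neg_div]
  filter_upwards [ae_restrict_mem measurableSet_Ioi] with u hu
  exact Real.rpow_nonneg (hc.trans hu).le _

lemma measurable_ofReal_mul_rpow (c a : ℝ) :
    Measurable fun s : ℝ => ENNReal.ofReal (c * s ^ a) := by fun_prop

lemma lintegral_layer {p : ℝ} (hp : 0 < p) (x : ℝ≥0∞) :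
    ∫⁻ s in Ioi (0 : ℝ), {s : ℝ | ENNReal.ofReal s < x}.indicator
      (fun s => ENNReal.ofReal (p * s ^ (p - 1))) s = x ^ p := by
  have hfin : ∀ r : ℝ, 0 < r → ∫⁻ s in Ioi (0 : ℝ), {s : ℝ | ENNReal.ofReal s < .ofReal r}.indicator
      (fun s => ENNReal.ofReal (p * s ^ (p - 1))) s = (ENNReal.ofReal r) ^ p := by
    intro r hr
    have hset : {s : ℝ | ENNReal.ofReal s < .ofReal r} = Iio r := by
      ext s; simp [ENNReal.ofReal_lt_ofReal_iff hr]
    rw [hset, setLIntegral_indicator measurableSet_Iio]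
    have : Iio r ∩ Ioi 0 = Ioo 0 r := by ext; simp [and_comm]
    rw [this]
    simp_rw [ENNReal.ofReal_mul hp.le]
    rw [lintegral_const_mul _ (by fun_prop), lintegral_rpow_Ioo (by linarith) hr,
      ← ENNReal.ofReal_mul hp.le, ENNReal.ofReal_rpow_of_pos hr]
    congr 1
    rw [sub_add_cancel]; field_simp
  induction x with
  | top =>
    rw [ENNReal.top_rpow_of_pos hp]
    refine ENNReal.eq_top_of_forall_nnreal_le fun r => ?_
    have h1 := hfin ((r + 1 : ℝ≥0) ^ (1 / p) : ℝ) (by positivity)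
    rw [← ENNReal.ofReal_rpow_of_pos (by positivity), ← ENNReal.rpow_mul,
      one_div_mul_cancel hp.ne', ENNReal.rpow_one, ENNReal.ofReal_coe_nnreal] at h1
    calc (r : ℝ≥0∞) ≤ ((r + 1 : ℝ≥0) : ℝ≥0∞) := by simp
      _ = _ := h1.symm
      _ ≤ _ := by
        refine lintegral_mono fun s => ?_
        refine indicator_le_indicator_of_subset ?_ (fun _ => zero_le) s
        intro s hs; simp
  | coe x =>
    rcases eq_or_ne x 0 with rfl | hx
    · simp [hp]
    · have := hfin x (by positivity)
      simpa using this

/-- The layer cake formula for the `p`-th power of an extended nonnegative function. -/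
lemma lintegral_rpow_eq_layer {S : Type*} [MeasurableSpace S] (μ : Measure S) [SFinite μ]
    {G : S → ℝ≥0∞} (hG : Measurable G) {p : ℝ} (hp : 0 < p) :
    ∫⁻ x, G x ^ p ∂μ =
      ∫⁻ s in Ioi (0 : ℝ), ENNReal.ofReal (p * s ^ (p - 1)) * μ {x | ENNReal.ofReal s < G x} := by
  simp_rw [← lintegral_layer hp]
  rw [lintegral_lintegral_swap]
  · refine lintegral_congr fun s => ?_
    have : ∀ x, {s : ℝ | ENNReal.ofReal s < G x}.indicator
        (fun s => ENNReal.ofReal (p * s ^ (p - 1))) s =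
        {x | ENNReal.ofReal s < G x}.indicator (fun _ => ENNReal.ofReal (p * s ^ (p - 1))) x := by
      intro x; rfl
    simp_rw [this]
    rw [lintegral_indicator_const (measurableSet_lt measurable_const hG)]
  · refine Measurable.aemeasurable ?_
    have hs : MeasurableSet {z : S × ℝ | ENNReal.ofReal z.2 < G z.1} :=
      measurableSet_lt (by fun_prop) (by fun_prop)
    have : (Function.uncurry fun x s => {s : ℝ | ENNReal.ofReal s < G x}.indicator
        (fun s => ENNReal.ofReal (p * s ^ (p - 1))) s) =
        {z : S × ℝ | ENNReal.ofReal z.2 < G z.1}.indicator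
          (fun z => ENNReal.ofReal (p * z.2 ^ (p - 1))) := by
      ext ⟨x, s⟩; rfl
    rw [this]
    exact Measurable.indicator (by fun_prop) hs

/-- Levels are compared at equal heights, so the layer cake formula transfers the constant to every
power without dependence on `p`. -/
lemma lintegral_rpow_le_of_measure_le {S T : Type*} [MeasurableSpace S] [MeasurableSpace T]
    {μ : Measure S} {ν : Measure T} [SFinite μ] [SFinite ν] {G : S → ℝ≥0∞} {H : T → ℝ≥0∞}
    (hG : Measurable G) (hH : Measurable H) {p : ℝ} (hp : 0 < p) (C : ℝ≥0∞)
    (h : ∀ s : ℝ, 0 < s → μ {x | ENNReal.ofReal s < G x} ≤ C * ν {x | ENNReal.ofReal s < H x}) :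
    ∫⁻ x, G x ^ p ∂μ ≤ C * ∫⁻ x, H x ^ p ∂ν := by
  have hm : Measurable fun s : ℝ => ν {x | ENNReal.ofReal s < H x} := by
    refine Antitone.measurable fun a b hab => measure_mono fun x hx => ?_
    exact (ENNReal.ofReal_le_ofReal hab).trans_lt hx
  have hm' : Measurable fun s : ℝ =>
      ENNReal.ofReal (p * s ^ (p - 1)) * ν {x | ENNReal.ofReal s < H x} :=
    (measurable_ofReal_mul_rpow _ _).mul hm
  rw [lintegral_rpow_eq_layer μ hG hp, lintegral_rpow_eq_layer ν hH hp,
    ← lintegral_const_mul _ hm']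
  refine setLIntegral_mono (hm'.const_mul _) fun s hs => ?_
  calc _ ≤ ENNReal.ofReal (p * s ^ (p - 1)) * (C * ν {x | ENNReal.ofReal s < H x}) := by
        gcongr; exact h s hs
    _ = _ := by ring

/-- Tonelli's theorem on the triangle `0 < u < s`. -/
lemma lintegral_triangle {k w : ℝ → ℝ≥0∞} (hk : Measurable k) (hw : Measurable w) :
    ∫⁻ s in Ioi (0 : ℝ), k s * ∫⁻ u in Ioo 0 s, w u =
      ∫⁻ u in Ioi (0 : ℝ), w u * ∫⁻ s in Ioi u, k s := by
  have h1 : ∀ s, k s * ∫⁻ u in Ioo 0 s, w u =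
      ∫⁻ u in Ioi (0 : ℝ), {z : ℝ × ℝ | z.2 < z.1}.indicator (fun z => k z.1 * w z.2) (s, u) := by
    intro s
    have : ∀ u, {z : ℝ × ℝ | z.2 < z.1}.indicator (fun z => k z.1 * w z.2) (s, u) =
      (Iio s).indicator (fun u => k s * w u) u := by intro u; rfl
    simp_rw [this]
    rw [setLIntegral_indicator measurableSet_Iio, lintegral_const_mul _ hw]
    congr 3
    ext; simp [and_comm]
  have h2 : ∀ u ∈ Ioi (0 : ℝ), w u * ∫⁻ s in Ioi u, k s =
      ∫⁻ s in Ioi (0 : ℝ), {z : ℝ × ℝ | z.2 < z.1}.indicator (fun z => k z.1 * w z.2) (s, u) := by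
    intro u hu
    have : ∀ s, {z : ℝ × ℝ | z.2 < z.1}.indicator (fun z => k z.1 * w z.2) (s, u) =
      (Ioi u).indicator (fun s => k s * w u) s := by intro s; rfl
    simp_rw [this]
    rw [setLIntegral_indicator measurableSet_Ioi, lintegral_mul_const _ hk, mul_comm,
      inter_eq_left.2 (Ioi_subset_Ioi (le_of_lt hu))]
  simp_rw [h1]
  rw [setLIntegral_congr_fun measurableSet_Ioi h2, lintegral_lintegral_swap]
  refine Measurable.aemeasurable ?_
  exact Measurable.indicator (by fun_prop) (measurableSet_lt measurable_snd measurable_fst)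

/-- Hardy's inequality. -/
lemma hardy_le {h : ℝ → ℝ≥0∞} (hh : Measurable h) {q : ℝ} (hq : 1 < q) :
    ∫⁻ s in Ioi (0 : ℝ), ENNReal.ofReal (s ^ (-q)) * (∫⁻ u in Ioo 0 s, h u) ^ q ≤
      ENNReal.ofReal ((q / (q - 1)) ^ q) * ∫⁻ u in Ioi (0 : ℝ), h u ^ q := by
  set q' := q / (q - 1) with hq'
  have hq1 : 0 < q - 1 := by linarith
  have hq0 : 0 < q := by linarith
  have hq'0 : 0 < q' := by positivity
  have hconj : q.HolderConjugate q' := Real.HolderConjugate.conjExponent hq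
  have key : ∀ s ∈ Ioi (0 : ℝ), ENNReal.ofReal (s ^ (-q)) * (∫⁻ u in Ioo 0 s, h u) ^ q ≤
      ENNReal.ofReal (q' ^ (q - 1)) * (ENNReal.ofReal (s ^ (-1 - 1 / q')) *
        ∫⁻ u in Ioo 0 s, h u ^ q * ENNReal.ofReal (u ^ (1 / q'))) := by
    intro s hs
    have hs : 0 < s := hs
    -- The weight `u^{1/(qq')}` in Hölder's inequality yields the constant `(q')^q` exactly. Its
    -- precise size matters, since `q' = 1/θ` blows up as `θ → 0`.
    have e1 : ∫⁻ u in Ioo 0 s, h u = ∫⁻ u in Ioo 0 s,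
        ((fun u => h u * ENNReal.ofReal (u ^ (1 / (q * q')))) *
          fun u => ENNReal.ofReal (u ^ (-(1 / (q * q'))))) u := by
      refine setLIntegral_congr_fun measurableSet_Ioo fun u hu => ?_
      simp only [Pi.mul_apply]
      rw [mul_assoc, ← ENNReal.ofReal_mul (Real.rpow_nonneg hu.1.le _), ← Real.rpow_add hu.1]
      simp
    have e2 := ENNReal.lintegral_mul_le_Lp_mul_Lq (volume.restrict (Ioo 0 s)) hconj
      (f := fun u => h u * ENNReal.ofReal (u ^ (1 / (q * q'))))
      (g := fun u => ENNReal.ofReal (u ^ (-(1 / (q * q'))))) (by fun_prop) (by fun_prop)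
    rw [← e1] at e2
    have e3 : ∫⁻ u in Ioo 0 s, (h u * ENNReal.ofReal (u ^ (1 / (q * q')))) ^ q =
        ∫⁻ u in Ioo 0 s, h u ^ q * ENNReal.ofReal (u ^ (1 / q')) := by
      refine setLIntegral_congr_fun measurableSet_Ioo fun u hu => ?_
      rw [ENNReal.mul_rpow_of_nonneg _ _ hq0.le,
        ENNReal.ofReal_rpow_of_pos (Real.rpow_pos_of_pos hu.1 _), ← Real.rpow_mul hu.1.le]
      congr 3; field_simp
    have e4 : ∫⁻ u in Ioo 0 s, (ENNReal.ofReal (u ^ (-(1 / (q * q'))))) ^ q' =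
        ENNReal.ofReal (q' * s ^ (1 / q')) := by
      have : ∀ u ∈ Ioo 0 s, (ENNReal.ofReal (u ^ (-(1 / (q * q'))))) ^ q' =
          ENNReal.ofReal (u ^ (-(1 / q))) := by
        intro u hu
        rw [ENNReal.ofReal_rpow_of_pos (Real.rpow_pos_of_pos hu.1 _), ← Real.rpow_mul hu.1.le]
        congr 2; field_simp
      rw [setLIntegral_congr_fun measurableSet_Ioo this, lintegral_rpow_Ioo _ hs]
      · congr 1
        have : -(1 / q) + 1 = 1 / q' := by rw [hq']; field_simp; ring
        rw [this]; field_simp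
      · have : 1 / q < 1 := by rw [div_lt_one hq0]; exact hq
        linarith
    rw [e3, e4] at e2
    have e5 := ENNReal.rpow_le_rpow e2 hq0.le
    rw [ENNReal.mul_rpow_of_nonneg _ _ hq0.le, ← ENNReal.rpow_mul, one_div_mul_cancel hq0.ne',
      ENNReal.rpow_one, ← ENNReal.rpow_mul, ENNReal.ofReal_rpow_of_pos (by positivity)] at e5
    have e6 : 1 / q' * q = q - 1 := by rw [hq']; field_simp
    rw [e6] at e5
    refine (mul_le_mul_right e5 _).trans (le_of_eq ?_)
    have e7 : ENNReal.ofReal (s ^ (-q)) * ENNReal.ofReal ((q' * s ^ (1 / q')) ^ (q - 1)) =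
        ENNReal.ofReal (q' ^ (q - 1)) * ENNReal.ofReal (s ^ (-1 - 1 / q')) := by
      rw [← ENNReal.ofReal_mul (by positivity), ← ENNReal.ofReal_mul (by positivity)]
      congr 1
      rw [Real.mul_rpow hq'0.le (by positivity), ← Real.rpow_mul hs.le, mul_left_comm,
        ← Real.rpow_add hs]
      congr 2
      rw [hq']; field_simp; ring
    rw [mul_comm (∫⁻ u in Ioo 0 s, _), ← mul_assoc, e7, mul_assoc]
  refine (setLIntegral_mono' measurableSet_Ioi key).trans ?_
  have hm : Measurable fun s => ∫⁻ u in Ioo 0 s, h u ^ q * ENNReal.ofReal (u ^ (1 / q')) := by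
    refine Monotone.measurable fun a b hab => ?_
    exact lintegral_mono_set (Ioo_subset_Ioo_right hab)
  rw [lintegral_const_mul _ (by fun_prop), lintegral_triangle (by fun_prop) (by fun_prop)]
  have e8 : ∀ u ∈ Ioi (0 : ℝ), h u ^ q * ENNReal.ofReal (u ^ (1 / q')) *
      ∫⁻ s in Ioi u, ENNReal.ofReal (s ^ (-1 - 1 / q')) = ENNReal.ofReal q' * h u ^ q := by
    intro u hu
    have hu : 0 < u := hu
    have : 0 < 1 / q' := by positivity
    rw [lintegral_rpow_Ioi (by linarith) hu, mul_assoc, ← ENNReal.ofReal_mul (by positivity),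
      mul_comm]
    congr 2
    rw [show -1 - 1 / q' + 1 = -(1 / q') by ring, Real.rpow_neg hu.le]
    field_simp
  rw [setLIntegral_congr_fun measurableSet_Ioi e8, lintegral_const_mul _ (by fun_prop), ← mul_assoc,
    ← ENNReal.ofReal_mul (by positivity)]
  gcongr
  rw [← Real.rpow_add_one hq'0.ne', sub_add_cancel]

/-- The reverse Hardy inequality for non-increasing functions. -/
lemma le_hardy {h : ℝ → ℝ≥0∞} (hh : Antitone h) {q : ℝ} (hq : 1 < q) :
    ∫⁻ u in Ioi (0 : ℝ), h u ^ q ≤ ENNReal.ofReal (q - 1) *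
      ∫⁻ s in Ioi (0 : ℝ), ENNReal.ofReal (s ^ (-q)) * (∫⁻ u in Ioo 0 s, h u) ^ q := by
  have hq1 : 0 < q - 1 := by linarith
  have hm := hh.measurable
  have key : ∀ s ∈ Ioi (0 : ℝ),
      ENNReal.ofReal (s ^ (-q)) * ∫⁻ u in Ioo 0 s, ENNReal.ofReal (u ^ (q - 1)) * h u ^ q ≤
      ENNReal.ofReal (s ^ (-q)) * (∫⁻ u in Ioo 0 s, h u) ^ q := by
    intro s hs
    gcongr
    -- Monotonicity gives `u h(u) ≤ ∫₀^u h ≤ ∫₀^s h`; raising this to the power `q - 1` leaves one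
    -- factor `h u` to integrate. Nothing is differentiated, so `∫₀^s h` may be infinite.
    have hmono : ∀ u ∈ Ioo 0 s, ENNReal.ofReal (u ^ (q - 1)) * h u ^ q ≤
        (∫⁻ u in Ioo 0 s, h u) ^ (q - 1) * h u := by
      intro u hu
      have e1 : ENNReal.ofReal u * h u ≤ ∫⁻ u in Ioo 0 s, h u := by
        calc ENNReal.ofReal u * h u = ∫⁻ _ in Ioo 0 u, h u := by simp [mul_comm]
          _ ≤ ∫⁻ v in Ioo 0 u, h v :=
            setLIntegral_mono' measurableSet_Ioo fun v hv => hh hv.2.le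
          _ ≤ _ := lintegral_mono_set (Ioo_subset_Ioo_right hu.2.le)
      have e2 : h u ^ q = h u ^ (q - 1) * h u := by
        conv_lhs => rw [← sub_add_cancel q 1]
        rw [ENNReal.rpow_add_of_nonneg _ _ hq1.le zero_le_one, ENNReal.rpow_one]
      rw [e2, ← mul_assoc]
      gcongr
      rw [← ENNReal.ofReal_rpow_of_pos hu.1, ← ENNReal.mul_rpow_of_nonneg _ _ hq1.le]
      gcongr
    calc _ ≤ ∫⁻ v in Ioo 0 s, (∫⁻ u in Ioo 0 s, h u) ^ (q - 1) * h v :=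
          setLIntegral_mono' measurableSet_Ioo hmono
      _ = (∫⁻ u in Ioo 0 s, h u) ^ (q - 1) * ∫⁻ v in Ioo 0 s, h v := lintegral_const_mul _ hm
      _ = _ := by
        conv_rhs => rw [← sub_add_cancel q 1]
        rw [ENNReal.rpow_add_of_nonneg _ _ hq1.le zero_le_one, ENNReal.rpow_one]
  refine le_trans (le_of_eq ?_) (mul_le_mul_right (setLIntegral_mono' measurableSet_Ioi key) _)
  rw [lintegral_triangle (by fun_prop) (by fun_prop)]
  have e8 : ∀ u ∈ Ioi (0 : ℝ), ENNReal.ofReal (u ^ (q - 1)) * h u ^ q *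
      ∫⁻ s in Ioi u, ENNReal.ofReal (s ^ (-q)) = ENNReal.ofReal (1 / (q - 1)) * h u ^ q := by
    intro u hu
    have hu : 0 < u := hu
    rw [lintegral_rpow_Ioi (by linarith) hu, mul_right_comm, ← ENNReal.ofReal_mul (by positivity)]
    congr 2
    rw [show -q + 1 = -(q - 1) by ring, Real.rpow_neg hu.le, neg_neg]
    field_simp
  rw [setLIntegral_congr_fun measurableSet_Ioi e8, lintegral_const_mul _ (by fun_prop), ← mul_assoc,
    ← ENNReal.ofReal_mul (by positivity), mul_one_div_cancel hq1.ne']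
  simp

lemma lintegral_comp_rpow_Ioi (F : ℝ → ℝ≥0∞) {a : ℝ} (ha : 0 < a) :
    ∫⁻ t in Ioi (0 : ℝ), ENNReal.ofReal (a * t ^ (a - 1)) * F (t ^ a) =
      ∫⁻ s in Ioi (0 : ℝ), F s := by
  have himg : (fun t : ℝ => t ^ a) '' Ioi 0 = Ioi 0 := by
    ext s
    constructor
    · rintro ⟨t, ht, rfl⟩; exact Real.rpow_pos_of_pos ht _
    · intro hs
      refine ⟨s ^ (1 / a), Real.rpow_pos_of_pos hs _, ?_⟩
      simp only
      rw [← Real.rpow_mul (le_of_lt hs), one_div_mul_cancel ha.ne', Real.rpow_one]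
  have := lintegral_image_eq_lintegral_abs_deriv_mul (s := Ioi (0 : ℝ)) (f := fun t => t ^ a)
    (f' := fun t => a * t ^ (a - 1)) measurableSet_Ioi
    (fun t ht => (Real.hasDerivAt_rpow_const (Or.inl (ne_of_gt ht))).hasDerivWithinAt)
    (fun x hx y hy hxy => (Real.rpow_left_inj (le_of_lt hx) (le_of_lt hy) ha.ne').1 hxy) F
  rw [himg] at this
  rw [this]
  refine setLIntegral_congr_fun measurableSet_Ioi fun t ht => ?_
  have ht : 0 < t := ht
  rw [abs_of_nonneg (by positivity)]

/-! ### The rearrangement and the interpolation norm -/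

section Rearr

variable {S : Type*} [MeasurableSpace S] {μ : Measure S} {G : S → ℝ≥0∞}

/-- The non-increasing rearrangement of an extended nonnegative function. -/
def rearr (μ : Measure S) (G : S → ℝ≥0∞) (t : ℝ) : ℝ≥0∞ :=
  sInf {s : ℝ≥0∞ | μ {x | s < G x} ≤ ENNReal.ofReal t}

/-- The infimum in the rearrangement is attained, by continuity of the measure along increasing
superlevel sets. -/
lemma measure_sInf_lt_le (t : ℝ≥0∞) : μ {x | sInf {s : ℝ≥0∞ | μ {x | s < G x} ≤ t} < G x} ≤ t := by
  set A := {s : ℝ≥0∞ | μ {x | s < G x} ≤ t}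
  have hne : A.Nonempty := ⟨⊤, by simp [A]⟩
  obtain ⟨u, hu, -, hlim, hmem⟩ := (isGLB_sInf A).exists_seq_antitone_tendsto hne
  have : {x | sInf A < G x} = ⋃ n, {x | u n < G x} := by
    ext x
    simp only [mem_ofPred_eq, mem_iUnion]
    constructor
    · intro h
      exact ((hlim.eventually (gt_mem_nhds h))).exists
    · rintro ⟨n, hn⟩
      exact (sInf_le (hmem n)).trans_lt hn
  have hmono : Monotone fun n => {x | u n < G x} := fun a b hab x hx => (hu hab).trans_lt hx
  rw [this, hmono.measure_iUnion]
  exact iSup_le hmem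

lemma measure_rearr_lt_le (t : ℝ) : μ {x | rearr μ G t < G x} ≤ ENNReal.ofReal t :=
  measure_sInf_lt_le _

lemma lt_rearr_iff {t : ℝ} {u : ℝ≥0∞} : u < rearr μ G t ↔ ENNReal.ofReal t < μ {x | u < G x} := by
  constructor
  · intro h
    by_contra! hc
    exact (not_le.2 h) (sInf_le hc)
  · intro h
    by_contra! hc
    refine not_le.2 h ((measure_mono fun x hx => ?_).trans (measure_rearr_lt_le (G := G) t))
    exact hc.trans_lt hx

lemma antitone_rearr : Antitone (rearr μ G) := fun _ _ hab =>
  sInf_le_sInf fun _ hs => le_trans hs (ENNReal.ofReal_le_ofReal hab)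

lemma volume_lt_rearr (u : ℝ≥0∞) :
    (volume.restrict (Ioi (0 : ℝ))) {t | u < rearr μ G t} = μ {x | u < G x} := by
  simp_rw [lt_rearr_iff]
  generalize μ {x | u < G x} = b
  rw [Measure.restrict_apply (measurableSet_lt (by fun_prop) (by fun_prop))]
  induction b with
  | top => simp
  | coe b =>
    rcases eq_or_ne b 0 with rfl | hb
    · simp
    · have : {t : ℝ | ENNReal.ofReal t < b} ∩ Ioi 0 = Ioo 0 (b : ℝ) := by
        ext t
        simp only [mem_inter_iff, mem_ofPred_eq, mem_Ioi, mem_Ioo]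
        rw [and_comm]
        refine and_congr_right fun ht => ?_
        rw [← ENNReal.ofReal_coe_nnreal, ENNReal.ofReal_lt_ofReal_iff (by positivity)]
      rw [this]
      simp

lemma lintegral_rearr_rpow [SFinite μ] (hG : Measurable G) {p : ℝ} (hp : 0 < p) :
    ∫⁻ t in Ioi (0 : ℝ), rearr μ G t ^ p = ∫⁻ x, G x ^ p ∂μ := by
  refine le_antisymm ?_ ?_
  · have := lintegral_rpow_le_of_measure_le (μ := volume.restrict (Ioi (0 : ℝ))) (ν := μ)
      (antitone_rearr (G := G)).measurable hG hp 1 fun s _ => by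
        rw [volume_lt_rearr, one_mul]
    simpa using this
  · have := lintegral_rpow_le_of_measure_le (ν := volume.restrict (Ioi (0 : ℝ))) (μ := μ)
      hG (antitone_rearr (G := G)).measurable hp 1 fun s _ => by
        rw [volume_lt_rearr, one_mul]
    simpa using this

/-- The level set has measure at most `T`, so the rearrangement of `G` restricted to it vanishes
from `T` on, and before `T` it is at most that of `G`. -/
lemma lintegral_level_le_rearr [SFinite μ] (hG : Measurable G) {p : ℝ} (hp : 0 < p) (T : ℝ) :
    ∫⁻ x in {x | rearr μ G T < G x}, G x ^ p ∂μ ≤ ∫⁻ t in Ioo 0 T, rearr μ G t ^ p := by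
  set E := {x | rearr μ G T < G x} with hE
  have hEm : MeasurableSet E := measurableSet_lt measurable_const hG
  have h1 : ∫⁻ x in E, G x ^ p ∂μ = ∫⁻ x, (E.indicator G x) ^ p ∂μ := by
    rw [← lintegral_indicator hEm]
    refine lintegral_congr fun x => ?_
    by_cases hx : x ∈ E <;> simp [hx, hp]
  rw [h1, ← lintegral_rearr_rpow (hG.indicator hEm) hp]
  have h2 : ∀ t ∈ Ioi (0 : ℝ), rearr μ (E.indicator G) t ^ p ≤
      (Iio T).indicator (fun t => rearr μ G t ^ p) t := by
    intro t ht
    by_cases htT : t < T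
    · rw [indicator_of_mem (by exact htT)]
      gcongr
      refine sInf_le_sInf fun s hs => (measure_mono fun x hx => ?_).trans hs
      have hx : s < E.indicator G x := hx
      exact lt_of_lt_of_le hx (indicator_le_self' (fun _ _ => zero_le) x)
    · rw [indicator_of_notMem (by exact htT)]
      have : rearr μ (E.indicator G) t ≤ 0 := by
        refine sInf_le ?_
        refine (measure_mono (t := E) fun x hx => ?_).trans
          ((measure_rearr_lt_le (G := G) T).trans (ENNReal.ofReal_le_ofReal (not_lt.1 htT)))
        by_contra hxE
        simp [hxE] at hx
      simp [le_zero_iff.1 this, hp]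
  refine (setLIntegral_mono' measurableSet_Ioi h2).trans ?_
  rw [setLIntegral_indicator measurableSet_Iio]
  refine lintegral_mono_set fun t ht => ⟨ht.2, ht.1⟩

lemma mul_rearr_rpow_le {p T : ℝ} (hp : 0 < p) :
    ENNReal.ofReal T * rearr μ G T ^ p ≤ ∫⁻ t in Ioo 0 T, rearr μ G t ^ p := by
  calc ENNReal.ofReal T * rearr μ G T ^ p = ∫⁻ _ in Ioo 0 T, rearr μ G T ^ p := by simp [mul_comm]
    _ ≤ _ := setLIntegral_mono' measurableSet_Ioo fun t ht => by
        gcongr; exact antitone_rearr ht.2.le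

lemma rearr_le_add_const {H : S → ℝ≥0∞} {c : ℝ≥0∞} (h : ∀ x, G x ≤ H x + c) (t : ℝ) :
    rearr μ G t ≤ rearr μ H t + c := by
  refine sInf_le ?_
  refine (measure_mono fun x hx => ?_).trans (measure_rearr_lt_le (G := H) t)
  have : rearr μ H t + c < H x + c := lt_of_lt_of_le hx (h x)
  exact lt_of_add_lt_add_right this

end Rearr

/-! ### Interpolation norms by Hardy's inequalities, uniformly in `θ` -/

lemma rpow_neg_self_le {θ : ℝ} (h0 : 0 < θ) : θ ^ (-θ) ≤ 3 := by
  have h1 : -1 ≤ θ * Real.log θ := by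
    have := Real.one_sub_inv_le_log_of_pos h0
    have h2 := mul_le_mul_of_nonneg_left this h0.le
    rw [mul_sub, mul_inv_cancel₀ h0.ne'] at h2
    linarith
  rw [Real.rpow_def_of_pos h0]
  calc Real.exp (Real.log θ * -θ) ≤ Real.exp 1 := Real.exp_le_exp.2 (by linarith)
    _ ≤ 3 := by have := Real.exp_one_lt_d9; linarith

/-- The substitution is `s = t^{p₀}`; the remaining exponent `p/p₀ = 1/(1-θ)` no longer involves
`p₀`. -/
lemma lintegral_interp_eq (h : ℝ → ℝ≥0∞) {p₀ θ : ℝ} (hp₀ : 1 ≤ p₀)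
    (h1 : θ < 1) :
    ∫⁻ t in Ioi (0 : ℝ), (ENNReal.ofReal (t ^ (-θ)) *
      (∫⁻ u in Ioo 0 (t ^ p₀), h u) ^ (1 / p₀)) ^ (p₀ / (1 - θ)) / ENNReal.ofReal t =
    ENNReal.ofReal (1 / p₀) * ∫⁻ s in Ioi (0 : ℝ), ENNReal.ofReal (s ^ (-(1 / (1 - θ)))) *
      (∫⁻ u in Ioo 0 s, h u) ^ (1 / (1 - θ)) := by
  have hp0 : 0 < p₀ := by linarith
  have h1' : 0 < 1 - θ := by linarith
  rw [← lintegral_comp_rpow_Ioi (fun s => ENNReal.ofReal (s ^ (-(1 / (1 - θ)))) *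
    (∫⁻ u in Ioo 0 s, h u) ^ (1 / (1 - θ))) hp0, ← lintegral_const_mul' _ _ ENNReal.ofReal_ne_top]
  refine setLIntegral_congr_fun measurableSet_Ioi fun t ht => ?_
  have ht : 0 < t := ht
  rw [ENNReal.mul_rpow_of_nonneg _ _ (by positivity), ← ENNReal.rpow_mul,
    ENNReal.ofReal_rpow_of_pos (by positivity), ← Real.rpow_mul ht.le, ← mul_assoc, ← mul_assoc,
    ← ENNReal.ofReal_mul (by positivity), ← ENNReal.ofReal_mul (by positivity),
    ENNReal.div_eq_inv_mul, ← ENNReal.ofReal_inv_of_pos ht, ← mul_assoc,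
    ← ENNReal.ofReal_mul (by positivity)]
  congr 2
  · rw [← mul_assoc, one_div_mul_cancel hp0.ne', one_mul, ← Real.rpow_mul ht.le,
      ← Real.rpow_neg_one, ← Real.rpow_add ht, ← Real.rpow_add ht]
    congr 1
    field_simp
    ring
  · field_simp

section Interp

variable {S : Type*} [MeasurableSpace S] {μ : Measure S} [SFinite μ] {G : S → ℝ≥0∞}
variable {E : Type*} [AddCommGroup E] {N₀ N₁ : E → ℝ≥0∞} {f : E}

lemma normInterpNorm_eq {θ p : ℝ} (h : 0 ≤ θ * (1 - θ) * p) (hp : 0 < p) :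
    normInterpNorm N₀ N₁ θ p f = (ENNReal.ofReal (θ * (1 - θ) * p) *
      ∫⁻ t in Ioi (0 : ℝ),
        (ENNReal.ofReal (t ^ (-θ)) * peetreK N₀ N₁ t f) ^ p / ENNReal.ofReal t) ^ (1 / p) := by
  rw [normInterpNorm, interpNorm, ENNReal.mul_rpow_of_nonneg _ _ (by positivity),
    ENNReal.ofReal_rpow_of_nonneg h (by positivity)]

lemma normInterpNorm_le (hG : Measurable G) {p₀ θ : ℝ} (hp₀ : 1 ≤ p₀) (h0 : 0 < θ) (h1 : θ < 1)
    (C : ℝ≥0)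
    (hK : ∀ t, 0 < t → peetreK N₀ N₁ t f ≤
      C * (∫⁻ u in Ioo 0 (t ^ p₀), rearr μ G u ^ p₀) ^ (1 / p₀)) :
    normInterpNorm N₀ N₁ θ (p₀ / (1 - θ)) f ≤
      (3 * C : ℝ≥0) * (∫⁻ x, G x ^ (p₀ / (1 - θ)) ∂μ) ^ (1 / (p₀ / (1 - θ))) := by
  have hp0 : 0 < p₀ := by linarith
  have h1' : 0 < 1 - θ := by linarith
  set p := p₀ / (1 - θ) with hp
  have hpp : 0 < p := by positivity
  have hmr : Measurable fun u => rearr μ G u ^ p₀ := (antitone_rearr (G := G)).measurable.pow_const _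
  rw [normInterpNorm_eq (by positivity) hpp]
  have hq : 1 < 1 / (1 - θ) := by rw [lt_div_iff₀ h1']; linarith
  have hqp : 1 / (1 - θ) ≤ p := by rw [hp]; gcongr
  have e0 : ∫⁻ t in Ioi (0 : ℝ),
        (ENNReal.ofReal (t ^ (-θ)) * peetreK N₀ N₁ t f) ^ p / ENNReal.ofReal t ≤
      (C : ℝ≥0∞) ^ p * (ENNReal.ofReal (1 / p₀) * ∫⁻ s in Ioi (0 : ℝ),
        ENNReal.ofReal (s ^ (-(1 / (1 - θ)))) *
          (∫⁻ u in Ioo 0 s, rearr μ G u ^ p₀) ^ (1 / (1 - θ))) := by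
    rw [← lintegral_interp_eq _ hp₀ h1, ← hp, ← lintegral_const_mul']
    · refine setLIntegral_mono' measurableSet_Ioi fun t ht => ?_
      rw [← mul_div_assoc, ← ENNReal.mul_rpow_of_nonneg _ _ hpp.le]
      refine ENNReal.div_le_div_right (ENNReal.rpow_le_rpow ?_ hpp.le) _
      refine (mul_le_mul_right (hK t ht) _).trans (le_of_eq ?_)
      ring
    · exact ENNReal.rpow_ne_top_of_nonneg hpp.le ENNReal.coe_ne_top
  have e1 := hardy_le hmr hq
  have e2 : ∀ u : ℝ, (rearr μ G u ^ p₀) ^ (1 / (1 - θ)) = rearr μ G u ^ p := by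
    intro u; rw [← ENNReal.rpow_mul, hp]; congr 1; field_simp
  simp_rw [e2] at e1
  rw [lintegral_rearr_rpow hG hpp] at e1
  -- Normalization times Hardy's constant is `θ · θ^{-1/(1-θ)} = (θ^{-θ})^{1/(1-θ)}`. As `θ^{-θ}` is
  -- bounded and `1/(1-θ) ≤ p`, the `p`-th root is at most `3`.
  have e3 : ENNReal.ofReal (θ * (1 - θ) * p) * (ENNReal.ofReal (1 / p₀) *
      ENNReal.ofReal ((1 / (1 - θ) / (1 / (1 - θ) - 1)) ^ (1 / (1 - θ)))) ≤ (3 : ℝ≥0∞) ^ p := by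
    rw [← ENNReal.ofReal_mul (by positivity), ← ENNReal.ofReal_mul (by positivity)]
    have e4 : θ * (1 - θ) * p * (1 / p₀ * (1 / (1 - θ) / (1 / (1 - θ) - 1)) ^ (1 / (1 - θ))) =
        (θ ^ (-θ)) ^ (1 / (1 - θ)) := by
      have : 1 / (1 - θ) / (1 / (1 - θ) - 1) = θ⁻¹ := by
        have : 1 / (1 - θ) - 1 = θ / (1 - θ) := by field_simp; ring
        rw [this]; field_simp
      rw [this, ← Real.rpow_mul h0.le, Real.inv_rpow h0.le, ← Real.rpow_neg h0.le, hp]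
      have : θ * (1 - θ) * (p₀ / (1 - θ)) * (1 / p₀ * θ ^ (-(1 / (1 - θ)))) =
          θ ^ (1 : ℝ) * θ ^ (-(1 / (1 - θ))) := by
        rw [Real.rpow_one]; field_simp
      rw [this, ← Real.rpow_add h0]
      congr 1; field_simp; ring
    rw [e4]
    calc ENNReal.ofReal ((θ ^ (-θ)) ^ (1 / (1 - θ))) ≤ ENNReal.ofReal (3 ^ (1 / (1 - θ))) := by
          gcongr; exact rpow_neg_self_le h0
      _ ≤ ENNReal.ofReal (3 ^ p) := by
          gcongr; norm_num
      _ = (3 : ℝ≥0∞) ^ p := by rw [← ENNReal.ofReal_rpow_of_pos (by norm_num)]; norm_num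
  calc _ ≤ ((3 : ℝ≥0∞) ^ p * (C : ℝ≥0∞) ^ p * ∫⁻ x, G x ^ p ∂μ) ^ (1 / p) := by
        refine ENNReal.rpow_le_rpow ?_ (by positivity)
        refine (mul_le_mul_right e0 _).trans ?_
        refine (mul_le_mul_right (mul_le_mul_right (mul_le_mul_right e1 _) _) _).trans ?_
        refine le_trans (le_of_eq ?_)
          (mul_le_mul_left (mul_le_mul_left e3 ((C : ℝ≥0∞) ^ p)) (∫⁻ x, G x ^ p ∂μ))
        ring
    _ = _ := by
        rw [ENNReal.mul_rpow_of_nonneg _ _ (by positivity), ← ENNReal.mul_rpow_of_nonneg _ _ hpp.le,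
          ← ENNReal.rpow_mul, mul_one_div_cancel hpp.ne', ENNReal.rpow_one]
        push_cast
        rfl

lemma le_normInterpNorm (hG : Measurable G) {p₀ θ : ℝ} (hp₀ : 1 ≤ p₀) (h0 : 0 < θ) (h1 : θ < 1)
    (C : ℝ≥0)
    (hK : ∀ t, 0 < t → (∫⁻ u in Ioo 0 (t ^ p₀), rearr μ G u ^ p₀) ^ (1 / p₀) ≤
      C * peetreK N₀ N₁ t f) :
    (∫⁻ x, G x ^ (p₀ / (1 - θ)) ∂μ) ^ (1 / (p₀ / (1 - θ))) ≤
      (2 * C : ℝ≥0) * normInterpNorm N₀ N₁ θ (p₀ / (1 - θ)) f := by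
  have hp0 : 0 < p₀ := by linarith
  have h1' : 0 < 1 - θ := by linarith
  set p := p₀ / (1 - θ) with hp
  have hpp : 0 < p := by positivity
  have hmr : Measurable fun u => rearr μ G u ^ p₀ := (antitone_rearr (G := G)).measurable.pow_const _
  have har : Antitone fun u => rearr μ G u ^ p₀ := fun a b hab => by
    have := antitone_rearr (μ := μ) (G := G) hab
    simp only; gcongr
  rw [normInterpNorm_eq (by positivity) hpp]
  set q := 1 / (1 - θ) with hqdef
  have hq : 1 < q := by rw [hqdef, lt_div_iff₀ h1']; linarith
  have hqp : q ≤ p := by rw [hp, hqdef]; gcongr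
  have e0 : (ENNReal.ofReal (1 / p₀) * ∫⁻ s in Ioi (0 : ℝ),
        ENNReal.ofReal (s ^ (-q)) * (∫⁻ u in Ioo 0 s, rearr μ G u ^ p₀) ^ q) ≤
      (C : ℝ≥0∞) ^ p * ∫⁻ t in Ioi (0 : ℝ),
        (ENNReal.ofReal (t ^ (-θ)) * peetreK N₀ N₁ t f) ^ p / ENNReal.ofReal t := by
    rw [hqdef, ← lintegral_interp_eq _ hp₀ h1, ← hp, ← lintegral_const_mul']
    · refine setLIntegral_mono' measurableSet_Ioi fun t ht => ?_
      rw [← mul_div_assoc, ← ENNReal.mul_rpow_of_nonneg _ _ hpp.le]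
      refine ENNReal.div_le_div_right (ENNReal.rpow_le_rpow ?_ hpp.le) _
      refine (mul_le_mul_right (hK t ht) _).trans (le_of_eq ?_)
      ring
    · exact ENNReal.rpow_ne_top_of_nonneg hpp.le ENNReal.coe_ne_top
  have e1 := le_hardy har hq
  have e2 : ∀ u : ℝ, (rearr μ G u ^ p₀) ^ q = rearr μ G u ^ p := by
    intro u; rw [← ENNReal.rpow_mul, hp, hqdef]; congr 1; field_simp
  simp_rw [e2] at e1
  rw [lintegral_rearr_rpow hG hpp] at e1
  set J := ∫⁻ t in Ioi (0 : ℝ),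
        (ENNReal.ofReal (t ^ (-θ)) * peetreK N₀ N₁ t f) ^ p / ENNReal.ofReal t
  set I := ∫⁻ s in Ioi (0 : ℝ),
        ENNReal.ofReal (s ^ (-q)) * (∫⁻ u in Ioo 0 s, rearr μ G u ^ p₀) ^ q
  -- The reverse Hardy constant `q - 1 = qθ` is the normalization `θ(1-θ)p/p₀ = θ` times a surplus
  -- `q`. Bernoulli's inequality bounds the surplus by `2^q ≤ 2^p`, harmless after the `p`-th root.
  have hq2 : ENNReal.ofReal q ≤ (2 : ℝ≥0∞) ^ p := by
    calc ENNReal.ofReal q ≤ ENNReal.ofReal (2 ^ p) := by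
          gcongr
          calc q ≤ 1 + q * 1 := by linarith
            _ ≤ (1 + 1) ^ q := one_add_mul_self_le_rpow_one_add (by norm_num) hq.le
            _ ≤ 2 ^ p := by norm_num; gcongr
      _ = (2 : ℝ≥0∞) ^ p := by rw [← ENNReal.ofReal_rpow_of_pos (by norm_num)]; norm_num
  have e5 : ENNReal.ofReal (q - 1) =
      ENNReal.ofReal q * (ENNReal.ofReal (θ * (1 - θ) * p) * ENNReal.ofReal (1 / p₀)) := by
    rw [← ENNReal.ofReal_mul (by positivity), ← ENNReal.ofReal_mul (by positivity)]
    congr 1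
    rw [hp, hqdef]; field_simp; ring
  calc _ ≤ ((2 : ℝ≥0∞) ^ p * (C : ℝ≥0∞) ^ p * (ENNReal.ofReal (θ * (1 - θ) * p) * J)) ^ (1 / p) := by
        gcongr
        calc _ ≤ ENNReal.ofReal (q - 1) * I := e1
          _ = ENNReal.ofReal q * ENNReal.ofReal (θ * (1 - θ) * p) *
              (ENNReal.ofReal (1 / p₀) * I) := by rw [e5]; ring
          _ ≤ (2 : ℝ≥0∞) ^ p * ENNReal.ofReal (θ * (1 - θ) * p) * ((C : ℝ≥0∞) ^ p * J) := by
              gcongr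
          _ = _ := by ring
    _ = _ := by
        rw [ENNReal.mul_rpow_of_nonneg _ _ (by positivity), ← ENNReal.mul_rpow_of_nonneg _ _ hpp.le,
          ← ENNReal.rpow_mul, mul_one_div_cancel hpp.ne', ENNReal.rpow_one]
        push_cast
        rfl

end Interp

/-! ### Medians -/

section Median

variable {S : Type*} [MeasurableSpace S] {μ : Measure S}

/-- A median of `f` over the set `s`. -/
def median (μ : Measure S) (f : S → ℝ) (s : Set S) : ℝ :=
  sInf {c | μ (s ∩ {x | c < f x}) ≤ μ s / 2}

lemma half_le_measure_diff {s t : Set S} (ht : MeasurableSet t) (h2 : μ s ≠ ∞)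
    (h : μ (s ∩ t) ≤ μ s / 2) : μ s / 2 ≤ μ (s \ t) := by
  have h3 : μ s / 2 + μ s / 2 ≤ μ s / 2 + μ (s \ t) := by
    rw [ENNReal.add_halves, ← measure_inter_add_sdiff s ht]
    gcongr
    rwa [measure_inter_add_sdiff s ht]
  exact (ENNReal.add_le_add_iff_left (ENNReal.div_ne_top h2 (by simp))).1 h3

/-- Since `0 < μ s < ∞`, the set defining the median is nonempty and bounded below, so its `sInf` is
a genuine infimum. Both halves then follow by letting the level tend to it from above and from
below. -/
lemma median_halves {f : S → ℝ} (hf : Measurable f) {s : Set S} (h1 : μ s ≠ 0) (h2 : μ s ≠ ∞) :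
    μ s / 2 ≤ μ (s ∩ {x | f x ≤ median μ f s}) ∧ μ s / 2 ≤ μ (s ∩ {x | median μ f s ≤ f x}) := by
  set A := {c : ℝ | μ (s ∩ {x | c < f x}) ≤ μ s / 2} with hA
  have hhalf : μ s / 2 < μ s := ENNReal.half_lt_self h1 h2
  have hmeas : ∀ c, MeasurableSet {x | c < f x} := fun c => measurableSet_lt measurable_const hf
  have hbdd : BddBelow A := by
    have hU : s = ⋃ n : ℕ, s ∩ {x | -(n : ℝ) < f x} := by
      rw [← inter_iUnion, eq_comm, inter_eq_left]
      intro x _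
      obtain ⟨n, hn⟩ := exists_nat_gt (-f x)
      exact mem_iUnion.2 ⟨n, by simp only [mem_ofPred_eq]; linarith⟩
    have hmono : Monotone fun n : ℕ => s ∩ {x | -(n : ℝ) < f x} := fun a b hab x hx => by
      have h3 : -(a : ℝ) < f x := hx.2
      have h4 : (a : ℝ) ≤ b := by exact_mod_cast hab
      exact ⟨hx.1, show -(b : ℝ) < f x by linarith⟩
    have h3 : μ s / 2 < ⨆ n : ℕ, μ (s ∩ {x | -(n : ℝ) < f x}) := by
      rw [← hmono.measure_iUnion, ← hU]; exact hhalf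
    obtain ⟨n, hn⟩ := lt_iSup_iff.1 h3
    refine ⟨-(n : ℝ), fun c hc => ?_⟩
    by_contra! hlt
    refine not_le.2 hn ((measure_mono ?_).trans hc)
    exact inter_subset_inter_right _ fun x hx => hlt.trans hx
  have hne : A.Nonempty := by
    by_contra hemp
    rw [not_nonempty_iff_eq_empty] at hemp
    have hall : ∀ n : ℕ, μ (s ∩ {x | f x ≤ n}) ≤ μ s / 2 := by
      intro n
      have h3 : (n : ℝ) ∉ A := by simp [hemp]
      have h4 : μ s / 2 ≤ μ (s ∩ {x | (n : ℝ) < f x}) := (not_le.1 h3).le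
      by_contra! h5
      have := ENNReal.add_lt_add_of_le_of_lt (ENNReal.div_ne_top h2 (by simp)) h4 h5
      rw [ENNReal.add_halves, ← measure_inter_add_sdiff s (hmeas n)] at this
      refine lt_irrefl _ (this.trans_le (add_le_add le_rfl (measure_mono fun x hx => ?_)))
      exact ⟨hx.1, mem_compl_iff _ _ |>.2 (by simpa using hx.2)⟩
    have hU : s = ⋃ n : ℕ, s ∩ {x | f x ≤ n} := by
      rw [← inter_iUnion, eq_comm, inter_eq_left]
      intro x _
      obtain ⟨n, hn⟩ := exists_nat_gt (f x)
      exact mem_iUnion.2 ⟨n, hn.le⟩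
    have hmono : Monotone fun n : ℕ => s ∩ {x | f x ≤ (n : ℝ)} := fun a b hab x hx =>
      ⟨hx.1, show f x ≤ b from le_trans (show f x ≤ a from hx.2) (by exact_mod_cast hab)⟩
    refine not_le.2 hhalf ?_
    conv_lhs => rw [hU]
    rw [hmono.measure_iUnion]
    exact iSup_le hall
  set m := median μ f s with hm
  have hseq : ∀ n : ℕ, (0 : ℝ) < 1 / ((n : ℝ) + 1) := fun n => by positivity
  have hanti : ∀ {a b : ℕ}, a ≤ b → 1 / ((b : ℝ) + 1) ≤ 1 / ((a : ℝ) + 1) := fun hab =>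
    one_div_le_one_div_of_le (by positivity) (by simpa using hab)
  constructor
  · have h3 : μ (s ∩ {x | m < f x}) ≤ μ s / 2 := by
      have hU : s ∩ {x | m < f x} = ⋃ n : ℕ, s ∩ {x | m + 1 / ((n : ℝ) + 1) < f x} := by
        rw [← inter_iUnion]
        congr 1
        ext x
        simp only [mem_ofPred_eq, mem_iUnion]
        constructor
        · intro h
          obtain ⟨n, hn⟩ := exists_nat_one_div_lt (sub_pos.2 h)
          exact ⟨n, by linarith⟩
        · rintro ⟨n, hn⟩; linarith [hseq n]
      have hmono : Monotone fun n : ℕ => s ∩ {x | m + 1 / ((n : ℝ) + 1) < f x} :=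
        fun a b hab x hx => ⟨hx.1, lt_of_le_of_lt (add_le_add le_rfl (hanti hab))
          (show m + 1 / ((a : ℝ) + 1) < f x from hx.2)⟩
      rw [hU, hmono.measure_iUnion]
      refine iSup_le fun n => ?_
      obtain ⟨c, hc, hlt⟩ := exists_lt_of_csInf_lt hne (lt_add_of_pos_right m (hseq n))
      refine (measure_mono ?_).trans hc
      exact inter_subset_inter_right _ fun x hx => hlt.trans hx
    refine (half_le_measure_diff (hmeas m) h2 h3).trans (measure_mono fun x hx => ⟨hx.1, ?_⟩)
    simpa using hx.2
  · have h3 : μ (s ∩ {x | f x < m}) ≤ μ s / 2 := by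
      have hU : s ∩ {x | f x < m} = ⋃ n : ℕ, s ∩ {x | f x ≤ m - 1 / ((n : ℝ) + 1)} := by
        rw [← inter_iUnion]
        congr 1
        ext x
        simp only [mem_ofPred_eq, mem_iUnion]
        constructor
        · intro h
          obtain ⟨n, hn⟩ := exists_nat_one_div_lt (sub_pos.2 h)
          exact ⟨n, by linarith⟩
        · rintro ⟨n, hn⟩; linarith [hseq n]
      have hmono : Monotone fun n : ℕ => s ∩ {x | f x ≤ m - 1 / ((n : ℝ) + 1)} :=
        fun a b hab x hx => ⟨hx.1, le_trans (show f x ≤ m - 1 / ((a : ℝ) + 1) from hx.2)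
          (sub_le_sub le_rfl (hanti hab))⟩
      rw [hU, hmono.measure_iUnion]
      refine iSup_le fun n => ?_
      have hnot : m - 1 / ((n : ℝ) + 1) ∉ A := fun h => by
        have := csInf_le hbdd h
        have hn := hseq n
        have : m ≤ m - 1 / ((n : ℝ) + 1) := this
        linarith
      have h4 : μ s / 2 ≤ μ (s ∩ {x | m - 1 / ((n : ℝ) + 1) < f x}) := by
        by_contra! h6
        exact hnot h6.le
      by_contra! h5
      have := ENNReal.add_lt_add_of_le_of_lt (ENNReal.div_ne_top h2 (by simp)) h4 h5
      rw [ENNReal.add_halves, ← measure_inter_add_sdiff s (hmeas (m - 1 / ((n : ℝ) + 1)))] at this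
      refine lt_irrefl _ (this.trans_le (add_le_add le_rfl (measure_mono fun x hx => ?_)))
      exact ⟨hx.1, mem_compl_iff _ _ |>.2 (by simpa using hx.2)⟩
    refine (half_le_measure_diff (measurableSet_lt hf measurable_const) h2 h3).trans
      (measure_mono fun x hx => ⟨hx.1, ?_⟩)
    simpa using hx.2

/-- On at least half of `s` the value of `f` lies on the far side of the median as seen from `a`.
This is how a deviating median produces mass where `f` itself deviates. -/
lemma half_le_measure_median {f : S → ℝ} (hf : Measurable f) {s : Set S} (h1 : μ s ≠ 0)
    (h2 : μ s ≠ ∞) (a : ℝ) : μ s / 2 ≤ μ (s ∩ {x | |median μ f s - a| ≤ |f x - a|}) := by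
  obtain ⟨hl, hr⟩ := median_halves hf h1 h2
  rcases le_total a (median μ f s) with h | h
  · refine hr.trans (measure_mono (inter_subset_inter_right _ fun x hx => ?_))
    have hx : median μ f s ≤ f x := hx
    change |median μ f s - a| ≤ |f x - a|
    rw [abs_of_nonneg (by linarith), abs_of_nonneg (by linarith)]; linarith
  · refine hl.trans (measure_mono (inter_subset_inter_right _ fun x hx => ?_))
    have hx : f x ≤ median μ f s := hx
    change |median μ f s - a| ≤ |f x - a|
    rw [abs_of_nonpos (by linarith), abs_of_nonpos (by linarith)]; linarith

lemma abs_median_sub_le {f : S → ℝ} (hf : Measurable f) {s : Set S} (h1 : μ s ≠ 0)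
    (h2 : μ s ≠ ∞) {a t : ℝ} (h : μ (s ∩ {x | t < |f x - a|}) < μ s / 2) :
    |median μ f s - a| ≤ t := by
  by_contra! hlt
  refine not_lt.2 ((half_le_measure_median hf h1 h2 a).trans (measure_mono ?_)) h
  exact inter_subset_inter_right _ fun x hx => hlt.trans_le hx

end Median

/-! ### Dyadic grids -/

/-- A dyadic grid in a doubling metric measure space: points with the same label of
generation `k` form a cell of generation `k`. -/
structure DyadicGrid {Y : Type*} [PseudoMetricSpace Y] [MeasurableSpace Y] (μ : Measure Y) where
  label : ℤ → Y → (Fin 2 → ℤ)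
  measurable_label : ∀ k, Measurable (label k)
  nested : ∀ k x y, label (k + 1) x = label (k + 1) y → label k x = label k y
  dist_lt : ∀ k x y, label k x = label k y → dist x y < 2 ^ (-k)
  measure_ball_le : ∀ k x, μ (Metric.ball x (2 ^ (-k))) ≤ 4 * μ {y | label k y = label k x}
  doubling : ∀ x r, 0 < r → μ (Metric.ball x (2 * r)) ≤ 4 * μ (Metric.ball x r)
  measure_ball_pos : ∀ x r, 0 < r → 0 < μ (Metric.ball x r)
  measure_ball_lt_top : ∀ x r, μ (Metric.ball x r) < ∞
  infinite_or_cell : μ univ = ∞ ∨ ∃ k x, {y | label k y = label k x} = univ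

namespace DyadicGrid

variable {Y : Type*} [PseudoMetricSpace Y] [MeasurableSpace Y] {μ : Measure Y} (D : DyadicGrid μ)

/-- The cell of generation `k` that contains `x`. -/
def cell (k : ℤ) (x : Y) : Set Y := {y | D.label k y = D.label k x}

variable {D}

lemma mem_cell_self (k : ℤ) (x : Y) : x ∈ D.cell k x := rfl

lemma label_eq_of_le {j k : ℤ} (hjk : j ≤ k) {x y : Y} (h : D.label k x = D.label k y) :
    D.label j x = D.label j y := by
  induction j, hjk using Int.leInductionDown with
  | base => exact h
  | pred n _ ih => exact D.nested _ _ _ (by simpa using ih)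

lemma cell_eq {k : ℤ} {x y : Y} (h : y ∈ D.cell k x) : D.cell k y = D.cell k x := by
  have h : D.label k y = D.label k x := h
  simp only [cell, h]

lemma mem_cell_of_le {j k : ℤ} (hjk : j ≤ k) {x y : Y} (h : y ∈ D.cell k x) : y ∈ D.cell j x :=
  label_eq_of_le hjk h

lemma cell_subset_ball (k : ℤ) (x : Y) : D.cell k x ⊆ Metric.ball x (2 ^ (-k)) :=
  fun _ hy => D.dist_lt k _ _ hy

lemma measurableSet_cell (k : ℤ) (x : Y) : MeasurableSet (D.cell k x) :=
  D.measurable_label k (measurableSet_singleton _)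

lemma measure_cell_ne_zero (k : ℤ) (x : Y) : μ (D.cell k x) ≠ 0 := fun h => by
  have h1 := D.measure_ball_le k x
  change _ ≤ 4 * μ (D.cell k x) at h1
  rw [h, mul_zero] at h1
  exact not_lt.2 h1 (D.measure_ball_pos x _ (by positivity))

lemma measure_cell_ne_top (k : ℤ) (x : Y) : μ (D.cell k x) ≠ ∞ :=
  ((measure_mono (cell_subset_ball k x)).trans_lt (D.measure_ball_lt_top _ _)).ne

lemma measure_ball_pow_le (D : DyadicGrid μ) (n : ℕ) (x : Y) {r : ℝ} (hr : 0 < r) :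
    μ (Metric.ball x (2 ^ n * r)) ≤ 4 ^ n * μ (Metric.ball x r) := by
  induction n with
  | zero => simp
  | succ n ih =>
    rw [pow_succ', mul_assoc, pow_succ', mul_assoc]
    exact (D.doubling _ _ (by positivity)).trans (mul_le_mul_right ih _)

lemma measure_ball_le_cell (n : ℕ) (k : ℤ) (x : Y) {c : Y} {r : ℝ}
    (h : dist c x + r ≤ 2 ^ n * 2 ^ (-k)) :
    μ (Metric.ball c r) ≤ 4 ^ (n + 1) * μ (D.cell k x) := by
  calc μ (Metric.ball c r) ≤ μ (Metric.ball x (2 ^ n * 2 ^ (-k))) :=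
        measure_mono (Metric.ball_subset_ball' (by linarith))
    _ ≤ 4 ^ n * μ (Metric.ball x (2 ^ (-k))) := D.measure_ball_pow_le n x (by positivity)
    _ ≤ 4 ^ n * (4 * μ (D.cell k x)) := mul_le_mul_right (D.measure_ball_le k x) _
    _ = _ := by ring

/-! ### Stopping-time families of cells -/

section Stopping

variable {U : Set Y} {τ : Y → ℤ}

/-- The pairs (generation, label) form a countable index set that splits `U` into disjoint cells;
measurability and countable additivity on `U` come from this. -/
lemma stopping_piece (hinv : ∀ x ∈ U, ∀ y ∈ D.cell (τ x) x, y ∈ U ∧ τ y = τ x)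
    (i : ℤ × (Fin 2 → ℤ)) :
    {x | x ∈ U ∧ τ x = i.1 ∧ D.label i.1 x = i.2} = ∅ ∨
      ∃ x ∈ U, {x | x ∈ U ∧ τ x = i.1 ∧ D.label i.1 x = i.2} = D.cell (τ x) x := by
  rcases eq_empty_or_nonempty {x | x ∈ U ∧ τ x = i.1 ∧ D.label i.1 x = i.2} with h | ⟨x, hx, h1, h2⟩
  · exact Or.inl h
  · refine Or.inr ⟨x, hx, Subset.antisymm ?_ ?_⟩
    · rintro y ⟨-, -, hy⟩
      change D.label (τ x) y = D.label (τ x) x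
      rw [h1, h2, hy]
    · intro y hy
      obtain ⟨h3, h4⟩ := hinv x hx y hy
      refine ⟨h3, h4.trans h1, ?_⟩
      have hy : D.label (τ x) y = D.label (τ x) x := hy
      rw [← h1, hy, h1, h2]

lemma iUnion_stopping_piece :
    U = ⋃ i : ℤ × (Fin 2 → ℤ), {x | x ∈ U ∧ τ x = i.1 ∧ D.label i.1 x = i.2} := by
  ext x
  simp only [mem_iUnion, mem_ofPred_eq]
  exact ⟨fun h => ⟨(τ x, D.label (τ x) x), h, rfl, rfl⟩, fun ⟨_, h, _⟩ => h⟩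

lemma measurableSet_stopping (hinv : ∀ x ∈ U, ∀ y ∈ D.cell (τ x) x, y ∈ U ∧ τ y = τ x) :
    MeasurableSet U := by
  rw [iUnion_stopping_piece (D := D) (U := U) (τ := τ)]
  refine MeasurableSet.iUnion fun i => ?_
  rcases stopping_piece hinv i with h | ⟨x, -, h⟩
  · rw [h]; exact MeasurableSet.empty
  · rw [h]; exact measurableSet_cell _ _

/-- To compare two measures on a union of disjoint cells it suffices to compare them on the
cells. -/
lemma measure_le_of_stopping {ν₁ ν₂ : Measure Y}
    (hinv : ∀ x ∈ U, ∀ y ∈ D.cell (τ x) x, y ∈ U ∧ τ y = τ x)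
    (h : ∀ x ∈ U, ν₁ (D.cell (τ x) x) ≤ ν₂ (D.cell (τ x) x)) : ν₁ U ≤ ν₂ U := by
  rw [iUnion_stopping_piece (D := D) (U := U) (τ := τ)]
  have hm : ∀ i : ℤ × (Fin 2 → ℤ), MeasurableSet {x | x ∈ U ∧ τ x = i.1 ∧ D.label i.1 x = i.2} := by
    intro i
    rcases stopping_piece hinv i with h | ⟨x, -, h⟩
    · rw [h]; exact MeasurableSet.empty
    · rw [h]; exact measurableSet_cell _ _
  have hd : Pairwise (Function.onFun Disjoint fun i : ℤ × (Fin 2 → ℤ) =>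
      {x | x ∈ U ∧ τ x = i.1 ∧ D.label i.1 x = i.2}) := by
    rintro ⟨i, l⟩ ⟨j, l'⟩ hij
    refine Set.disjoint_left.2 ?_
    rintro x ⟨-, h1, h2⟩ ⟨-, h3, h4⟩
    simp only at h1 h2 h3 h4
    refine hij ?_
    rw [← h1, ← h3] at *
    rw [← h2, ← h4]
  rw [measure_iUnion hd hm, measure_iUnion hd hm]
  refine ENNReal.tsum_le_tsum fun i => ?_
  rcases stopping_piece hinv i with h' | ⟨x, hx, h'⟩
  · simp [h']
  · rw [h']; exact h x hx

/-- The first generation in which `P` holds. -/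
def firstTime (P : ℤ → Y → Prop) (x : Y) : ℤ := sInf {k | P k x}

lemma firstTime_spec {Z : Type*} {P : ℤ → Z → Prop} {x : Z} {k₀ : ℤ} (hb : ∀ k, P k x → k₀ ≤ k)
    (h : ∃ k, P k x) : P (firstTime P x) x :=
  Int.csInf_mem (s := {k | P k x}) h ⟨k₀, fun k hk => hb k hk⟩

lemma not_of_lt_firstTime {Z : Type*} {P : ℤ → Z → Prop} {x : Z} {k₀ : ℤ} (hb : ∀ k, P k x → k₀ ≤ k)
    {j : ℤ} (hj : j < firstTime P x) : ¬ P j x := fun h =>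
  not_le.2 hj (csInf_le ⟨k₀, fun k hk => hb k hk⟩ h)

/-- Two points of a cell share all coarser cells, so a property constant on cells cannot start
earlier at one of them than at the other. -/
lemma firstTime_eq {P : ℤ → Y → Prop}
    (hP : ∀ k x, ∀ y ∈ D.cell k x, P k x → P k y) {x : Y} {k₀ : ℤ} (hb : ∀ k, P k x → k₀ ≤ k)
    (h : ∃ k, P k x) {y : Y} (hy : y ∈ D.cell (firstTime P x) x) :
    firstTime P y = firstTime P x := by
  have h1 := firstTime_spec hb h
  have hlow : ∀ j, P j y → firstTime P x ≤ j := by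
    intro j hj
    by_contra! hlt
    refine not_of_lt_firstTime hb hlt (hP j y x ?_ hj)
    exact (mem_cell_of_le hlt.le hy).symm
  refine le_antisymm ?_ ?_
  · exact csInf_le ⟨_, fun j hj => hlow j hj⟩ (hP _ x y hy h1)
  · exact hlow _ (firstTime_spec hlow ⟨_, hP _ x y hy h1⟩)

lemma firstTime_inv {P : ℤ → Y → Prop} {k₀ : ℤ}
    (hP : ∀ k x, ∀ y ∈ D.cell k x, P k x → P k y) (hb : ∀ k x, P k x → k₀ ≤ k) :
    ∀ x ∈ {x | ∃ k, P k x}, ∀ y ∈ D.cell (firstTime P x) x,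
      y ∈ {x | ∃ k, P k x} ∧ firstTime P y = firstTime P x := fun x hx y hy =>
  ⟨⟨_, hP _ x y hy (firstTime_spec (fun k => hb k x) hx)⟩,
    firstTime_eq hP (fun k => hb k x) hx hy⟩

/-- The maximal cells with property `P` are disjoint and cover the set, so testing the two measures
on them is enough. The bound `k₀` guarantees that maximal cells exist. -/
lemma measure_exists_le {P : ℤ → Y → Prop} {k₀ : ℤ} {ν₁ ν₂ : Measure Y}
    (hP : ∀ k x, ∀ y ∈ D.cell k x, P k x → P k y) (hb : ∀ k x, P k x → k₀ ≤ k)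
    (h : ∀ k x, P k x → (∀ j < k, ¬ P j x) → ν₁ (D.cell k x) ≤ ν₂ (D.cell k x)) :
    ν₁ {x | ∃ k, P k x} ≤ ν₂ {x | ∃ k, P k x} :=
  measure_le_of_stopping (firstTime_inv hP hb) fun x hx =>
    h _ x (firstTime_spec (fun k => hb k x) hx)
      fun _ hj => not_of_lt_firstTime (fun k => hb k x) hj

end Stopping

/-! ### Medians over cells and a substitute for Lebesgue differentiation -/

variable (D) in
/-- The median of `f` over the cell of generation `k` that contains `x`. -/
def med (f : Y → ℝ) (k : ℤ) (x : Y) : ℝ := median μ f (D.cell k x)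

lemma med_eq {f : Y → ℝ} {k : ℤ} {x y : Y} (h : y ∈ D.cell k x) : D.med f k y = D.med f k x := by
  rw [med, cell_eq h, med]

lemma measurable_med (f : Y → ℝ) (k : ℤ) : Measurable (D.med f k) :=
  (measurable_of_countable fun l => median μ f {y | D.label k y = l}).comp (D.measurable_label k)

/-- A set in which all small cells around its points have at least half of their measure outside
the set is a null set. -/
lemma measure_eq_zero_of_cells [OpensMeasurableSpace Y] [μ.OuterRegular] {F : Set Y}
    (hF : MeasurableSet F) (hfin : μ F ≠ ∞) (k₀ : ℤ)
    (h : ∀ x ∈ F, ∀ k, k₀ ≤ k → μ (D.cell k x) / 2 ≤ μ (D.cell k x \ F)) : μ F = 0 := by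
  refine le_zero_iff.1 (ENNReal.le_of_forall_pos_le_add fun ε hε _ => ?_)
  rw [zero_add]
  -- The maximal admissible cells inside `V` cover `F`, and each has at most twice the measure of
  -- its part outside `F`. Hence `μ F ≤ 2 μ (V \ F)`, which is small.
  obtain ⟨V, hFV, hVo, hV⟩ := F.exists_isOpen_lt_add (μ := μ) hfin (ε := ε / 2)
    (by simp [hε.ne'])
  set P : ℤ → Y → Prop := fun k x =>
    k₀ ≤ k ∧ D.cell k x ⊆ V ∧ μ (D.cell k x) / 2 ≤ μ (D.cell k x \ F) with hP
  have h1 : μ {x | ∃ k, P k x} ≤ ((2 : ℝ≥0∞) • μ.restrict Fᶜ) {x | ∃ k, P k x} := by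
    refine measure_exists_le (D := D) (k₀ := k₀) (fun k x y hy hx => ?_) (fun k x hx => hx.1)
      fun k x hx _ => ?_
    · simp only [hP, cell_eq hy]; exact hx
    · rw [Measure.smul_apply, Measure.restrict_apply (measurableSet_cell k x), smul_eq_mul,
        ← sdiff_eq]
      · have := hx.2.2
        rw [ENNReal.div_le_iff (by simp) (by simp)] at this
        rwa [mul_comm]
  have h2 : F ⊆ {x | ∃ k, P k x} := by
    intro x hx
    obtain ⟨r, hr, hrV⟩ := Metric.isOpen_iff.1 hVo x (hFV hx)
    obtain ⟨n, hn⟩ := exists_pow_lt_of_lt_one hr (by norm_num : (1 / 2 : ℝ) < 1)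
    refine ⟨max k₀ n, le_max_left _ _, ?_, h x hx _ (le_max_left _ _)⟩
    refine (cell_subset_ball _ _).trans ((Metric.ball_subset_ball ?_).trans hrV)
    calc (2 : ℝ) ^ (-(max k₀ (n : ℤ))) ≤ 2 ^ (-(n : ℤ)) := by
          gcongr
          · norm_num
          · exact le_max_right _ _
      _ = (1 / 2) ^ n := by simp
      _ ≤ r := hn.le
  have h3 : {x | ∃ k, P k x} ⊆ V := fun x ⟨k, hk⟩ => hk.2.1 (mem_cell_self k x)
  calc μ F ≤ μ {x | ∃ k, P k x} := measure_mono h2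
    _ ≤ 2 * μ.restrict Fᶜ {x | ∃ k, P k x} := h1
    _ ≤ 2 * μ.restrict Fᶜ V := by gcongr
    _ = 2 * (μ V - μ F) := by
      rw [Measure.restrict_apply hVo.measurableSet, ← sdiff_eq, measure_sdiff hFV hF.nullMeasurableSet hfin]
    _ ≤ 2 * (ε / 2) := by
      gcongr
      rw [tsub_le_iff_left]; exact hV.le
    _ = ε := ENNReal.mul_div_cancel (by simp) (by simp)

/-- This takes the place of Lebesgue's differentiation theorem: where all small medians are at most
`c + s`, at least half of every small cell satisfies `f ≤ c + s`, so the exceptional points form a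
null set. The lower side is symmetric. -/
lemma ae_abs_sub_le [OpensMeasurableSpace Y] [μ.OuterRegular] {f : Y → ℝ} (hf : Measurable f)
    (k₀ : ℤ) (x₀ : Y) (c s : ℝ) :
    ∀ᵐ x ∂μ, x ∈ D.cell k₀ x₀ → (∀ k, k₀ ≤ k → |D.med f k x - c| ≤ s) → |f x - c| ≤ s := by
  set G := {x | x ∈ D.cell k₀ x₀ ∧ ∀ k, k₀ ≤ k → |D.med f k x - c| ≤ s} with hG
  have hGm : MeasurableSet G := by
    have : G = D.cell k₀ x₀ ∩ ⋂ k, ⋂ (_ : k₀ ≤ k), {x | |D.med f k x - c| ≤ s} := by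
      ext x; simp [hG]
    rw [this]
    refine (measurableSet_cell _ _).inter (MeasurableSet.iInter fun k => MeasurableSet.iInter
      fun _ => measurableSet_le ?_ measurable_const)
    have := measurable_med (D := D) f k
    fun_prop
  have hlt : ∀ F, F ⊆ G → μ F ≠ ∞ := fun F hF =>
    ((measure_mono (hF.trans fun x hx => hx.1)).trans_lt
      (measure_cell_ne_top (D := D) k₀ x₀).lt_top).ne
  have h1 : μ (G ∩ {x | c + s < f x}) = 0 := by
    refine measure_eq_zero_of_cells (D := D) (hGm.inter (measurableSet_lt measurable_const hf))
      (hlt _ inter_subset_left) k₀ fun x hx k hk => ?_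
    refine (median_halves hf (measure_cell_ne_zero k x) (measure_cell_ne_top k x)).1.trans
      (measure_mono fun y hy => ⟨hy.1, fun hy' => ?_⟩)
    have h2 := (abs_le.1 (hx.1.2 k hk)).2
    have h3 : f y ≤ D.med f k x := hy.2
    have h4 : c + s < f y := hy'.2
    linarith
  have h2 : μ (G ∩ {x | f x < c - s}) = 0 := by
    refine measure_eq_zero_of_cells (D := D) (hGm.inter (measurableSet_lt hf measurable_const))
      (hlt _ inter_subset_left) k₀ fun x hx k hk => ?_
    refine (median_halves hf (measure_cell_ne_zero k x) (measure_cell_ne_top k x)).2.trans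
      (measure_mono fun y hy => ⟨hy.1, fun hy' => ?_⟩)
    have h2 := (abs_le.1 (hx.1.2 k hk)).1
    have h3 : D.med f k x ≤ f y := hy.2
    have h4 : f y < c - s := hy'.2
    linarith
  filter_upwards [measure_eq_zero_iff_ae_notMem.1 h1, measure_eq_zero_iff_ae_notMem.1 h2]
    with x h3 h4 hx hk
  rw [abs_le]
  constructor
  · by_contra! h; exact h4 ⟨⟨hx, hk⟩, by change f x < c - s; linarith⟩
  · by_contra! h; exact h3 ⟨⟨hx, hk⟩, by change c + s < f x; linarith⟩

end DyadicGrid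

/-! ### The local Fefferman–Stein inequality -/

section Osc

variable {Y : Type*} [MeasurableSpace Y]

/-- Some constant differs from `f` by more than `s` only on the portion `β` of `B`. -/
def OscLE (μ : Measure Y) (f : Y → ℝ) (β : ℝ≥0∞) (B : Set Y) (s : ℝ) : Prop :=
  ∃ a : ℝ, μ (B ∩ {x | s < |f x - a|}) ≤ β * μ B

/-- `g` dominates the oscillation of `f` over all balls. -/
def OscBound [PseudoMetricSpace Y] (μ : Measure Y) (f : Y → ℝ) (β : ℝ≥0∞) (g : Y → ℝ≥0∞) : Prop :=
  ∀ c r x s, 0 < r → 0 < s → x ∈ Metric.ball c r → g x < ENNReal.ofReal s →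
    OscLE μ f β (Metric.ball c r) s

end Osc

namespace DyadicGrid

variable {Y : Type*} [PseudoMetricSpace Y] [MeasurableSpace Y] {μ : Measure Y} {D : DyadicGrid μ}

/-- The exceptional set occupies a portion at most `β M < 1/2` of the cell, too little to carry the
median away from `a`. -/
lemma abs_med_sub_le {f : Y → ℝ} (hf : Measurable f) {k : ℤ} {x : Y} {B : Set Y}
    (hB : D.cell k x ⊆ B) {β M : ℝ≥0∞} (hM : μ B ≤ M * μ (D.cell k x)) (hβ : β * M < 1 / 2)
    {a s : ℝ} (h : μ (B ∩ {x | s < |f x - a|}) ≤ β * μ B) : |D.med f k x - a| ≤ s := by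
  refine abs_median_sub_le hf (measure_cell_ne_zero k x) (measure_cell_ne_top k x) ?_
  calc μ (D.cell k x ∩ {x | s < |f x - a|}) ≤ μ (B ∩ {x | s < |f x - a|}) :=
        measure_mono (inter_subset_inter_left _ hB)
    _ ≤ β * (M * μ (D.cell k x)) := h.trans (mul_le_mul_right hM _)
    _ = β * M * μ (D.cell k x) := by ring
    _ < 1 / 2 * μ (D.cell k x) := by
      gcongr
      · exact measure_cell_ne_zero k x
      · exact measure_cell_ne_top k x
    _ = μ (D.cell k x) / 2 := by rw [div_eq_mul_inv, div_eq_mul_inv, one_mul, mul_comm]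

variable (D) in
/-- The points of a cell at which some smaller cell has a median that is more than `s` away. -/
def medSet (f : Y → ℝ) (k₀ : ℤ) (x₀ : Y) (s : ℝ) : Set Y :=
  {x | ∃ k, k₀ ≤ k ∧ x ∈ D.cell k₀ x₀ ∧ s < |D.med f k x - D.med f k₀ x₀|}

/-- Stop at the first cell whose median is more than `s` from `m₀`; the parent's median is still
within `s`. If `g < v` somewhere in the cell, `f` is within `v` of a constant `a` on most of a
surrounding ball, and `a` is within `s + v` of `m₀`. Descendants with deviation above `s + 4v` then
carry `|f - a| > v` on half of their measure, so they fill little of the cell. -/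
lemma good_lambda {f : Y → ℝ} (hf : Measurable f) {g : Y → ℝ≥0∞} {β : ℝ≥0∞} (hβ : β ≤ 1 / 256)
    (hg : OscBound μ f β g) (k₀ : ℤ) (x₀ : Y) {s v : ℝ} (hs : 0 ≤ s)
    (hv : 0 < v) :
    μ (D.medSet f k₀ x₀ (s + 4 * v) ∩ {x | g x < ENNReal.ofReal v}) ≤
      1 / 8 * μ (D.medSet f k₀ x₀ s) := by
  set m₀ := D.med f k₀ x₀ with hm₀
  set T := D.medSet f k₀ x₀ (s + 4 * v) ∩ {x | g x < ENNReal.ofReal v} with hT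
  have hsub : T ⊆ D.medSet f k₀ x₀ s := by
    rintro x ⟨⟨k, h1, h2, h3⟩, -⟩
    exact ⟨k, h1, h2, lt_of_le_of_lt (by linarith) h3⟩
  have key : (μ.restrict T) (D.medSet f k₀ x₀ s) ≤ ((1 / 8 : ℝ≥0∞) • μ) (D.medSet f k₀ x₀ s) := by
    refine measure_exists_le (D := D) (k₀ := k₀) (fun k x y hy ⟨h1, h2, h3⟩ => ⟨h1, ?_, ?_⟩)
      (fun k x h => h.1) fun κ x ⟨h1, h2, h3⟩ hfirst => ?_
    · have := mem_cell_of_le h1 hy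
      rw [← cell_eq h2]; exact this
    · rwa [med_eq hy]
    -- In generation `k₀` the deviation is zero, so the parent of the stopping cell still lies in
    -- the admissible range.
    have hκ : k₀ < κ := by
      refine lt_of_le_of_ne h1 fun h => ?_
      subst h
      rw [med_eq h2, sub_self, abs_zero] at h3
      linarith
    rw [Measure.restrict_apply (measurableSet_cell κ x), Measure.smul_apply, smul_eq_mul]
    rcases eq_empty_or_nonempty (D.cell κ x ∩ T) with hemp | ⟨y, hyR, hyT⟩
    · simp [hemp]
    set B := Metric.ball y (2 ^ (-(κ - 1))) with hBdef
    have hpow : (2 : ℝ) ^ (-(κ - 1)) = 2 * 2 ^ (-κ) := by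
      rw [show -(κ - 1) = 1 + -κ by ring, zpow_add₀ two_ne_zero, zpow_one]
    have hp0 : (0 : ℝ) < 2 ^ (-κ) := by positivity
    obtain ⟨a, ha⟩ := hg y (2 ^ (-(κ - 1))) y v (by positivity) hv
      (Metric.mem_ball_self (by positivity)) hyT.2
    have hy2 : y ∈ D.cell (κ - 1) x := mem_cell_of_le (by lia) hyR
    have hxy : dist y x < 2 ^ (-κ) := D.dist_lt κ _ _ hyR
    have hB1 : D.cell (κ - 1) x ⊆ B := by
      rw [← cell_eq hy2]; exact cell_subset_ball _ _
    have hB2 : D.cell κ x ⊆ B := fun z hz => hB1 (mem_cell_of_le (by lia) hz)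
    have hM1 : μ B ≤ 64 * μ (D.cell (κ - 1) x) := by
      refine (measure_ball_le_cell (D := D) 2 (κ - 1) x ?_).trans (by norm_num)
      rw [hpow]; linarith
    have hM2 : μ B ≤ 64 * μ (D.cell κ x) := by
      refine (measure_ball_le_cell (D := D) 2 κ x ?_).trans (by norm_num)
      rw [hpow]; linarith
    have hβ2 : β * 64 < 1 / 2 := by
      refine (mul_le_mul_left hβ 64).trans_lt ?_
      rw [one_div, ← ENNReal.div_eq_inv_mul, ENNReal.div_lt_iff (by simp) (by simp), one_div,
        ← ENNReal.div_eq_inv_mul, ENNReal.lt_div_iff_mul_lt (by simp) (by simp)]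
      norm_num
    have hm1 : |D.med f (κ - 1) x - a| ≤ v := abs_med_sub_le hf hB1 hM1 hβ2 ha
    have hprev : |D.med f (κ - 1) x - m₀| ≤ s := by
      by_contra! hlt
      exact hfirst (κ - 1) (by lia) ⟨by lia, h2, hlt⟩
    set P : ℤ → Y → Prop := fun k z =>
      κ ≤ k ∧ z ∈ D.cell κ x ∧ s + 4 * v < |D.med f k z - m₀| with hP
    -- Generations coarser than `κ` cannot be responsible: their medians are shared with `x`, and by
    -- the choice of `κ` they deviate by at most `s`.
    have hTP : D.cell κ x ∩ T ⊆ {z | ∃ k, P k z} := by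
      rintro z ⟨hzR, ⟨k, hk1, hk2, hk3⟩, -⟩
      refine ⟨k, ?_, hzR, hk3⟩
      by_contra! hlt
      refine hfirst k hlt ⟨hk1, h2, ?_⟩
      rw [← med_eq (mem_cell_of_le hlt.le hzR)]
      exact lt_of_le_of_lt (by linarith) hk3
    have hPR : {z | ∃ k, P k z} ⊆ D.cell κ x := fun z ⟨k, hk⟩ => hk.2.1
    have hFm : MeasurableSet {z | v < |f z - a|} :=
      measurableSet_lt measurable_const (by fun_prop)
    have h5 : μ {z | ∃ k, P k z} ≤
        ((2 : ℝ≥0∞) • μ.restrict {z | v < |f z - a|}) {z | ∃ k, P k z} := by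
      refine measure_exists_le (D := D) (k₀ := κ)
        (fun k z w hw ⟨h1, h2, h3⟩ => ⟨h1, ?_, by rwa [med_eq hw]⟩)
        (fun k z hz => hz.1) fun k z ⟨h1, h2, h3⟩ _ => ?_
      · rw [← cell_eq h2]; exact mem_cell_of_le h1 hw
      rw [Measure.smul_apply, Measure.restrict_apply (measurableSet_cell k z), smul_eq_mul]
      have h6 := half_le_measure_median hf (measure_cell_ne_zero (D := D) k z)
        (measure_cell_ne_top k z) a
      rw [ENNReal.div_le_iff (by simp) (by simp), mul_comm] at h6
      refine h6.trans (mul_le_mul_right (measure_mono (inter_subset_inter_right _ fun w hw => ?_)) _)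
      have hw : |D.med f k z - a| ≤ |f w - a| := hw
      change v < |f w - a|
      refine lt_of_lt_of_le ?_ hw
      have e1 := abs_sub_le (D.med f k z) a m₀
      have e2 := abs_sub_le a (D.med f (κ - 1) x) m₀
      rw [abs_sub_comm a (D.med f (κ - 1) x)] at e2
      linarith
    calc μ (D.cell κ x ∩ T) ≤ μ {z | ∃ k, P k z} := measure_mono hTP
      _ ≤ 2 * μ.restrict {z | v < |f z - a|} {z | ∃ k, P k z} := h5
      _ ≤ 2 * μ.restrict {z | v < |f z - a|} (D.cell κ x) := by gcongr
      -- The ball has twice the cell's scale and its centre is in the cell, which costs `4 ^ 2`;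
      -- then `2 · 16 / 256 = 1/8`.
      _ ≤ 2 * (1 / 256 * (16 * μ (D.cell κ x))) := by
        rw [Measure.restrict_apply (measurableSet_cell κ x)]
        gcongr
        calc μ (D.cell κ x ∩ {z | v < |f z - a|}) ≤ μ (B ∩ {z | v < |f z - a|}) :=
              measure_mono (inter_subset_inter_left _ hB2)
          _ ≤ β * μ B := ha
          _ ≤ 1 / 256 * (16 * μ (D.cell κ x)) := by
            gcongr
            rw [hBdef, ← cell_eq hyR]
            refine (measure_ball_le_cell (D := D) 1 κ y ?_).trans (by norm_num)
            rw [hpow]; simp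
      _ = 1 / 8 * μ (D.cell κ x) := by
        rw [← mul_assoc, ← mul_assoc]
        congr 1
        rw [← ENNReal.toReal_eq_toReal_iff' (by finiteness) (by finiteness)]
        simp
        norm_num
  have hmE : MeasurableSet (D.medSet f k₀ x₀ s) := by
    refine measurableSet_stopping (firstTime_inv (D := D) (k₀ := k₀)
      (fun k x y hy ⟨h1, h2, h3⟩ => ⟨h1, ?_, ?_⟩) (fun k x h => h.1))
    · rw [← cell_eq h2]; exact mem_cell_of_le h1 hy
    · rwa [med_eq hy]
  rw [Measure.restrict_apply hmE, inter_eq_right.2 hsub] at key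
  exact key

/-- The local dyadic Fefferman–Stein inequality. -/
theorem lintegral_sub_med_le [OpensMeasurableSpace Y] [SFinite μ] [μ.OuterRegular] {p : ℝ}
    (hp : 1 ≤ p) : ∃ C : ℝ≥0, ∀ (f : Y → ℝ) (g : Y → ℝ≥0∞) (β : ℝ≥0∞), Measurable f →
      Measurable g → β ≤ 1 / 256 → OscBound μ f β g → ∀ k₀ x₀,
      ∫⁻ x in D.cell k₀ x₀, ‖f x - D.med f k₀ x₀‖ₑ ^ p ∂μ ≤ C * ∫⁻ x in D.cell k₀ x₀, g x ^ p ∂μ := by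
  have hp0 : 0 < p := by linarith
  -- Chosen so that `(1 + δ)^p = 4`: rescaling the level costs a factor `1/4`, which absorbs the
  -- `1/8` of the good-lambda inequality.
  set δ : ℝ := 4 ^ (1 / p) - 1 with hδ
  have hδ0 : 0 < δ := by
    have := Real.one_lt_rpow (x := 4) (z := 1 / p) (by norm_num) (by positivity)
    linarith
  have hδ1 : 0 < 1 + δ := by linarith
  refine ⟨8 * Real.toNNReal (8 / δ) ^ p, fun f g β hf hgm hβ hg k₀ x₀ => ?_⟩
  set m₀ := D.med f k₀ x₀ with hm₀
  set μ₀ := μ.restrict (D.cell k₀ x₀) with hμ₀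
  set M : Y → ℝ≥0∞ := fun x => ⨆ (k : ℤ) (_ : k₀ ≤ k), ENNReal.ofReal |D.med f k x - m₀| with hM
  have hMm : Measurable M := by
    refine Measurable.iSup fun k => Measurable.iSup fun _ => ?_
    have := measurable_med (D := D) f k
    fun_prop
  have hMset : ∀ s : ℝ, 0 ≤ s →
      {x | ENNReal.ofReal s < M x} ∩ D.cell k₀ x₀ = D.medSet f k₀ x₀ s := by
    intro s hs
    ext x
    simp only [hM, mem_inter_iff, mem_ofPred_eq, lt_iSup_iff, medSet]
    constructor
    · rintro ⟨⟨k, hk, h⟩, hx⟩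
      exact ⟨k, hk, hx, (ENNReal.ofReal_lt_ofReal_iff_of_nonneg hs).1 h⟩
    · rintro ⟨k, hk, hx, h⟩
      exact ⟨⟨k, hk, (ENNReal.ofReal_lt_ofReal_iff_of_nonneg hs).2 h⟩, hx⟩
  have hgl : ∀ s : ℝ, 0 < s → μ₀ {x | ENNReal.ofReal ((1 + δ) * s) < M x} ≤
      1 / 8 * μ₀ {x | ENNReal.ofReal s < M x} +
        μ₀ {x | ENNReal.ofReal s < ENNReal.ofReal (8 / δ) * g x} := by
    intro s hs
    have hv : 0 < δ * s / 4 := by positivity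
    have h1 := good_lambda (D := D) hf hβ hg k₀ x₀ hs.le hv
    rw [show s + 4 * (δ * s / 4) = (1 + δ) * s by ring, ← hMset _ hs.le,
      ← hMset _ (by positivity)] at h1
    rw [hμ₀, Measure.restrict_apply (measurableSet_lt measurable_const hMm),
      Measure.restrict_apply (measurableSet_lt measurable_const hMm),
      Measure.restrict_apply (measurableSet_lt measurable_const (by fun_prop))]
    refine le_trans ?_ (add_le_add h1 le_rfl)
    refine (measure_mono fun x hx => ?_).trans (measure_union_le _ _)
    by_cases hgx : g x < ENNReal.ofReal (δ * s / 4)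
    · exact Or.inl ⟨hx, hgx⟩
    · refine Or.inr ⟨?_, hx.2⟩
      change ENNReal.ofReal s < ENNReal.ofReal (8 / δ) * g x
      refine lt_of_lt_of_le ?_ (mul_le_mul_right (not_lt.1 hgx) _)
      rw [← ENNReal.ofReal_mul (by positivity), ENNReal.ofReal_lt_ofReal_iff (by positivity)]
      have : 8 / δ * (δ * s / 4) = 2 * s := by field_simp; norm_num
      linarith
  set I := ∫⁻ x in D.cell k₀ x₀, g x ^ p ∂μ with hI
  -- Absorption subtracts a multiple of the integral, which must be finite; truncation ensures this
  -- on a cell of finite measure.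
  have hN : ∀ N : ℕ, ∫⁻ x, (min (M x) N) ^ p ∂μ₀ ≤ (8 * Real.toNNReal (8 / δ) ^ p : ℝ≥0) * I := by
    intro N
    set h : Y → ℝ≥0∞ := fun x => min (M x) N with hh
    have hhm : Measurable h := hMm.min measurable_const
    have hfin : ∫⁻ x, h x ^ p ∂μ₀ ≠ ∞ := by
      refine ((lintegral_mono (g := fun _ => (N : ℝ≥0∞) ^ p) fun x => ?_).trans_lt ?_).ne
      · exact ENNReal.rpow_le_rpow (min_le_right _ _) hp0.le
      · rw [lintegral_const, hμ₀, Measure.restrict_apply_univ]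
        exact ENNReal.mul_lt_top (ENNReal.rpow_lt_top_of_nonneg hp0.le (by simp))
          (measure_cell_ne_top k₀ x₀).lt_top
    have hlev : ∀ s : ℝ, 0 < s → μ₀ {x | ENNReal.ofReal s < ENNReal.ofReal (1 + δ)⁻¹ * h x} ≤
        1 / 8 * μ₀ {x | ENNReal.ofReal s < h x} +
          μ₀ {x | ENNReal.ofReal s < ENNReal.ofReal (8 / δ) * g x} := by
      intro s hs
      have h1 : ∀ x, ENNReal.ofReal s < ENNReal.ofReal (1 + δ)⁻¹ * h x →
          ENNReal.ofReal ((1 + δ) * s) < h x := by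
        intro x hx
        rw [ENNReal.ofReal_inv_of_pos hδ1, ← ENNReal.div_eq_inv_mul,
          ENNReal.lt_div_iff_mul_lt (by simp [hδ1]) (by simp)] at hx
        rwa [mul_comm, ENNReal.ofReal_mul hs.le]
      by_cases hsN : ENNReal.ofReal s < N
      · have h2 : μ₀ {x | ENNReal.ofReal s < M x} = μ₀ {x | ENNReal.ofReal s < h x} := by
          congr 1
          ext x
          simp [hh, hsN]
        rw [← h2]
        refine (measure_mono fun x hx => ?_).trans (hgl s hs)
        exact (h1 x hx).trans_le (min_le_left _ _)
      · have : {x | ENNReal.ofReal s < ENNReal.ofReal (1 + δ)⁻¹ * h x} = ∅ := by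
          refine eq_empty_of_forall_notMem fun x hx => hsN ?_
          refine lt_of_le_of_lt (ENNReal.ofReal_le_ofReal ?_) ((h1 x hx).trans_le (min_le_right _ _))
          nlinarith
        simp [this]
    have hlay : ∫⁻ x, (ENNReal.ofReal (1 + δ)⁻¹ * h x) ^ p ∂μ₀ ≤
        1 / 8 * ∫⁻ x, h x ^ p ∂μ₀ + ∫⁻ x, (ENNReal.ofReal (8 / δ) * g x) ^ p ∂μ₀ := by
      have hmeas : ∀ F : Y → ℝ≥0∞, Measurable fun s : ℝ =>
          ENNReal.ofReal (p * s ^ (p - 1)) * μ₀ {x | ENNReal.ofReal s < F x} := fun F =>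
        (measurable_ofReal_mul_rpow _ _).mul (Antitone.measurable fun a b hab =>
          measure_mono fun x hx => (ENNReal.ofReal_le_ofReal hab).trans_lt hx)
      rw [lintegral_rpow_eq_layer μ₀ (by fun_prop) hp0, lintegral_rpow_eq_layer μ₀ hhm hp0,
        lintegral_rpow_eq_layer μ₀ (by fun_prop) hp0, ← lintegral_const_mul _ (hmeas _),
        ← lintegral_add_left ((hmeas _).const_mul _)]
      refine setLIntegral_mono' measurableSet_Ioi fun s hs => ?_
      refine (mul_le_mul_right (hlev s hs) _).trans (le_of_eq ?_)
      ring
    simp_rw [ENNReal.mul_rpow_of_nonneg _ _ hp0.le] at hlay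
    rw [lintegral_const_mul _ (by fun_prop), lintegral_const_mul _ (by fun_prop)] at hlay
    have h4 : ENNReal.ofReal (1 + δ)⁻¹ ^ p = 1 / 4 := by
      rw [ENNReal.ofReal_inv_of_pos hδ1, ENNReal.inv_rpow, ENNReal.ofReal_rpow_of_pos hδ1, hδ,
        add_sub_cancel, ← Real.rpow_mul (by norm_num), one_div_mul_cancel hp0.ne', Real.rpow_one,
        one_div]
      norm_num
    rw [h4] at hlay
    have hq : (1 / 4 : ℝ≥0∞) = 1 / 8 + 1 / 8 := by
      rw [← ENNReal.toReal_eq_toReal_iff' (by finiteness) (by finiteness),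
        ENNReal.toReal_add (by finiteness) (by finiteness)]
      simp
      norm_num
    rw [hq, add_mul, ENNReal.add_le_add_iff_left
      (ENNReal.mul_ne_top (by finiteness) hfin)] at hlay
    have h8 := mul_le_mul_right hlay 8
    rw [← mul_assoc, one_div, ENNReal.mul_inv_cancel (by simp) (by simp), one_mul] at h8
    refine h8.trans (le_of_eq ?_)
    rw [← mul_assoc]
    congr 1
    rw [ENNReal.coe_mul, ENNReal.coe_rpow_of_nonneg _ hp0.le]
    rfl
  have hlim : ∫⁻ x, M x ^ p ∂μ₀ ≤ (8 * Real.toNNReal (8 / δ) ^ p : ℝ≥0) * I := by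
    refine le_of_tendsto' (lintegral_tendsto_of_tendsto_of_monotone
      (f := fun (N : ℕ) x => (min (M x) N) ^ p) (fun N => ?_) ?_ ?_) hN
    · exact ((hMm.min measurable_const).pow_const p).aemeasurable
    · refine Filter.Eventually.of_forall fun x a b hab => ?_
      simp only
      gcongr
    · refine Filter.Eventually.of_forall fun x => ?_
      refine ((ENNReal.continuous_rpow_const).tendsto _).comp ?_
      have := (tendsto_const_nhds (x := M x)).min ENNReal.tendsto_nat_nhds_top
      simpa using this
  refine le_trans (lintegral_mono_ae ?_) hlim
  -- Rational levels keep the exceptional null sets countable in number.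
  have hae : ∀ q : ℚ, ∀ᵐ x ∂μ, x ∈ D.cell k₀ x₀ →
      (∀ k, k₀ ≤ k → |D.med f k x - m₀| ≤ (q : ℝ)) → |f x - m₀| ≤ q :=
    fun q => ae_abs_sub_le hf k₀ x₀ m₀ q
  filter_upwards [ae_restrict_of_ae (ae_all_iff.2 hae), ae_restrict_mem (measurableSet_cell k₀ x₀)]
    with x hx hxD
  refine ENNReal.rpow_le_rpow ?_ hp0.le
  by_contra! hlt
  rw [← ofReal_norm, Real.norm_eq_abs] at hlt
  obtain ⟨q, -, hq1, hq2⟩ := ENNReal.lt_iff_exists_rat_btwn.1 hlt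
  rw [← ENNReal.ofReal] at hq1 hq2
  have h1 := hx q hxD fun k hk => by
    have h2 : ENNReal.ofReal |D.med f k x - m₀| ≤ M x := le_iSup₂_of_le k hk le_rfl
    have h3 := h2.trans_lt hq1
    have h4 : (0 : ℝ) < q := by
      by_contra! h5
      rw [ENNReal.ofReal_of_nonpos h5] at h3
      exact not_lt_zero h3
    exact ((ENNReal.ofReal_lt_ofReal_iff h4).1 h3).le
  exact not_lt.2 (ENNReal.ofReal_le_ofReal h1) hq2

end DyadicGrid

namespace DyadicGrid

variable {Y : Type*} [PseudoMetricSpace Y] [MeasurableSpace Y] {μ : Measure Y}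

/-! ### The Whitney decomposition -/

section Whitney

variable (D : DyadicGrid μ)

/-- The cell of generation `k` around `x` is small compared to its distance from the complement
of `Ω`. -/
def IsDeep (Ω : Set Y) (k : ℤ) (x : Y) : Prop :=
  ∀ y ∈ D.cell k x, Metric.ball y (8 * 2 ^ (-k)) ⊆ Ω

/-- The generation of the Whitney cell around `x`. -/
def whitneyGen (Ω : Set Y) : Y → ℤ := firstTime (D.IsDeep Ω)

variable {D} {Ω : Set Y}

lemma IsDeep.ball_subset {k : ℤ} {x : Y} (h : D.IsDeep Ω k x) :
    Metric.ball x (8 * 2 ^ (-k)) ⊆ Ω := h x (mem_cell_self k x)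

lemma IsDeep.mem {k : ℤ} {x : Y} (h : D.IsDeep Ω k x) : x ∈ Ω :=
  h.ball_subset (Metric.mem_ball_self (by positivity))

lemma IsDeep.of_mem_cell {k : ℤ} {x y : Y} (hy : y ∈ D.cell k x) (h : D.IsDeep Ω k x) :
    D.IsDeep Ω k y := by
  intro z hz
  rw [cell_eq hy] at hz
  exact h z hz

lemma exists_isDeep (hΩ : IsOpen Ω) {x : Y} (hx : x ∈ Ω) : ∃ k, D.IsDeep Ω k x := by
  obtain ⟨r, hr, hrV⟩ := Metric.isOpen_iff.1 hΩ x hx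
  obtain ⟨n, hn⟩ := exists_pow_lt_of_lt_one (show 0 < r / 9 by positivity)
    (by norm_num : (1 / 2 : ℝ) < 1)
  refine ⟨n, fun y hy => (Metric.ball_subset_ball' ?_).trans hrV⟩
  have h1 := D.dist_lt _ _ _ hy
  have h2 : (2 : ℝ) ^ (-(n : ℤ)) = (1 / 2) ^ n := by simp
  linarith

/-- A point outside `Ω` bounds the size of deep cells around `x`, so a largest one exists. -/
lemma exists_le_of_isDeep (hne : Ω ≠ univ) (x : Y) : ∃ k₀, ∀ k, D.IsDeep Ω k x → k₀ ≤ k := by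
  obtain ⟨z, hz⟩ := (ne_univ_iff_exists_notMem _).1 hne
  obtain ⟨n, hn⟩ := pow_unbounded_of_one_lt (dist z x) (one_lt_two)
  refine ⟨-n, fun k hk => ?_⟩
  by_contra! hlt
  refine hz (hk.ball_subset ?_)
  rw [Metric.mem_ball]
  refine hn.trans ?_
  have : (2 : ℝ) ^ (n : ℤ) ≤ 2 ^ (-k) := zpow_le_zpow_right₀ one_le_two (by lia)
  rw [zpow_natCast] at this
  have h0 : (0 : ℝ) < 2 ^ (-k) := by positivity
  linarith

lemma isDeep_whitneyGen (hΩ : IsOpen Ω) (hne : Ω ≠ univ) {x : Y} (hx : x ∈ Ω) :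
    D.IsDeep Ω (D.whitneyGen Ω x) x := by
  obtain ⟨k₀, hk₀⟩ := exists_le_of_isDeep (D := D) hne x
  exact firstTime_spec hk₀ (exists_isDeep hΩ hx)

lemma whitneyGen_inv (hΩ : IsOpen Ω) (hne : Ω ≠ univ) :
    ∀ x ∈ Ω, ∀ y ∈ D.cell (D.whitneyGen Ω x) x,
      y ∈ Ω ∧ D.whitneyGen Ω y = D.whitneyGen Ω x := by
  intro x hx y hy
  obtain ⟨k₀, hk₀⟩ := exists_le_of_isDeep (D := D) hne x
  exact ⟨((isDeep_whitneyGen hΩ hne hx).of_mem_cell hy).mem,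
    firstTime_eq (fun _ _ _ hy h => h.of_mem_cell hy) hk₀ (exists_isDeep hΩ hx) hy⟩

/-- The parent is not deep. With `h = 2^{-gen}`, its diameter contributes `2h` and the failing ball
`16h`. -/
lemma exists_notMem_near (hne : Ω ≠ univ) (x : Y) :
    ∃ z ∉ Ω, dist z x < 18 * 2 ^ (-D.whitneyGen Ω x) := by
  obtain ⟨k₀, hk₀⟩ := exists_le_of_isDeep (D := D) hne x
  have h1 : ¬ D.IsDeep Ω (D.whitneyGen Ω x - 1) x :=
    not_of_lt_firstTime hk₀ (show D.whitneyGen Ω x - 1 < D.whitneyGen Ω x by lia)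
  simp only [IsDeep, not_forall, not_subset] at h1
  obtain ⟨y, hy, z, hz, hzΩ⟩ := h1
  refine ⟨z, hzΩ, ?_⟩
  have hpow : (2 : ℝ) ^ (-(D.whitneyGen Ω x - 1)) = 2 * 2 ^ (-D.whitneyGen Ω x) := by
    rw [show -(D.whitneyGen Ω x - 1) = 1 + -D.whitneyGen Ω x by ring, zpow_add₀ two_ne_zero,
      zpow_one]
  have h2 := D.dist_lt _ _ _ hy
  rw [Metric.mem_ball] at hz
  rw [hpow] at h2 hz
  linarith [dist_triangle z y x]

variable (D) in
/-- The function `f` outside `Ω`, replaced by its medians over the Whitney cells of `Ω`. -/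
def whitneyFun (Ω : Set Y) (f : Y → ℝ) (x : Y) : ℝ :=
  open Classical in if x ∈ Ω then D.med f (D.whitneyGen Ω x) x else f x

lemma whitneyFun_of_mem {f : Y → ℝ} {x : Y} (hx : x ∈ Ω) :
    D.whitneyFun Ω f x = D.med f (D.whitneyGen Ω x) x := if_pos hx

lemma whitneyFun_of_notMem {f : Y → ℝ} {x : Y} (hx : x ∉ Ω) : D.whitneyFun Ω f x = f x :=
  if_neg hx

lemma measurable_whitneyGen [OpensMeasurableSpace Y] (hΩ : IsOpen Ω) (hne : Ω ≠ univ) :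
    Measurable (D.whitneyGen Ω) := by
  refine measurable_to_countable' fun k => ?_
  have h1 : MeasurableSet {x | x ∈ Ω ∧ D.whitneyGen Ω x = k} := by
    refine measurableSet_stopping (D := D) (τ := D.whitneyGen Ω) fun x hx y hy => ?_
    obtain ⟨h2, h3⟩ := whitneyGen_inv hΩ hne x hx.1 y hy
    exact ⟨⟨h2, h3.trans hx.2⟩, h3⟩
  -- The infimum of the empty set of integers is `0` by convention, so the generation is constant
  -- off `Ω`.
  have h0 : ∀ x ∉ Ω, D.whitneyGen Ω x = 0 := by
    intro x hx
    have : {k | D.IsDeep Ω k x} = ∅ := eq_empty_of_forall_notMem fun k hk => hx (IsDeep.mem hk)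
    rw [whitneyGen, firstTime, this, Int.csInf_empty]
  have h2 : D.whitneyGen Ω ⁻¹' {k} = {x | x ∈ Ω ∧ D.whitneyGen Ω x = k} ∪ {x | x ∈ Ωᶜ ∧ 0 = k} := by
    ext x
    by_cases hx : x ∈ Ω
    · simp [hx]
    · simp [hx, h0 x hx]
  rw [h2]
  refine h1.union ?_
  by_cases hk : 0 = k
  · simp only [hk, and_true]; exact hΩ.measurableSet.compl
  · simp [hk]

lemma measurable_whitneyFun [OpensMeasurableSpace Y] (hΩ : IsOpen Ω) (hne : Ω ≠ univ) {f : Y → ℝ}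
    (hf : Measurable f) : Measurable (D.whitneyFun Ω f) := by
  have h1 : Measurable fun z : ℤ × Y => D.med f z.1 z.2 :=
    measurable_from_prod_countable_right (f := fun z : ℤ × Y => D.med f z.1 z.2) fun k =>
      measurable_med f k
  have h2 : Measurable fun x => D.med f (D.whitneyGen Ω x) x :=
    h1.comp (f := fun x => (D.whitneyGen Ω x, x))
      ((measurable_whitneyGen hΩ hne).prodMk measurable_id)
  classical
  have h3 : D.whitneyFun Ω f = Ω.piecewise (fun x => D.med f (D.whitneyGen Ω x) x) f := by
    ext x
    by_cases hx : x ∈ Ω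
    · simp [hx, whitneyFun_of_mem hx]
    · simp [hx, whitneyFun_of_notMem hx]
  rw [h3]
  exact h2.piecewise hΩ.measurableSet hf

lemma mul_pow_lt_half {α : ℝ≥0∞} (hα : α * 4 ^ 11 ≤ 1) : α * 4 ^ (7 + 1) < 1 / 2 := by
  have h : (4 : ℝ≥0∞) ^ (7 + 1) = 4 ^ 11 * (1 / 64) := by
    rw [← ENNReal.toReal_eq_toReal_iff' (by finiteness) (by finiteness)]
    simp
    norm_num
  rw [h, ← mul_assoc]
  calc _ ≤ 1 * (1 / 64 : ℝ≥0∞) := by gcongr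
    _ < 1 / 2 := by
      rw [one_mul, ← ENNReal.toReal_lt_toReal (by finiteness) (by finiteness)]
      simp; norm_num

/-- The size of `α` is fixed here: `3 · 4^5 · α ≤ 1/1024 = 4^{-5}` requires `α ≤ 1/(3 · 4^{10})`,
and `4^{11}` is the next power of four. The other demand, `4^8 α < 1/2`, is weaker. -/
lemma three_mul_le {α : ℝ≥0∞} (hα : α * 4 ^ 11 ≤ 1) (m : ℝ≥0∞) :
    3 * (α * (4 ^ 5 * m)) ≤ 1 / 1024 * m := by
  have h : (3 : ℝ≥0∞) * 4 ^ 5 = 4 ^ 11 * (3 / 4 ^ 6) := by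
    rw [← ENNReal.toReal_eq_toReal_iff' (by finiteness) (by finiteness)]
    simp; norm_num
  calc 3 * (α * (4 ^ 5 * m)) = α * (3 * 4 ^ 5) * m := by ring
    _ = α * 4 ^ 11 * (3 / 4 ^ 6) * m := by rw [h]; ring
    _ ≤ 1 * (3 / 4 ^ 6) * m := by gcongr
    _ ≤ 1 / 1024 * m := by
      gcongr
      rw [one_mul, ← ENNReal.toReal_le_toReal (by finiteness) (by finiteness)]
      simp; norm_num

/-- Every ball has a comparable enlargement containing a point outside `Ω`, where `g ≤ Λ`, or else
sits deep inside a region of comparable Whitney cells that has one. The oscillation of `f` on the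
larger ball passes to the medians, at the price of replacing `α` by `1/1024`. -/
lemma oscBound_whitneyFun [OpensMeasurableSpace Y] (hΩ : IsOpen Ω) (hne : Ω ≠ univ) {f : Y → ℝ}
    (hf : Measurable f) {g : Y → ℝ≥0∞} {α Λ : ℝ≥0∞} (hα : α * 4 ^ 11 ≤ 1) (hg : OscBound μ f α g)
    (hΛ : ∀ z ∉ Ω, g z ≤ Λ) : OscBound μ (D.whitneyFun Ω f) (1 / 1024) fun _ => Λ := by
  intro c r _ s hr hs _ hΛs
  -- If some Whitney cell met by the ball has scale at least `r`, the ball lies in `Ω` and all cells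
  -- met have comparable scale, so every median is within `s` of `a`. Otherwise all cells met are
  -- smaller than `r` and the deviating ones are summed.
  by_cases hcase : ∃ x ∈ Metric.ball c r, x ∈ Ω ∧ r ≤ 2 ^ (-D.whitneyGen Ω x)
  · obtain ⟨x, hxc, hxΩ, hrx⟩ := hcase
    set h : ℝ := 2 ^ (-D.whitneyGen Ω x) with hh
    have hh0 : 0 < h := by positivity
    obtain ⟨z, hz, hzx⟩ := exists_notMem_near (D := D) hne x
    rw [← hh] at hzx
    have hdeep := (isDeep_whitneyGen (D := D) hΩ hne hxΩ).ball_subset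
    rw [← hh] at hdeep
    obtain ⟨a, ha⟩ := hg x (32 * h) z s (by positivity) hs
      (by rw [Metric.mem_ball]; linarith) ((hΛ z hz).trans_lt hΛs)
    refine ⟨a, ?_⟩
    have : Metric.ball c r ∩ {x | s < |D.whitneyFun Ω f x - a|} = ∅ := by
      refine eq_empty_of_forall_notMem fun y ⟨hyc, hy⟩ => ?_
      have hy : s < |D.whitneyFun Ω f y - a| := hy
      rw [Metric.mem_ball] at hxc hyc
      have hyx : dist y x < 2 * h := by linarith [dist_triangle_right y x c]
      have hyΩ : y ∈ Ω := hdeep (by rw [Metric.mem_ball]; linarith)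
      rw [whitneyFun_of_mem hyΩ] at hy
      refine not_le.2 hy ?_
      set e : ℝ := 2 ^ (-D.whitneyGen Ω y) with he
      have he0 : 0 < e := by positivity
      have h1 : 8 * e ≤ dist z y := by
        by_contra! hlt
        exact hz ((isDeep_whitneyGen (D := D) hΩ hne hyΩ).ball_subset hlt)
      have h2 : dist z y < 20 * h := by linarith [dist_triangle_right z y x]
      obtain ⟨w, hw, hwy⟩ := exists_notMem_near (D := D) hne y
      rw [← he] at hwy
      have h3 : 8 * h ≤ dist w x := by
        by_contra! hlt
        exact hw (hdeep hlt)
      have h4 : 6 * h < 18 * e := by linarith [dist_triangle w y x]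
      refine abs_med_sub_le hf (B := Metric.ball x (32 * h)) (M := 4 ^ (7 + 1)) ?_ ?_ ?_ ha
      · refine (cell_subset_ball _ _).trans (Metric.ball_subset_ball' ?_)
        rw [← he]; linarith
      -- The distance is below `2h` and `h < 3e`, so `2h + 32h < 102e ≤ 2^7 e`.
      · refine measure_ball_le_cell 7 _ _ ?_
        rw [← he, dist_comm]; linarith
      · exact mul_pow_lt_half hα
    rw [this]; simp
  · push Not at hcase
    obtain ⟨z, hz, hzc⟩ : ∃ z ∉ Ω, dist z c < 32 * r := by
      by_cases hc : c ∈ Ω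
      · obtain ⟨z, hz, hzc⟩ := exists_notMem_near (D := D) hne c
        have := hcase c (Metric.mem_ball_self hr) hc
        exact ⟨z, hz, by linarith⟩
      · exact ⟨c, hc, by simpa using hr⟩
    obtain ⟨a, ha⟩ := hg c (32 * r) z s (by positivity) hs hzc ((hΛ z hz).trans_lt hΛs)
    refine ⟨a, ?_⟩
    set P' := Metric.ball c (32 * r)
    set F := {x | s < |f x - a|} with hF
    -- These are the Whitney cells inside `P'` with deviating median. On each, `f` deviates on half
    -- of the measure, so `μ U ≤ 2 μ (P' ∩ F)`.
    set U := {x | x ∈ Ω ∧ D.cell (D.whitneyGen Ω x) x ⊆ P' ∧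
      s < |D.med f (D.whitneyGen Ω x) x - a|} with hU
    have h1 : μ U ≤ ((2 : ℝ≥0∞) • μ.restrict F) U := by
      refine measure_le_of_stopping (D := D) (τ := D.whitneyGen Ω)
        (fun x ⟨hx1, hx2, hx3⟩ y hy => ?_) fun x ⟨_, _, hx3⟩ => ?_
      · obtain ⟨h2, h3⟩ := whitneyGen_inv hΩ hne x hx1 y hy
        refine ⟨⟨h2, ?_, ?_⟩, h3⟩
        · rwa [h3, cell_eq hy]
        · rwa [h3, med_eq hy]
      · rw [Measure.smul_apply, Measure.restrict_apply (measurableSet_cell _ _), smul_eq_mul]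
        have h6 := half_le_measure_median hf
          (measure_cell_ne_zero (D := D) (D.whitneyGen Ω x) x) (measure_cell_ne_top _ x) a
        rw [ENNReal.div_le_iff (by simp) (by simp), mul_comm] at h6
        refine h6.trans (mul_le_mul_right (measure_mono (inter_subset_inter_right _ fun w hw => ?_)) _)
        exact lt_of_lt_of_le hx3 hw
    have hUP : U ⊆ P' := fun x hx => hx.2.1 (mem_cell_self _ x)
    have hFm : MeasurableSet F := measurableSet_lt measurable_const (by fun_prop)
    have h2 : μ U ≤ 2 * μ (P' ∩ F) := by
      refine h1.trans ?_
      rw [Measure.smul_apply, Measure.restrict_apply' hFm, smul_eq_mul]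
      gcongr
    have hsub : Metric.ball c r ∩ {x | s < |D.whitneyFun Ω f x - a|} ⊆ P' ∩ F ∪ U := by
      rintro x ⟨hxc, hx⟩
      have hx : s < |D.whitneyFun Ω f x - a| := hx
      by_cases hxΩ : x ∈ Ω
      · rw [whitneyFun_of_mem hxΩ] at hx
        refine Or.inr ⟨hxΩ, (cell_subset_ball _ _).trans (Metric.ball_subset_ball' ?_), hx⟩
        have := hcase x hxc hxΩ
        rw [Metric.mem_ball] at hxc
        linarith
      · rw [whitneyFun_of_notMem hxΩ] at hx
        exact Or.inl ⟨Metric.ball_subset_ball (by linarith) hxc, hx⟩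
    have hP' : μ P' ≤ 4 ^ 5 * μ (Metric.ball c r) := by
      have := D.measure_ball_pow_le 5 c hr
      rwa [show (2 : ℝ) ^ 5 = 32 by norm_num] at this
    calc _ ≤ μ (P' ∩ F ∪ U) := measure_mono hsub
      _ ≤ μ (P' ∩ F) + 2 * μ (P' ∩ F) := (measure_union_le _ _).trans (by gcongr)
      _ = 3 * μ (P' ∩ F) := by ring
      _ ≤ 3 * (α * (4 ^ 5 * μ (Metric.ball c r))) := by
        gcongr
        exact ha.trans (by gcongr)
      _ ≤ 1 / 1024 * μ (Metric.ball c r) := three_mul_le hα _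

end Whitney

/-! ### Consequences for `BMO` and for the `L^p` part of the decomposition -/

variable [OpensMeasurableSpace Y] [SFinite μ] [μ.OuterRegular]

/-- The John–Strömberg inequality. -/
lemma exists_lintegral_sub_le (D : DyadicGrid μ) : ∃ C : ℝ≥0, ∀ (f : Y → ℝ) (Λ : ℝ≥0∞), Measurable f →
    OscBound μ f (1 / 1024) (fun _ => Λ) → ∀ c r s, 0 < r → 0 < s → Λ < ENNReal.ofReal s →
      ∃ a : ℝ, ∫⁻ x in Metric.ball c r, ‖f x - a‖ₑ ∂μ ≤
        C * ENNReal.ofReal s * μ (Metric.ball c r) := by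
  obtain ⟨C, hC⟩ := lintegral_sub_med_le (D := D) le_rfl
  refine ⟨(C + 1) * 4, fun f Λ hf hΛ c r s hr hs hΛs => ?_⟩
  obtain ⟨k, hk1, hk2⟩ := exists_mem_Ico_zpow (x := r) (y := 2) hr one_lt_two
  obtain ⟨a, ha⟩ := hΛ c (2 * r) c s (by positivity) hs (Metric.mem_ball_self (by positivity)) hΛs
  refine ⟨a, ?_⟩
  obtain ⟨k, rfl⟩ : ∃ j, k = -j := ⟨-k, by simp⟩
  rw [zpow_add₀ two_ne_zero, zpow_one] at hk2
  set U := {x | ∃ y ∈ Metric.ball c r, y ∈ D.cell k x} with hU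
  have hBU : Metric.ball c r ⊆ U := fun x hx => ⟨x, hx, mem_cell_self k x⟩
  have hcell : ∀ x ∈ U, D.cell k x ⊆ Metric.ball c (2 * r) := by
    rintro x ⟨y, hy, hyx⟩
    rw [← cell_eq hyx]
    refine (cell_subset_ball _ _).trans (Metric.ball_subset_ball' ?_)
    rw [Metric.mem_ball] at hy
    linarith
  have hUB : U ⊆ Metric.ball c (2 * r) := fun x hx => hcell x hx (mem_cell_self k x)
  have hfm : Measurable fun x => ‖f x - a‖ₑ := by fun_prop
  -- On cells of scale comparable to `r`, Fefferman–Stein with `p = 1` and constant majorant `Λ`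
  -- controls `f` minus its median, and each median is within `s` of `a`.
  have h1 : μ.withDensity (fun x => ‖f x - a‖ₑ) U ≤
      ((((C + 1 : ℝ≥0) : ℝ≥0∞) * ENNReal.ofReal s) • μ) U := by
    refine measure_le_of_stopping (D := D) (τ := fun _ => k)
      (fun x ⟨y, hy, hyx⟩ z hz => ⟨⟨y, hy, by rwa [cell_eq hz]⟩, rfl⟩) fun x hx => ?_
    rw [withDensity_apply _ (measurableSet_cell k x), Measure.smul_apply, smul_eq_mul]
    obtain ⟨y, hy, hyx⟩ := hx
    have hmed : |D.med f k x - a| ≤ s := by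
      refine abs_med_sub_le hf (hcell x ⟨y, hy, hyx⟩) (M := 4 ^ 4) ?_ ?_ ha
      · rw [← cell_eq hyx]
        refine measure_ball_le_cell 3 _ _ ?_
        rw [Metric.mem_ball, dist_comm] at hy
        linarith
      · rw [← ENNReal.toReal_lt_toReal (by finiteness) (by finiteness)]
        simp; norm_num
    have hFS := hC f (fun _ => Λ) (1 / 1024) hf measurable_const (by
        rw [← ENNReal.toReal_le_toReal (by finiteness) (by finiteness)]
        simp; norm_num) hΛ k x
    simp only [ENNReal.rpow_one] at hFS
    rw [lintegral_const, Measure.restrict_apply_univ] at hFS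
    calc ∫⁻ x in D.cell k x, ‖f x - a‖ₑ ∂μ
        ≤ ∫⁻ y in D.cell k x, (‖f y - D.med f k x‖ₑ + ENNReal.ofReal s) ∂μ := by
          refine lintegral_mono fun y => ?_
          rw [← sub_add_sub_cancel (f y) (D.med f k x) a]
          refine (enorm_add_le _ _).trans ?_
          gcongr
          rw [← ofReal_norm, Real.norm_eq_abs]
          exact ENNReal.ofReal_le_ofReal hmed
      _ = ∫⁻ y in D.cell k x, ‖f y - D.med f k x‖ₑ ∂μ + ENNReal.ofReal s * μ (D.cell k x) := by
          rw [lintegral_add_right _ measurable_const, lintegral_const, Measure.restrict_apply_univ]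
      _ ≤ C * (ENNReal.ofReal s * μ (D.cell k x)) + ENNReal.ofReal s * μ (D.cell k x) := by
          gcongr
          exact hFS.trans (by gcongr)
      _ = _ := by push_cast; ring
  calc ∫⁻ x in Metric.ball c r, ‖f x - a‖ₑ ∂μ
      = μ.withDensity (fun x => ‖f x - a‖ₑ) (Metric.ball c r) :=
        (withDensity_apply _ Metric.isOpen_ball.measurableSet).symm
    _ ≤ (((C + 1 : ℝ≥0) : ℝ≥0∞) * ENNReal.ofReal s) * μ U := (measure_mono hBU).trans h1
    _ ≤ (((C + 1 : ℝ≥0) : ℝ≥0∞) * ENNReal.ofReal s) * (4 * μ (Metric.ball c r)) := by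
        gcongr
        exact (measure_mono hUB).trans (D.doubling c r hr)
    _ = _ := by push_cast; ring

/-- The Calderón–Zygmund type decomposition with a small part in `L^p` and a part of bounded
mean oscillation. -/
lemma lintegral_sub_whitneyFun_le (D : DyadicGrid μ) {p : ℝ} (hp : 1 ≤ p) :
    ∃ C : ℝ≥0, ∀ (f : Y → ℝ) (g : Y → ℝ≥0∞) (β : ℝ≥0∞) (Ω : Set Y), Measurable f →
      Measurable g → β ≤ 1 / 256 → OscBound μ f β g → IsOpen Ω → Ω ≠ univ →
      ∫⁻ x, ‖f x - D.whitneyFun Ω f x‖ₑ ^ p ∂μ ≤ C * ∫⁻ x in Ω, g x ^ p ∂μ := by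
  obtain ⟨C, hC⟩ := lintegral_sub_med_le (D := D) hp
  refine ⟨C, fun f g β Ω hf hgm hβ hg hΩ hne => ?_⟩
  have h1 : μ.withDensity (fun x => ‖f x - D.whitneyFun Ω f x‖ₑ ^ p) Ω ≤
      ((C : ℝ≥0∞) • μ.withDensity fun x => g x ^ p) Ω := by
    refine measure_le_of_stopping (D := D) (whitneyGen_inv hΩ hne) fun x hx => ?_
    rw [Measure.smul_apply, withDensity_apply _ (measurableSet_cell _ _),
      withDensity_apply _ (measurableSet_cell _ _), smul_eq_mul]
    refine le_trans (le_of_eq ?_) (hC f g β hf hgm hβ hg (D.whitneyGen Ω x) x)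
    refine setLIntegral_congr_fun (measurableSet_cell _ _) fun y hy => ?_
    obtain ⟨h2, h3⟩ := whitneyGen_inv hΩ hne x hx y hy
    rw [whitneyFun_of_mem h2, h3, med_eq hy]
  rw [Measure.smul_apply, withDensity_apply _ hΩ.measurableSet,
    withDensity_apply _ hΩ.measurableSet, smul_eq_mul] at h1
  refine le_trans (le_of_eq ?_) h1
  rw [← lintegral_indicator hΩ.measurableSet]
  refine lintegral_congr fun x => ?_
  by_cases hx : x ∈ Ω
  · simp [hx]
  · have : 0 < p := by linarith
    simp [hx, whitneyFun_of_notMem hx, this]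

end DyadicGrid

/-! ### The weak type inequality -/

section Weak

variable {Y : Type*} [PseudoMetricSpace Y] [MeasurableSpace Y] [OpensMeasurableSpace Y]
  [SecondCountableTopology Y] {μ : Measure Y}

/-- The weak type inequality for the uncentred maximal function of a set. -/
lemma DyadicGrid.measure_dense_le (D : DyadicGrid μ) {E : Set Y} (hE : MeasurableSet E) (β : ℝ≥0∞) :
    β * μ {x | ∃ c r, 0 < r ∧ x ∈ Metric.ball c r ∧
      β * μ (Metric.ball c r) < μ (Metric.ball c r ∩ E)} ≤ 64 * μ E := by
  -- Vitali's lemma needs bounded radii; the bound `n` is removed by monotone convergence.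
  have key : ∀ n : ℕ, β * μ {x | ∃ c r, (0 < r ∧ r ≤ (n : ℝ)) ∧ x ∈ Metric.ball c r ∧
      β * μ (Metric.ball c r) < μ (Metric.ball c r ∩ E)} ≤ 64 * μ E := by
    intro n
    set t : Set (Y × ℝ) := {b | (0 < b.2 ∧ b.2 ≤ (n : ℝ)) ∧
      β * μ (Metric.ball b.1 b.2) < μ (Metric.ball b.1 b.2 ∩ E)} with ht
    obtain ⟨u, hut, hdisj, hcov⟩ := Vitali.exists_disjoint_subfamily_covering_enlargement_closedBall
      t Prod.fst Prod.snd n (fun a ha => ha.1.2) 4 (by norm_num)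
    have hdisj' : u.PairwiseDisjoint fun a => Metric.ball a.1 a.2 := fun a ha b hb hab =>
      (hdisj ha hb hab).mono Metric.ball_subset_closedBall Metric.ball_subset_closedBall
    have hcount : u.Countable := hdisj'.countable_of_isOpen (fun _ _ => Metric.isOpen_ball)
      fun a ha => ⟨a.1, Metric.mem_ball_self (hut ha).1.1⟩
    have hsub : {x | ∃ c r, (0 < r ∧ r ≤ (n : ℝ)) ∧ x ∈ Metric.ball c r ∧
        β * μ (Metric.ball c r) < μ (Metric.ball c r ∩ E)} ⊆
        ⋃ b ∈ u, Metric.ball b.1 (2 ^ 3 * b.2) := by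
      rintro x ⟨c, r, hr, hx, h⟩
      obtain ⟨b, hb, hsub⟩ := hcov (c, r) ⟨hr, h⟩
      refine mem_biUnion hb ?_
      refine Metric.closedBall_subset_ball ?_ (hsub (Metric.ball_subset_closedBall hx))
      have := (hut hb).1.1
      linarith
    calc _ ≤ β * μ (⋃ b ∈ u, Metric.ball b.1 (2 ^ 3 * b.2)) := by gcongr
      _ ≤ β * ∑' b : u, μ (Metric.ball b.1.1 (2 ^ 3 * b.1.2)) := by
        gcongr; exact measure_biUnion_le μ hcount _
      _ = ∑' b : u, β * μ (Metric.ball b.1.1 (2 ^ 3 * b.1.2)) := ENNReal.tsum_mul_left.symm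
      _ ≤ ∑' b : u, 64 * μ (Metric.ball b.1.1 b.1.2 ∩ E) := by
        refine ENNReal.tsum_le_tsum fun b => ?_
        have h1 := D.measure_ball_pow_le 3 b.1.1 (hut b.2).1.1
        calc _ ≤ β * (4 ^ 3 * μ (Metric.ball b.1.1 b.1.2)) := by gcongr
          _ = 64 * (β * μ (Metric.ball b.1.1 b.1.2)) := by ring
          _ ≤ _ := by gcongr; exact (hut b.2).2.le
      _ = 64 * ∑' b : u, μ (Metric.ball b.1.1 b.1.2 ∩ E) := ENNReal.tsum_mul_left
      _ = 64 * μ (⋃ b ∈ u, Metric.ball b.1 b.2 ∩ E) := by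
        rw [measure_biUnion hcount (hdisj'.mono fun b => inter_subset_left)
          fun b _ => Metric.isOpen_ball.measurableSet.inter hE]
      _ ≤ _ := by
        gcongr
        exact iUnion₂_subset fun b _ => inter_subset_right
  have hU : {x | ∃ c r, 0 < r ∧ x ∈ Metric.ball c r ∧
      β * μ (Metric.ball c r) < μ (Metric.ball c r ∩ E)} =
      ⋃ n : ℕ, {x | ∃ c r, (0 < r ∧ r ≤ (n : ℝ)) ∧ x ∈ Metric.ball c r ∧
      β * μ (Metric.ball c r) < μ (Metric.ball c r ∩ E)} := by
    ext x
    simp only [mem_ofPred_eq, mem_iUnion]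
    constructor
    · rintro ⟨c, r, hr, h⟩
      obtain ⟨n, hn⟩ := exists_nat_ge r
      exact ⟨n, c, r, ⟨hr, hn⟩, h⟩
    · rintro ⟨n, c, r, hr, h⟩
      exact ⟨c, r, hr.1, h⟩
  have hmono : Monotone fun n : ℕ => {x | ∃ c r, (0 < r ∧ r ≤ (n : ℝ)) ∧ x ∈ Metric.ball c r ∧
      β * μ (Metric.ball c r) < μ (Metric.ball c r ∩ E)} := by
    rintro a b hab x ⟨c, r, hr, h⟩
    exact ⟨c, r, ⟨hr.1, hr.2.trans (by exact_mod_cast hab)⟩, h⟩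
  rw [hU, hmono.measure_iUnion, ENNReal.mul_iSup]
  exact iSup_le key

end Weak

/-! ### The sharp maximal function -/

section Rearrangement

variable {S : Type*} [MeasurableSpace S] {μ : Measure S}

lemma rearrangement_indicator (B : Set S) (h : S → ℝ) (t : ℝ≥0∞) :
    rearrangement μ (B.indicator h) t =
      sInf {s : ℝ≥0∞ | μ (B ∩ {x | s < ‖h x‖ₑ}) ≤ t} := by
  rw [rearrangement]
  congr! 5 with s
  ext x
  by_cases hx : x ∈ B <;> simp [hx]

lemma measure_rearrangement_lt_le (B : Set S) (h : S → ℝ) (t : ℝ≥0∞) :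
    μ (B ∩ {x | rearrangement μ (B.indicator h) t < ‖h x‖ₑ}) ≤ t := by
  refine le_trans (measure_mono fun x hx => ?_)
    (measure_sInf_lt_le (G := fun x => ‖B.indicator h x‖ₑ) t)
  have h2 : rearrangement μ (B.indicator h) t < ‖h x‖ₑ := hx.2
  change rearrangement μ (B.indicator h) t < ‖B.indicator h x‖ₑ
  rwa [indicator_of_mem hx.1]

lemma rearrangement_le {B : Set S} {h : S → ℝ} {t s : ℝ≥0∞}
    (hs : μ (B ∩ {x | s < ‖h x‖ₑ}) ≤ t) : rearrangement μ (B.indicator h) t ≤ s := by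
  rw [rearrangement_indicator]
  exact sInf_le hs

end Rearrangement

section Sharp

variable {X : Type*} [PseudoMetricSpace X]

lemma cube_eq_ball (c : Fin 2 → X) {r : ℝ} (hr : 0 < r) : cube c r = Metric.ball c r := by
  ext x
  simp [cube, dist_pi_lt_iff hr]

variable [MeasureSpace X]

lemma lt_sharpMax_iff {α : ℝ} {f : (Fin 2 → X) → ℝ} {u : ℝ≥0∞} {x : Fin 2 → X} :
    u < sharpMax α f x ↔ ∃ c r, 0 < r ∧ x ∈ Metric.ball c r ∧
      u < ⨅ a : ℝ, rearrangement volume ((Metric.ball c r).indicator fun y => f y - a)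
        (ENNReal.ofReal α * volume (Metric.ball c r)) := by
  simp only [sharpMax, lt_iSup_iff]
  constructor
  · rintro ⟨c, r, hr, hx, h⟩
    rw [cube_eq_ball c hr] at hx h
    exact ⟨c, r, hr, hx, h⟩
  · rintro ⟨c, r, hr, hx, h⟩
    rw [← cube_eq_ball c hr] at hx h
    exact ⟨c, r, hr, hx, h⟩

/-- A superlevel set is a union of open cubes. Besides measurability of the uncountable supremum,
this supplies the open set for the Whitney decomposition. -/
lemma isOpen_lt_sharpMax (α : ℝ) (f : (Fin 2 → X) → ℝ) (u : ℝ≥0∞) :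
    IsOpen {x | u < sharpMax α f x} := by
  have : {x | u < sharpMax α f x} = ⋃ (c : Fin 2 → X) (r : ℝ)
      (_ : 0 < r ∧ u < ⨅ a : ℝ, rearrangement volume ((Metric.ball c r).indicator fun y => f y - a)
        (ENNReal.ofReal α * volume (Metric.ball c r))), Metric.ball c r := by
    ext x
    simp only [mem_ofPred_eq, lt_sharpMax_iff, mem_iUnion, exists_prop]
    exact exists_congr fun c => exists_congr fun r => by tauto
  rw [this]
  exact isOpen_iUnion fun c => isOpen_iUnion fun r => isOpen_iUnion fun _ => Metric.isOpen_ball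

lemma measurable_sharpMax [OpensMeasurableSpace (Fin 2 → X)] (α : ℝ) (f : (Fin 2 → X) → ℝ) :
    Measurable (sharpMax α f) :=
  measurable_of_Ioi fun u => (isOpen_lt_sharpMax α f u).measurableSet

lemma oscBound_sharpMax (α : ℝ) (f : (Fin 2 → X) → ℝ) :
    OscBound volume f (ENNReal.ofReal α) (sharpMax α f) := by
  intro c r x s hr hs hx h
  have h1 : ⨅ a : ℝ, rearrangement volume ((Metric.ball c r).indicator fun y => f y - a)
        (ENNReal.ofReal α * volume (Metric.ball c r)) < ENNReal.ofReal s := by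
    by_contra! hle
    exact lt_irrefl _ (lt_sharpMax_iff.2 ⟨c, r, hr, hx, h.trans_le hle⟩)
  obtain ⟨a, ha⟩ := iInf_lt_iff.1 h1
  refine ⟨a, le_trans (measure_mono (inter_subset_inter_right _ fun y hy => ?_))
    (measure_rearrangement_lt_le _ (fun y => f y - a) _)⟩
  have hy : s < |f y - a| := hy
  refine ha.trans ?_
  rw [← ofReal_norm, Real.norm_eq_abs]
  exact (ENNReal.ofReal_lt_ofReal_iff_of_nonneg hs.le).2 hy

/-- Half of the allowed portion `α` is spent on each summand, with the constants `a` and `b` added.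
-/
lemma sharpMax_le_add {α : ℝ} (hα : 0 < α) {f f₀ f₁ : (Fin 2 → X) → ℝ}
    (hf : ∀ᵐ x, f x = f₀ x + f₁ x) {u : ℝ≥0∞}
    (hu : ∀ c r, 0 < r → ∃ b : ℝ, volume (Metric.ball c r ∩ {x | u < ‖f₁ x - b‖ₑ}) ≤
      ENNReal.ofReal (α / 2) * volume (Metric.ball c r)) (x : Fin 2 → X) :
    sharpMax α f x ≤ sharpMax (α / 2) f₀ x + u := by
  by_contra! hlt
  obtain ⟨c, r, hr, hx, h⟩ := lt_sharpMax_iff.1 hlt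
  refine not_le.2 h ?_
  have h0 : ⨅ a : ℝ, rearrangement volume ((Metric.ball c r).indicator fun y => f₀ y - a)
      (ENNReal.ofReal (α / 2) * volume (Metric.ball c r)) ≤ sharpMax (α / 2) f₀ x := by
    by_contra! hle
    exact lt_irrefl _ (lt_sharpMax_iff.2 ⟨c, r, hr, hx, hle⟩)
  refine le_trans ?_ (add_le_add h0 le_rfl)
  rw [ENNReal.iInf_add]
  refine le_iInf fun a => ?_
  obtain ⟨b, hb⟩ := hu c r hr
  refine iInf_le_of_le (a + b) (rearrangement_le ?_)
  set v := rearrangement volume ((Metric.ball c r).indicator fun y => f₀ y - a)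
      (ENNReal.ofReal (α / 2) * volume (Metric.ball c r)) with hv
  calc volume (Metric.ball c r ∩ {x | v + u < ‖f x - (a + b)‖ₑ})
      ≤ volume (Metric.ball c r ∩ {x | v < ‖f₀ x - a‖ₑ} ∪
          Metric.ball c r ∩ {x | u < ‖f₁ x - b‖ₑ}) := by
        refine measure_mono_ae ?_
        filter_upwards [hf] with y hy hyB
        obtain ⟨hyB, h1⟩ := hyB
        have h1 : v + u < ‖f y - (a + b)‖ₑ := h1
        by_contra hnot
        have h2 : ¬ (v < ‖f₀ y - a‖ₑ) := fun h => hnot (Or.inl ⟨hyB, h⟩)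
        have h3 : ¬ (u < ‖f₁ y - b‖ₑ) := fun h => hnot (Or.inr ⟨hyB, h⟩)
        rw [hy, show f₀ y + f₁ y - (a + b) = f₀ y - a + (f₁ y - b) by ring] at h1
        exact not_le.2 h1 ((enorm_add_le _ _).trans (add_le_add (not_lt.1 h2) (not_lt.1 h3)))
    _ ≤ ENNReal.ofReal (α / 2) * volume (Metric.ball c r) +
          ENNReal.ofReal (α / 2) * volume (Metric.ball c r) :=
        (measure_union_le _ _).trans (add_le_add (measure_rearrangement_lt_le _ _ _) hb)
    _ = ENNReal.ofReal α * volume (Metric.ball c r) := by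
        rw [← add_mul, ← ENNReal.ofReal_add (by positivity) (by positivity), add_halves]

variable [OpensMeasurableSpace (Fin 2 → X)] [SFinite (volume : Measure (Fin 2 → X))]

/-- If the sharp maximal function exceeds `s` at `x`, then `{|f - a| > s}` has density above `β` in
some ball around `x`. The weak type bound at each level is already a comparison of distribution
functions, so every `p > 0` is allowed. -/
lemma lintegral_sharpMax_rpow_le [SecondCountableTopology X]
    (D : DyadicGrid (volume : Measure (Fin 2 → X))) {β : ℝ} (hβ : 0 < β)
    {f : (Fin 2 → X) → ℝ} (hf : Measurable f) (a : ℝ) {p : ℝ} (hp : 0 < p) :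
    ∫⁻ x, sharpMax β f x ^ p ≤ 64 / ENNReal.ofReal β * ∫⁻ x, ‖f x - a‖ₑ ^ p := by
  have hβ' : ENNReal.ofReal β ≠ 0 := by simpa using hβ
  refine lintegral_rpow_le_of_measure_le (measurable_sharpMax β f)
    (H := fun x => ‖f x - a‖ₑ) (by fun_prop) hp _ fun s hs => ?_
  have h1 := D.measure_dense_le (E := {x | ENNReal.ofReal s < ‖f x - a‖ₑ})
    (measurableSet_lt measurable_const (by fun_prop)) (ENNReal.ofReal β)
  rw [← ENNReal.mul_div_right_comm,
    ENNReal.le_div_iff_mul_le (Or.inl hβ') (Or.inl ENNReal.ofReal_ne_top), mul_comm]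
  refine le_trans (mul_le_mul_right (measure_mono fun x hx => ?_) _) h1
  obtain ⟨c, r, hr, hxB, h⟩ := lt_sharpMax_iff.1 hx
  refine ⟨c, r, hr, hxB, ?_⟩
  by_contra! hle
  exact not_le.2 h (iInf_le_of_le a (rearrangement_le hle))

end Sharp

/-! ### Estimates for the `K`-functional -/

/-- The constant `a` is within `K` of the mean, hence the factor `2`. Finiteness of `K` provides
integrability, without which the Bochner mean would be the default value `0`. -/
lemma lintegral_sub_average_le {S : Type*} [MeasurableSpace S] {μ : Measure S} {f : S → ℝ}
    (hf : AEStronglyMeasurable f μ) {B : Set S} (h0 : μ B ≠ 0) (h1 : μ B ≠ ∞) {a : ℝ} {K : ℝ≥0∞}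
    (hK : K ≠ ∞) (h : ∫⁻ x in B, ‖f x - a‖ₑ ∂μ ≤ K * μ B) :
    ⨍⁻ x in B, ‖f x - ⨍ y in B, f y ∂μ‖ₑ ∂μ ≤ 2 * K := by
  set ν := (μ B)⁻¹ • μ.restrict B with hν
  have hprob : IsProbabilityMeasure ν := ⟨by
    rw [hν, Measure.smul_apply, Measure.restrict_apply_univ, smul_eq_mul,
      ENNReal.inv_mul_cancel h0 h1]⟩
  have hav : ⨍ y in B, f y ∂μ = ∫ y, f y ∂ν := by
    rw [average, Measure.restrict_apply_univ]
  have hlav : ∀ g : S → ℝ≥0∞, ⨍⁻ x in B, g x ∂μ = ∫⁻ x, g x ∂ν := fun g => by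
    rw [laverage, Measure.restrict_apply_univ]
  have hνK : ∫⁻ x, ‖f x - a‖ₑ ∂ν ≤ K := by
    rw [hν, lintegral_smul_measure, smul_eq_mul, ← ENNReal.div_eq_inv_mul]
    exact ENNReal.div_le_of_le_mul h
  have hfν : AEStronglyMeasurable f ν := (hf.restrict).smul_measure _
  have hint : Integrable (fun x => f x - a) ν :=
    ⟨hfν.sub aestronglyMeasurable_const, hνK.trans_lt hK.lt_top⟩
  have hint' : Integrable f ν := by
    refine (hint.add (integrable_const a)).congr (Filter.Eventually.of_forall fun x => ?_)
    simp
  have hmean : ‖a - ∫ y, f y ∂ν‖ₑ ≤ K := by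
    have : a - ∫ y, f y ∂ν = -∫ y, (f y - a) ∂ν := by
      rw [integral_sub hint' (integrable_const a)]
      simp
    rw [this, enorm_neg]
    exact (enorm_integral_le_lintegral_enorm _).trans hνK
  rw [hlav, hav]
  calc ∫⁻ x, ‖f x - ∫ y, f y ∂ν‖ₑ ∂ν ≤ ∫⁻ x, (‖f x - a‖ₑ + K) ∂ν := by
        refine lintegral_mono fun x => ?_
        rw [← sub_add_sub_cancel (f x) a]
        exact (enorm_add_le _ _).trans (add_le_add le_rfl hmean)
    _ = ∫⁻ x, ‖f x - a‖ₑ ∂ν + K := by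
        rw [lintegral_add_right _ measurable_const, lintegral_const, measure_univ, mul_one]
    _ ≤ K + K := by gcongr
    _ = 2 * K := (two_mul K).symm

lemma eLpNorm_ofReal_eq {S ε : Type*} [MeasurableSpace S] [TopologicalSpace ε] [ContinuousENorm ε]
    {μ : Measure S} {p : ℝ} (hp : 0 < p) (f : S → ε) :
    eLpNorm f (ENNReal.ofReal p) μ = (∫⁻ x, ‖f x‖ₑ ^ p ∂μ) ^ (1 / p) := by
  rw [eLpNorm_eq_lintegral_rpow_enorm_toReal (by simpa using hp) ENNReal.ofReal_ne_top,
    ENNReal.toReal_ofReal hp.le]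

section Main

variable {X : Type*} [PseudoMetricSpace X] [MeasureSpace X]

lemma bmoNorm_le (D : DyadicGrid (volume : Measure (Fin 2 → X))) {F : (Fin 2 → X) →ₘ[volume] ℝ}
    {K : ℝ≥0∞} (hK : K ≠ ∞)
    (h : ∀ c r, 0 < r → ∃ a : ℝ, ∫⁻ x in Metric.ball c r, ‖F x - a‖ₑ ≤
      K * volume (Metric.ball c r)) : bmoNorm F ≤ 2 * K := by
  refine iSup_le fun c => iSup_le fun r => iSup_le fun hr => ?_
  rw [cube_eq_ball c hr]
  obtain ⟨a, ha⟩ := h c r hr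
  exact lintegral_sub_average_le F.aestronglyMeasurable (D.measure_ball_pos c r hr).ne'
    (D.measure_ball_lt_top c r).ne hK ha

lemma measure_deviation_le (D : DyadicGrid (volume : Measure (Fin 2 → X)))
    (F : (Fin 2 → X) →ₘ[volume] ℝ) (hF : bmoNorm F ≠ ∞) {β : ℝ} (hβ : 0 < β) (c : Fin 2 → X)
    {r : ℝ} (hr : 0 < r) :
    ∃ b : ℝ, volume (Metric.ball c r ∩ {x | bmoNorm F / ENNReal.ofReal β < ‖F x - b‖ₑ}) ≤
      ENNReal.ofReal β * volume (Metric.ball c r) := by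
  set B := Metric.ball c r with hB
  have h1 := (D.measure_ball_lt_top c r).ne
  have h0 := (D.measure_ball_pos c r hr).ne'
  have hβ0 : ENNReal.ofReal β ≠ 0 := by simpa using hβ
  refine ⟨⨍ z in B, F z ∂volume, ?_⟩
  set b := ⨍ z in B, F z ∂volume with hb
  have hav : ∫⁻ y in B, ‖F y - b‖ₑ ≤ bmoNorm F * volume B := by
    have : ⨍⁻ y in B, ‖F y - b‖ₑ ∂volume ≤ bmoNorm F := by
      rw [hb, hB, ← cube_eq_ball c hr]
      exact le_iSup_of_le c (le_iSup_of_le r (le_iSup_of_le hr le_rfl))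
    rw [setLAverage_eq] at this
    rwa [ENNReal.div_le_iff h0 h1] at this
  have hm : AEMeasurable (fun y => ‖F y - b‖ₑ) (volume.restrict B) := by
    have := F.measurable
    fun_prop
  have hres : ∀ s : ℝ≥0∞, volume (B ∩ {x | s < ‖F x - b‖ₑ}) =
      volume.restrict B {x | s < ‖F x - b‖ₑ} := by
    intro s
    rw [Measure.restrict_apply, inter_comm]
    have := F.measurable
    exact measurableSet_lt measurable_const (by fun_prop)
  rw [hres]
  -- Chebyshev at threshold zero says nothing; in that case `F` is a.e. constant on the ball.
  rcases eq_or_ne (bmoNorm F) 0 with h | h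
  · rw [h, zero_mul, le_zero_iff, lintegral_eq_zero_iff' hm] at hav
    have : volume.restrict B {x | bmoNorm F / ENNReal.ofReal β < ‖F x - b‖ₑ} = 0 := by
      refine measure_eq_zero_iff_ae_notMem.2 ?_
      filter_upwards [hav] with x hx h2
      have h2 : bmoNorm F / ENNReal.ofReal β < ‖F x - b‖ₑ := h2
      rw [hx] at h2
      exact not_lt_zero h2
    rw [this]; exact zero_le
  · have h2 := mul_meas_ge_le_lintegral₀ hm (bmoNorm F / ENNReal.ofReal β)
    have h3 := h2.trans hav
    have h4 : volume.restrict B {x | bmoNorm F / ENNReal.ofReal β < ‖F x - b‖ₑ} ≤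
        volume.restrict B {x | bmoNorm F / ENNReal.ofReal β ≤ ‖F x - b‖ₑ} :=
      measure_mono fun x hx => le_of_lt (show bmoNorm F / ENNReal.ofReal β < ‖F x - b‖ₑ from hx)
    refine h4.trans ?_
    generalize volume.restrict B {x | bmoNorm F / ENNReal.ofReal β ≤ ‖F x - b‖ₑ} = m at h3 ⊢
    rw [div_eq_mul_inv, mul_assoc, ENNReal.mul_le_mul_iff_right h hF, ← ENNReal.div_eq_inv_mul,
      ENNReal.div_le_iff hβ0 ENNReal.ofReal_ne_top, mul_comm] at h3
    exact h3

variable [OpensMeasurableSpace (Fin 2 → X)] [SFinite (volume : Measure (Fin 2 → X))]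

lemma rearr_sharpMax_le_peetreK [SecondCountableTopology X]
    (D : DyadicGrid (volume : Measure (Fin 2 → X))) {α : ℝ} (hα : 0 < α) {p₀ : ℝ} (hp₀ : 1 ≤ p₀) :
    ∃ C : ℝ≥0, ∀ (f : (Fin 2 → X) →ₘ[volume] ℝ) (t : ℝ), 0 < t →
      (∫⁻ u in Ioo 0 (t ^ p₀), rearr volume (sharpMax α f) u ^ p₀) ^ (1 / p₀) ≤
        C * peetreK (lpNormModConst p₀) bmoNorm t f := by
  have hp0 : 0 < p₀ := by linarith
  have hα2 : 0 < α / 2 := by linarith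
  set C₁ : ℝ≥0 := (64 / Real.toNNReal (α / 2)) ^ (1 / p₀) + (Real.toNNReal (α / 2))⁻¹ with hC₁
  have hA0 : Real.toNNReal (α / 2) ≠ 0 := by simpa using hα2
  have hCpos : (C₁ : ℝ≥0∞) ≠ 0 := by
    rw [ENNReal.coe_ne_zero, hC₁]
    have : 0 < (Real.toNNReal (α / 2))⁻¹ := inv_pos.2 (pos_iff_ne_zero.2 hA0)
    positivity
  have hCa : (64 / ENNReal.ofReal (α / 2)) ^ (1 / p₀) ≤ (C₁ : ℝ≥0∞) := by
    have : 64 / ENNReal.ofReal (α / 2) = ((64 / Real.toNNReal (α / 2) : ℝ≥0) : ℝ≥0∞) := by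
      rw [ENNReal.coe_div hA0]; rfl
    rw [this, ← ENNReal.coe_rpow_of_nonneg _ (by positivity)]
    exact ENNReal.coe_le_coe.2 le_self_add
  have hCb : (ENNReal.ofReal (α / 2))⁻¹ ≤ (C₁ : ℝ≥0∞) := by
    rw [ENNReal.ofReal, ← ENNReal.coe_inv hA0]
    exact ENNReal.coe_le_coe.2 le_add_self
  refine ⟨C₁, fun f t ht => ?_⟩
  -- The nonzero constant moves to the left so that the infimum over decompositions stands alone.
  rw [mul_comm, ← ENNReal.div_le_iff hCpos ENNReal.coe_ne_top]
  refine le_iInf fun f₀ => le_iInf fun f₁ => le_iInf fun hf => ?_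
  rw [ENNReal.div_le_iff hCpos ENNReal.coe_ne_top]
  by_cases hb : bmoNorm f₁ = ∞
  · rw [hb, ENNReal.mul_top (by simpa using ht), add_top, ENNReal.top_mul hCpos]
    exact le_top
  have hsum : ∀ᵐ x, f x = f₀ x + f₁ x := by
    rw [← hf]; exact AEEqFun.coeFn_add f₀ f₁
  set u := bmoNorm f₁ / ENNReal.ofReal (α / 2) with hu
  have hpt := sharpMax_le_add hα hsum (u := u) fun c r hr =>
    measure_deviation_le D f₁ hb hα2 c hr
  set G₀ := sharpMax (α / 2) f₀ with hG₀
  have hre := rearr_le_add_const (μ := volume) hpt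
  have hT : 0 < t ^ p₀ := Real.rpow_pos_of_pos ht _
  calc (∫⁻ v in Ioo 0 (t ^ p₀), rearr volume (sharpMax α f) v ^ p₀) ^ (1 / p₀)
      ≤ (∫⁻ v in Ioo 0 (t ^ p₀), ((rearr volume G₀ + fun _ : ℝ => u) v) ^ p₀) ^ (1 / p₀) := by
        gcongr with v
        exact hre v
    _ ≤ (∫⁻ v in Ioo 0 (t ^ p₀), rearr volume G₀ v ^ p₀) ^ (1 / p₀) +
          (∫⁻ _ in Ioo 0 (t ^ p₀), u ^ p₀) ^ (1 / p₀) :=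
        ENNReal.lintegral_Lp_add_le (antitone_rearr (G := G₀)).measurable.aemeasurable
          aemeasurable_const hp₀
    _ ≤ C₁ * lpNormModConst p₀ f₀ + C₁ * (ENNReal.ofReal t * bmoNorm f₁) := by
        gcongr
        · rw [lpNormModConst, ENNReal.mul_iInf_of_ne hCpos ENNReal.coe_ne_top]
          refine le_iInf fun a => ?_
          rw [eLpNorm_ofReal_eq hp0]
          calc _ ≤ (64 / ENNReal.ofReal (α / 2) * ∫⁻ x, ‖f₀ x - a‖ₑ ^ p₀) ^ (1 / p₀) := by
                gcongr
                refine (lintegral_mono_set Ioo_subset_Ioi_self).trans ?_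
                rw [lintegral_rearr_rpow (measurable_sharpMax _ _) hp0]
                exact lintegral_sharpMax_rpow_le D hα2 f₀.measurable a hp0
            _ ≤ _ := by
                rw [ENNReal.mul_rpow_of_nonneg _ _ (by positivity)]
                gcongr
        · rw [lintegral_const, Measure.restrict_apply_univ, Real.volume_Ioo, sub_zero,
            ENNReal.mul_rpow_of_nonneg _ _ (by positivity), ← ENNReal.rpow_mul,
            mul_one_div_cancel hp0.ne', ENNReal.rpow_one, ENNReal.ofReal_rpow_of_pos hT,
            ← Real.rpow_mul ht.le, mul_one_div_cancel hp0.ne', Real.rpow_one, hu,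
            ENNReal.div_eq_inv_mul, mul_assoc, mul_comm (bmoNorm f₁)]
          gcongr
    _ = _ := by ring

lemma peetreK_le_rearr_sharpMax [(volume : Measure (Fin 2 → X)).OuterRegular]
    (D : DyadicGrid (volume : Measure (Fin 2 → X))) {α : ℝ} (hα : ENNReal.ofReal α * 4 ^ 11 ≤ 1)
    {p₀ : ℝ} (hp₀ : 1 ≤ p₀) :
    ∃ C : ℝ≥0, ∀ (f : (Fin 2 → X) →ₘ[volume] ℝ) (t : ℝ), 0 < t →
      rearr volume (sharpMax α f) (t ^ p₀) ≠ ∞ →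
      peetreK (lpNormModConst p₀) bmoNorm t f ≤
        C * (∫⁻ u in Ioo 0 (t ^ p₀), rearr volume (sharpMax α f) u ^ p₀) ^ (1 / p₀) := by
  have hp0 : 0 < p₀ := by linarith
  have hα' : ENNReal.ofReal α ≤ 1 / 256 := by
    rw [ENNReal.le_div_iff_mul_le (by simp) (by simp)]
    refine le_trans ?_ hα
    gcongr
    norm_num
  obtain ⟨C₁, hC₁⟩ := DyadicGrid.lintegral_sub_med_le (D := D) hp₀
  obtain ⟨C₂, hC₂⟩ := D.lintegral_sub_whitneyFun_le hp₀
  obtain ⟨C₃, hC₃⟩ := D.exists_lintegral_sub_le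
  refine ⟨C₁ ^ (1 / p₀) + C₂ ^ (1 / p₀) + 2 * (C₃ + 1), fun f t ht hfin => ?_⟩
  have hT : 0 < t ^ p₀ := Real.rpow_pos_of_pos ht _
  set G := sharpMax α f with hG
  have hGm : Measurable G := measurable_sharpMax α f
  have hosc : OscBound volume f (ENNReal.ofReal α) G := oscBound_sharpMax α f
  set Λ := rearr volume G (t ^ p₀) with hΛ
  set Ω := {x | Λ < G x} with hΩdef
  have hΩ : IsOpen Ω := isOpen_lt_sharpMax α f Λ
  set J := ∫⁻ u in Ioo 0 (t ^ p₀), rearr volume G u ^ p₀ with hJ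
  have hlev : ∫⁻ x in Ω, G x ^ p₀ ≤ J := lintegral_level_le_rearr hGm hp0 (t ^ p₀)
  have htΛ : ENNReal.ofReal t * Λ ≤ J ^ (1 / p₀) := by
    have h1 := ENNReal.rpow_le_rpow (mul_rearr_rpow_le (μ := volume) (G := G) (T := t ^ p₀) hp0)
      (show 0 ≤ 1 / p₀ by positivity)
    rwa [ENNReal.mul_rpow_of_nonneg _ _ (by positivity), ← ENNReal.rpow_mul,
      mul_one_div_cancel hp0.ne', ENNReal.rpow_one, ENNReal.ofReal_rpow_of_pos hT,
      ← Real.rpow_mul ht.le, mul_one_div_cancel hp0.ne', Real.rpow_one] at h1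
  -- Since `Ω` has finite measure, this happens only on a space of finite measure, where a single
  -- cell is everything and no Whitney decomposition is needed.
  by_cases hne : Ω = univ
  · have hcell : ∃ k x, D.cell k x = univ := by
      refine D.infinite_or_cell.resolve_left fun h => ?_
      have := measure_rearr_lt_le (μ := volume) (G := G) (t ^ p₀)
      rw [← hΛ, ← hΩdef, hne, h] at this
      exact ENNReal.ofReal_ne_top (top_le_iff.1 this)
    obtain ⟨k, x, hkx⟩ := hcell
    have h1 := hC₁ f G _ f.measurable hGm hα' hosc k x
    rw [hkx, ← hne] at h1
    have h0 : bmoNorm (0 : (Fin 2 → X) →ₘ[volume] ℝ) = 0 := by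
      have := bmoNorm_le D (F := 0) (K := 0) (by simp) fun c r _ => ⟨0, by
        rw [zero_mul, le_zero_iff]
        refine (lintegral_congr_ae (g := fun _ => (0 : ℝ≥0∞)) ?_).trans lintegral_zero
        filter_upwards [ae_restrict_of_ae (AEEqFun.coeFn_zero (β := ℝ) (μ := volume))] with y hy
        simp [hy]⟩
      simpa using this
    calc peetreK (lpNormModConst p₀) bmoNorm t f
        ≤ lpNormModConst p₀ f + ENNReal.ofReal t * bmoNorm (0 : (Fin 2 → X) →ₘ[volume] ℝ) :=
          iInf_le_of_le f (iInf_le_of_le 0 (iInf_le _ (add_zero f)))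
      _ = lpNormModConst p₀ f := by rw [h0, mul_zero, add_zero]
      _ ≤ (∫⁻ y, ‖f y - D.med f k x‖ₑ ^ p₀) ^ (1 / p₀) := by
          rw [← eLpNorm_ofReal_eq hp0 (fun y => f y - D.med f k x)]
          exact iInf_le _ _
      _ ≤ (C₁ * J) ^ (1 / p₀) := by
          gcongr
          rw [hne, Measure.restrict_univ] at h1
          refine h1.trans ?_
          gcongr
          rw [hne, Measure.restrict_univ] at hlev
          exact hlev
      _ = (C₁ ^ (1 / p₀) : ℝ≥0) * J ^ (1 / p₀) := by
          rw [ENNReal.mul_rpow_of_nonneg _ _ (by positivity),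
            ENNReal.coe_rpow_of_nonneg _ (by positivity)]
      _ ≤ _ := by
          gcongr
          rw [add_assoc]; exact le_self_add
  · set F₁ := D.whitneyFun Ω f with hF₁
    have hF₁m : Measurable F₁ := D.measurable_whitneyFun hΩ hne f.measurable
    have hF₀m : Measurable fun x => f x - F₁ x := f.measurable.sub hF₁m
    set f₁ : (Fin 2 → X) →ₘ[volume] ℝ := AEEqFun.mk F₁ hF₁m.aestronglyMeasurable with hf₁
    set f₀ : (Fin 2 → X) →ₘ[volume] ℝ := AEEqFun.mk (fun x => f x - F₁ x)
      hF₀m.aestronglyMeasurable with hf₀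
    have hsum : f₀ + f₁ = f := by
      refine AEEqFun.ext ?_
      filter_upwards [AEEqFun.coeFn_add f₀ f₁, AEEqFun.coeFn_mk _ hF₀m.aestronglyMeasurable,
        AEEqFun.coeFn_mk _ hF₁m.aestronglyMeasurable] with x h1 h2 h3
      rw [h1, Pi.add_apply, h2, h3, sub_add_cancel]
    have hN₀ : lpNormModConst p₀ f₀ ≤ (C₂ ^ (1 / p₀) : ℝ≥0) * J ^ (1 / p₀) := by
      refine (iInf_le _ (0 : ℝ)).trans ?_
      rw [eLpNorm_ofReal_eq hp0, ENNReal.coe_rpow_of_nonneg _ (by positivity),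
        ← ENNReal.mul_rpow_of_nonneg _ _ (by positivity)]
      gcongr
      calc ∫⁻ x, ‖f₀ x - 0‖ₑ ^ p₀ = ∫⁻ x, ‖f x - F₁ x‖ₑ ^ p₀ := by
            refine lintegral_congr_ae ?_
            filter_upwards [AEEqFun.coeFn_mk _ hF₀m.aestronglyMeasurable] with x h2
            rw [h2, sub_zero]
        _ ≤ C₂ * ∫⁻ x in Ω, G x ^ p₀ := hC₂ f G _ Ω f.measurable hGm hα' hosc hΩ hne
        _ ≤ C₂ * J := by gcongr
    have hosc₁ := D.oscBound_whitneyFun hΩ hne f.measurable hα hosc (Λ := Λ)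
      fun z hz => not_lt.1 hz
    have hb : bmoNorm f₁ ≤ (2 * (C₃ + 1) : ℝ≥0) * Λ := by
      -- `OscBound` speaks only of levels strictly above `Λ`; the bound at `Λ` follows by letting
      -- `s` decrease to it.
      have hs : ∀ s : ℝ≥0∞, Λ < s → bmoNorm f₁ ≤ (2 * (C₃ + 1) : ℝ≥0) * s := by
        intro s hΛs
        rcases eq_or_ne s ∞ with rfl | hs
        · rw [ENNReal.mul_top (by simp)]; exact le_top
        have hs0 : 0 < s.toReal := ENNReal.toReal_pos (bot_le.trans_lt hΛs).ne' hs
        refine (bmoNorm_le D (K := C₃ * s) (by finiteness) fun c r hr => ?_).trans ?_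
        · obtain ⟨a, ha⟩ := hC₃ F₁ Λ hF₁m hosc₁ c r s.toReal hr hs0 (by rwa [ENNReal.ofReal_toReal hs])
          rw [ENNReal.ofReal_toReal hs] at ha
          refine ⟨a, le_trans (le_of_eq ?_) ha⟩
          refine lintegral_congr_ae (ae_restrict_of_ae ?_)
          filter_upwards [AEEqFun.coeFn_mk _ hF₁m.aestronglyMeasurable] with x h2
          rw [h2]
        · rw [← mul_assoc]
          gcongr
          push_cast
          gcongr
          exact le_self_add
      have hc0 : ((2 * (C₃ + 1) : ℝ≥0) : ℝ≥0∞) ≠ 0 := by simp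
      rw [mul_comm, ← ENNReal.div_le_iff hc0 ENNReal.coe_ne_top]
      refine le_of_forall_gt fun s hΛs => ?_
      obtain ⟨s', h1, h2⟩ := exists_between hΛs
      refine lt_of_le_of_lt ?_ h2
      rw [ENNReal.div_le_iff hc0 ENNReal.coe_ne_top, mul_comm]
      exact hs s' h1
    calc peetreK (lpNormModConst p₀) bmoNorm t f
        ≤ lpNormModConst p₀ f₀ + ENNReal.ofReal t * bmoNorm f₁ :=
          iInf_le_of_le f₀ (iInf_le_of_le f₁ (iInf_le _ hsum))
      _ ≤ (C₂ ^ (1 / p₀) : ℝ≥0) * J ^ (1 / p₀) +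
            ENNReal.ofReal t * ((2 * (C₃ + 1) : ℝ≥0) * Λ) := by gcongr
      _ = (C₂ ^ (1 / p₀) : ℝ≥0) * J ^ (1 / p₀) +
            (2 * (C₃ + 1) : ℝ≥0) * (ENNReal.ofReal t * Λ) := by ring
      _ ≤ (C₂ ^ (1 / p₀) : ℝ≥0) * J ^ (1 / p₀) + (2 * (C₃ + 1) : ℝ≥0) * J ^ (1 / p₀) := by gcongr
      _ = ((C₂ ^ (1 / p₀) + 2 * (C₃ + 1) : ℝ≥0) : ℝ≥0∞) * J ^ (1 / p₀) := by
          rw [ENNReal.coe_add, add_mul]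
      _ ≤ _ := by
          gcongr
          exact le_add_self

end Main

/-! ### Dyadic grids on the plane and on the torus -/

/-- A coordinate on a one-dimensional space that induces a dyadic grid on its square. -/
structure DyadicLine (X : Type*) [PseudoMetricSpace X] [MeasureSpace X] where
  coord : X → ℝ
  measurable_coord : Measurable coord
  dist_le : ∀ x y, dist x y ≤ |coord x - coord y|
  doubling : ∀ (x : X) r, 0 < r → volume (Metric.ball x (2 * r)) ≤ 2 * volume (Metric.ball x r)
  volume_ball_pos : ∀ (x : X) r, 0 < r → 0 < volume (Metric.ball x r)
  volume_ball_lt_top : ∀ (x : X) r, volume (Metric.ball x r) < ∞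
  volume_ball_le : ∀ (k : ℤ) (x : X), volume (Metric.ball x (2 ^ (-k))) ≤
    2 * volume {y | ⌊(2 : ℝ) ^ k * coord y⌋ = ⌊(2 : ℝ) ^ k * coord x⌋}
  infinite_or_const : volume (univ : Set X) = ∞ ∨ ∀ x, ⌊coord x⌋ = 0

lemma floor_eq_of_floor_two_mul_eq {u v : ℝ} (h : ⌊2 * u⌋ = ⌊2 * v⌋) : ⌊u⌋ = ⌊v⌋ := by
  have key : ∀ w : ℝ, 2 * ⌊w⌋ ≤ ⌊2 * w⌋ ∧ ⌊2 * w⌋ < 2 * ⌊w⌋ + 2 := by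
    intro w
    constructor
    · rw [Int.le_floor]
      push_cast
      linarith [Int.floor_le w]
    · rw [Int.floor_lt]
      push_cast
      linarith [Int.lt_floor_add_one w]
  have h1 := key u
  have h2 := key v
  lia

namespace DyadicLine

variable {X : Type*} [PseudoMetricSpace X] [MeasureSpace X]
  [SigmaFinite (volume : Measure X)]

lemma volume_ball_pi (c : Fin 2 → X) {r : ℝ} (hr : 0 < r) :
    volume (Metric.ball c r) = volume (Metric.ball (c 0) r) * volume (Metric.ball (c 1) r) := by
  rw [ball_pi c hr, volume_pi_pi, Fin.prod_univ_two]

/-- The dyadic grid on the square. -/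
def toGrid [Nonempty X] (L : DyadicLine X) : DyadicGrid (volume : Measure (Fin 2 → X)) where
  label k x := fun i => ⌊(2 : ℝ) ^ k * L.coord (x i)⌋
  measurable_label k := by
    refine measurable_pi_lambda _ fun i => Int.measurable_floor.comp ?_
    have := L.measurable_coord
    fun_prop
  nested k x y h := by
    ext i
    have := congrFun h i
    simp only [zpow_add_one₀ (two_ne_zero' ℝ), mul_comm ((2 : ℝ) ^ k) 2, mul_assoc] at this
    exact floor_eq_of_floor_two_mul_eq this
  dist_lt k x y h := by
    have hk : (0 : ℝ) < 2 ^ k := by positivity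
    rw [dist_pi_lt_iff (by positivity)]
    intro i
    refine (L.dist_le _ _).trans_lt ?_
    have h1 := Int.abs_sub_lt_one_of_floor_eq_floor (congrFun h i)
    rw [← mul_sub, abs_mul, abs_of_pos hk] at h1
    rw [zpow_neg, ← one_div, lt_div_iff₀ hk, mul_comm]
    exact h1
  measure_ball_le k x := by
    have hcell : {y : Fin 2 → X | (fun i => ⌊(2 : ℝ) ^ k * L.coord (y i)⌋) =
        fun i => ⌊(2 : ℝ) ^ k * L.coord (x i)⌋} =
        univ.pi fun i => {y | ⌊(2 : ℝ) ^ k * L.coord y⌋ = ⌊(2 : ℝ) ^ k * L.coord (x i)⌋} := by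
      ext y
      simp [funext_iff]
    rw [hcell, volume_pi_pi, Fin.prod_univ_two, volume_ball_pi x (by positivity)]
    calc _ ≤ (2 * volume {y | ⌊(2 : ℝ) ^ k * L.coord y⌋ = ⌊(2 : ℝ) ^ k * L.coord (x 0)⌋}) *
          (2 * volume {y | ⌊(2 : ℝ) ^ k * L.coord y⌋ = ⌊(2 : ℝ) ^ k * L.coord (x 1)⌋}) :=
          mul_le_mul' (L.volume_ball_le k (x 0)) (L.volume_ball_le k (x 1))
      _ = _ := by ring
  doubling x r hr := by
    rw [volume_ball_pi x hr, volume_ball_pi x (by positivity)]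
    calc _ ≤ (2 * volume (Metric.ball (x 0) r)) * (2 * volume (Metric.ball (x 1) r)) :=
          mul_le_mul' (L.doubling _ r hr) (L.doubling _ r hr)
      _ = _ := by ring
  measure_ball_pos x r hr := by
    rw [volume_ball_pi x hr]
    exact ENNReal.mul_pos (L.volume_ball_pos _ r hr).ne' (L.volume_ball_pos _ r hr).ne'
  measure_ball_lt_top x r := by
    rcases le_or_gt r 0 with hr | hr
    · simp [Metric.ball_eq_empty.2 hr]
    · rw [volume_ball_pi x hr]
      exact ENNReal.mul_lt_top (L.volume_ball_lt_top _ r) (L.volume_ball_lt_top _ r)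
  infinite_or_cell := by
    rcases L.infinite_or_const with h | h
    · left
      rw [← pi_univ univ, volume_pi_pi, Fin.prod_univ_two, h]
      simp
    · right
      refine ⟨0, fun _ => Classical.arbitrary X, ?_⟩
      ext y
      simp [h]

end DyadicLine

lemma volume_floor_eq {k : ℤ} (n : ℤ) :
    volume {y : ℝ | ⌊(2 : ℝ) ^ k * y⌋ = n} = ENNReal.ofReal (2 ^ (-k)) := by
  have hk : (0 : ℝ) < 2 ^ k := by positivity
  have : {y : ℝ | ⌊(2 : ℝ) ^ k * y⌋ = n} = Ico (n / (2 : ℝ) ^ k) ((n + 1) / (2 : ℝ) ^ k) := by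
    ext y
    simp only [mem_ofPred_eq, Int.floor_eq_iff, mem_Ico, div_le_iff₀ hk, lt_div_iff₀ hk,
      mul_comm y]
  rw [this, Real.volume_Ico, zpow_neg]
  congr 1
  field_simp
  ring

/-- The dyadic intervals of the real line. -/
def realLine : DyadicLine ℝ where
  coord := id
  measurable_coord := measurable_id
  dist_le x y := le_of_eq (Real.dist_eq x y)
  doubling x r _ := by
    rw [Real.volume_ball, Real.volume_ball, ← ENNReal.ofReal_ofNat 2, ← ENNReal.ofReal_mul (by simp)]
  volume_ball_pos x r hr := Metric.measure_ball_pos _ _ hr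
  volume_ball_lt_top x r := measure_ball_lt_top
  volume_ball_le k x := by
    simp only [id]
    rw [volume_floor_eq, Real.volume_ball, ← ENNReal.ofReal_ofNat 2, ← ENNReal.ofReal_mul (by simp)]
  infinite_or_const := Or.inl Real.volume_univ

/-- Open balls are handled by closed balls of radius increasing to `r`, the volume formula being
continuous in the radius. -/
lemma volume_ball_circle (x : UnitAddCircle) (r : ℝ) :
    volume (Metric.ball x r) = ENNReal.ofReal (min 1 (2 * r)) := by
  refine le_antisymm ?_ ?_
  · exact (measure_mono Metric.ball_subset_closedBall).trans_eq (AddCircle.volume_closedBall 1 r)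
  · have h : ∀ r' < r, ENNReal.ofReal (min 1 (2 * r')) ≤ volume (Metric.ball x r) := fun r' hr' =>
      (AddCircle.volume_closedBall 1 (x := x) r').symm.trans_le
        (measure_mono (Metric.closedBall_subset_ball hr'))
    have hcont : Continuous fun r' : ℝ => ENNReal.ofReal (min 1 (2 * r')) :=
      ENNReal.continuous_ofReal.comp (by fun_prop)
    refine le_of_tendsto (hcont.continuousWithinAt (s := Iio r) (x := r)) ?_
    filter_upwards [self_mem_nhdsWithin] with r' hr'
    exact h r' hr'

/-- The representative of a point of the circle in `[0, 1)`. -/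
def circleCoord (x : UnitAddCircle) : ℝ := AddCircle.equivIco 1 0 x

lemma circleCoord_mem (x : UnitAddCircle) : circleCoord x ∈ Ico (0 : ℝ) 1 := by
  have h : (AddCircle.equivIco 1 0 x : ℝ) ∈ Ico (0 : ℝ) (0 + 1) := (AddCircle.equivIco 1 0 x).2
  exact ⟨h.1, h.2.trans_eq (zero_add 1)⟩

lemma coe_circleCoord (x : UnitAddCircle) : (circleCoord x : UnitAddCircle) = x :=
  AddCircle.coe_equivIco

lemma circleCoord_coe {y : ℝ} (hy : y ∈ Ico (0 : ℝ) 1) : circleCoord (y : UnitAddCircle) = y :=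
  AddCircle.equivIco_coe_of_mem (by simpa using hy)

lemma measurable_circleCoord : Measurable circleCoord :=
  measurable_subtype_coe.comp (AddCircle.measurableEquivIco 1 0).measurable

lemma volume_circleCoord_preimage {s : Set ℝ} (hs : MeasurableSet s) :
    volume (circleCoord ⁻¹' s) = volume (s ∩ Ico 0 1) := by
  rw [AddCircle.add_projection_respects_measure 1 0 (measurable_circleCoord hs), zero_add]
  have h1 : (QuotientAddGroup.mk ⁻¹' (circleCoord ⁻¹' s) ∩ Ioo 0 1 : Set ℝ) = s ∩ Ioo 0 1 := by
    ext y
    refine and_congr_left fun hy => ?_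
    have : circleCoord (y : UnitAddCircle) = y := circleCoord_coe (Ioo_subset_Ico_self hy)
    change circleCoord (y : UnitAddCircle) ∈ s ↔ y ∈ s
    rw [this]
  rw [measure_congr ((ae_eq_refl _).inter Ioo_ae_eq_Ioc.symm), h1,
    measure_congr ((ae_eq_refl s).inter Ioo_ae_eq_Ico)]

/-- For `k ≤ 0` the only cell is the whole circle; for `k ≥ 0` the dyadic interval lies inside `[0,
1)` and keeps its full length. -/
lemma volume_circle_cell (k : ℤ) (x : UnitAddCircle) :
    ENNReal.ofReal (min 1 (2 ^ (-k))) ≤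
      volume {y | ⌊(2 : ℝ) ^ k * circleCoord y⌋ = ⌊(2 : ℝ) ^ k * circleCoord x⌋} := by
  obtain ⟨hx0, hx1⟩ := circleCoord_mem x
  rcases le_total k 0 with hk | hk
  · have h2 : (2 : ℝ) ^ k ≤ 1 := zpow_le_one_of_nonpos₀ one_le_two hk
    have h3 : (0 : ℝ) < 2 ^ k := by positivity
    have h0 : ∀ y : UnitAddCircle, ⌊(2 : ℝ) ^ k * circleCoord y⌋ = 0 := by
      intro y
      obtain ⟨hy0, hy1⟩ := circleCoord_mem y
      rw [Int.floor_eq_zero_iff]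
      exact ⟨by positivity, by nlinarith⟩
    simp only [h0, ofPred_true, UnitAddCircle.measure_univ]
    exact ENNReal.ofReal_le_one.2 (min_le_left _ _)
  · obtain ⟨m, rfl⟩ := Int.eq_ofNat_of_zero_le hk
    set n := ⌊(2 : ℝ) ^ (m : ℤ) * circleCoord x⌋ with hn
    have hp : (0 : ℝ) < 2 ^ (m : ℤ) := by positivity
    have hn0 : 0 ≤ n := Int.floor_nonneg.2 (by positivity)
    have hn1 : n + 1 ≤ 2 ^ m := by
      have : n < 2 ^ m := by
        rw [hn, Int.floor_lt]
        push_cast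
        rw [zpow_natCast] at hp ⊢
        nlinarith
      lia
    have hn1' : (n : ℝ) + 1 ≤ 2 ^ (m : ℤ) := by
      rw [zpow_natCast]
      exact_mod_cast hn1
    have hn0' : (0 : ℝ) ≤ n := by exact_mod_cast hn0
    have hms : MeasurableSet {y : ℝ | ⌊(2 : ℝ) ^ (m : ℤ) * y⌋ = n} :=
      measurableSet_eq_fun (Int.measurable_floor.comp (by fun_prop)) measurable_const
    have h4 : {y : ℝ | ⌊(2 : ℝ) ^ (m : ℤ) * y⌋ = n} ∩ Ico 0 1 =
        {y : ℝ | ⌊(2 : ℝ) ^ (m : ℤ) * y⌋ = n} := by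
      refine inter_eq_left.2 fun y hy => ?_
      obtain ⟨hy0, hy1⟩ := Int.floor_eq_iff.1 (show ⌊(2 : ℝ) ^ (m : ℤ) * y⌋ = n from hy)
      constructor
      · by_contra! hlt
        nlinarith
      · by_contra! hlt
        nlinarith
    have h5 := volume_circleCoord_preimage hms
    rw [h4, volume_floor_eq] at h5
    change _ ≤ volume (circleCoord ⁻¹' {y : ℝ | ⌊(2 : ℝ) ^ (m : ℤ) * y⌋ = n})
    rw [h5]
    exact ENNReal.ofReal_le_ofReal (min_le_right _ _)

/-- The dyadic arcs of the circle. -/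
def circleLine : DyadicLine UnitAddCircle where
  coord := circleCoord
  measurable_coord := measurable_circleCoord
  dist_le x y := by
    conv_lhs => rw [← coe_circleCoord x, ← coe_circleCoord y]
    rw [dist_eq_norm, ← AddCircle.coe_sub, UnitAddCircle.norm_eq]
    simpa using round_le (circleCoord x - circleCoord y) 0
  doubling x r hr := by
    rw [volume_ball_circle, volume_ball_circle, ← ENNReal.ofReal_ofNat 2,
      ← ENNReal.ofReal_mul (by simp)]
    refine ENNReal.ofReal_le_ofReal ?_
    rcases le_total 1 (2 * r) with h | h
    · rw [min_eq_left h]; exact (min_le_left _ _).trans (by norm_num)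
    · rw [min_eq_right h]; exact (min_le_right _ _)
  volume_ball_pos x r hr := by
    rw [volume_ball_circle]
    simp [hr]
  volume_ball_lt_top x r := measure_lt_top _ _
  volume_ball_le k x := by
    rw [volume_ball_circle]
    refine le_trans ?_ (mul_le_mul_right (volume_circle_cell k x) 2)
    rw [← ENNReal.ofReal_ofNat 2, ← ENNReal.ofReal_mul (by simp)]
    refine ENNReal.ofReal_le_ofReal ?_
    rcases le_total 1 ((2 : ℝ) ^ (-k)) with h | h
    · rw [min_eq_left h]; exact (min_le_left _ _).trans (by norm_num)
    · rw [min_eq_right h]; exact min_le_right _ _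
  infinite_or_const := by
    right
    intro x
    rw [Int.floor_eq_zero_iff]
    exact circleCoord_mem x

/-! ### The interpolation and extrapolation theorem in a space with a dyadic grid -/

section Final

variable {X : Type*} [PseudoMetricSpace X] [MeasureSpace X]

lemma sharpNorm_eq {α p : ℝ} (hp : 0 < p) (f : (Fin 2 → X) →ₘ[volume] ℝ) :
    sharpNorm α p f = (∫⁻ x, sharpMax α f x ^ p) ^ (1 / p) := by
  rw [sharpNorm, eLpNorm_ofReal_eq hp]
  simp

lemma EqWithConst.of_le {E : Type*} {N M : E → ℝ≥0∞} {A B : Set E} {C : ℝ≥0}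
    (hA : A = {f | N f < ∞}) (hB : B = {f | M f < ∞})
    (h₁ : ∀ f, N f ≤ C * M f) (h₂ : ∀ f, M f ≤ C * N f) : EqWithConst A N B M C := by
  refine ⟨?_, fun f _ => ⟨h₁ f, h₂ f⟩⟩
  rw [hA, hB]
  ext f
  exact ⟨fun h => (h₂ f).trans_lt (ENNReal.mul_lt_top ENNReal.coe_lt_top h),
    fun h => (h₁ f).trans_lt (ENNReal.mul_lt_top ENNReal.coe_lt_top h)⟩

/-- On a finite interval `x^p ≤ 1 + x^q` suffices. This makes `K(1, f)` finite, which places `f` in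
the sum of the two spaces. -/
lemma setLIntegral_rearr_rpow_lt_top {S : Type*} [MeasurableSpace S] {μ : Measure S} [SFinite μ]
    {G : S → ℝ≥0∞} (hG : Measurable G) {p q : ℝ} (hp : 0 < p) (hpq : p ≤ q)
    (h : ∫⁻ x, G x ^ q ∂μ < ∞) (T : ℝ) : ∫⁻ u in Ioo 0 T, rearr μ G u ^ p < ∞ := by
  have hq : 0 < q := hp.trans_le hpq
  calc ∫⁻ u in Ioo 0 T, rearr μ G u ^ p ≤ ∫⁻ u in Ioo 0 T, (1 + rearr μ G u ^ q) := by
        refine lintegral_mono fun u => ?_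
        rcases le_total (rearr μ G u) 1 with hu | hu
        · exact (ENNReal.rpow_le_one hu hp.le).trans le_self_add
        · exact (ENNReal.rpow_le_rpow_of_exponent_le hu hpq).trans le_add_self
    _ = ENNReal.ofReal T + ∫⁻ u in Ioo 0 T, rearr μ G u ^ q := by
        rw [lintegral_add_left measurable_const]
        simp
    _ ≤ ENNReal.ofReal T + ∫⁻ u in Ioi 0, rearr μ G u ^ q := by
        gcongr
        exact Ioo_subset_Ioi_self
    _ < ∞ := by
        rw [lintegral_rearr_rpow hG hq]
        exact ENNReal.add_lt_top.2 ⟨ENNReal.ofReal_lt_top, h⟩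

variable [OpensMeasurableSpace (Fin 2 → X)] [SFinite (volume : Measure (Fin 2 → X))]
  [(volume : Measure (Fin 2 → X)).OuterRegular] [SecondCountableTopology X]

/-- The interpolation spaces of the pair `(L^{p₀}, BMO)` are the spaces `(L^p)^#`, uniformly. -/
theorem exists_eqWithConst_lpBmo (D : DyadicGrid (volume : Measure (Fin 2 → X))) {α : ℝ}
    (hα0 : 0 < α) (hα : ENNReal.ofReal α * 4 ^ 11 ≤ 1) {p₀ : ℝ} (hp₀ : 1 ≤ p₀) :
    ∃ C : ℝ≥0, ∀ θ p : ℝ, θ ∈ Ioo (0 : ℝ) 1 → 1 / p = (1 - θ) / p₀ →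
      lpBmoSpace X p₀ θ p = {f | lpBmoNorm p₀ θ p f < ∞} ∧
        EqWithConst (lpBmoSpace X p₀ θ p) (lpBmoNorm p₀ θ p) (sharpSpace X α p) (sharpNorm α p)
          C := by
  have hp0 : 0 < p₀ := by linarith
  obtain ⟨C₁, hC₁⟩ := rearr_sharpMax_le_peetreK D hα0 hp₀
  obtain ⟨C₂, hC₂⟩ := peetreK_le_rearr_sharpMax D hα hp₀
  -- The summand `1` keeps the constant nonzero, so that the bound is trivial when the sharp norm is
  -- infinite.
  refine ⟨2 * C₁ + 3 * C₂ + 1, fun θ p ⟨h0, h1⟩ hp => ?_⟩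
  have h1' : 0 < 1 - θ := by linarith
  obtain rfl : p = p₀ / (1 - θ) := by
    rw [← one_div_one_div p, hp, one_div_div]
  set p := p₀ / (1 - θ) with hpdef
  have hpp : 0 < p := by positivity
  have hp₀p : p₀ ≤ p := by
    rw [hpdef, le_div_iff₀ h1']
    nlinarith
  have hm : ∀ f : (Fin 2 → X) →ₘ[volume] ℝ, Measurable (sharpMax α f) := fun f =>
    measurable_sharpMax α f
  have hlow : ∀ f : (Fin 2 → X) →ₘ[volume] ℝ, sharpNorm α p f ≤ (2 * C₁ : ℝ≥0) * lpBmoNorm p₀ θ p f := fun f => by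
    rw [sharpNorm_eq hpp]
    exact le_normInterpNorm (hm f) hp₀ h0 h1 C₁ (hC₁ f)
  have hfin : ∀ f : (Fin 2 → X) →ₘ[volume] ℝ, sharpNorm α p f < ∞ → ∫⁻ x, sharpMax α f x ^ p < ∞ := fun f hf => by
    rwa [sharpNorm_eq hpp, ENNReal.rpow_lt_top_iff_of_pos (by positivity)] at hf
  have hK : ∀ f : (Fin 2 → X) →ₘ[volume] ℝ, sharpNorm α p f < ∞ → ∀ t, 0 < t → peetreK (lpNormModConst p₀) bmoNorm t f ≤
      C₂ * (∫⁻ u in Ioo 0 (t ^ p₀), rearr volume (sharpMax α f) u ^ p₀) ^ (1 / p₀) := by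
    intro f hf t ht
    have hT : 0 < t ^ p₀ := Real.rpow_pos_of_pos ht _
    refine hC₂ f t ht fun htop => ?_
    have h2 := (mul_rearr_rpow_le (μ := volume) (G := sharpMax α f) (T := t ^ p₀) hpp).trans
      (lintegral_mono_set Ioo_subset_Ioi_self)
    rw [lintegral_rearr_rpow (hm f) hpp, htop, ENNReal.top_rpow_of_pos hpp,
      ENNReal.mul_top (by simpa using hT)] at h2
    exact not_lt.2 h2 (hfin f hf)
  have hup : ∀ f : (Fin 2 → X) →ₘ[volume] ℝ, lpBmoNorm p₀ θ p f ≤ (2 * C₁ + 3 * C₂ + 1 : ℝ≥0) * sharpNorm α p f := by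
    intro f
    by_cases hf : sharpNorm α p f < ∞
    · refine (normInterpNorm_le (hm f) hp₀ h0 h1 C₂ (hK f hf)).trans ?_
      rw [sharpNorm_eq hpp]
      gcongr
      exact le_add_self.trans le_self_add
    · rw [not_lt_top_iff.1 hf, ENNReal.mul_top (by simp)]
      exact le_top
  have hlow' : ∀ f : (Fin 2 → X) →ₘ[volume] ℝ, sharpNorm α p f ≤ (2 * C₁ + 3 * C₂ + 1 : ℝ≥0) * lpBmoNorm p₀ θ p f := by
    intro f
    refine (hlow f).trans ?_
    gcongr
    rw [add_assoc]
    exact le_self_add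
  have hspace : lpBmoSpace X p₀ θ p = {f | lpBmoNorm p₀ θ p f < ∞} := by
    ext f
    refine ⟨fun h => h.2, fun h => ⟨?_, h⟩⟩
    have hf : sharpNorm α p f < ∞ := (hlow f).trans_lt (ENNReal.mul_lt_top ENNReal.coe_lt_top h)
    have h2 : peetreK (lpNormModConst p₀) bmoNorm 1 f < ∞ := by
      refine (hK f hf 1 one_pos).trans_lt (ENNReal.mul_lt_top ENNReal.coe_lt_top ?_)
      refine ENNReal.rpow_lt_top_of_nonneg (by positivity) ?_
      exact (setLIntegral_rearr_rpow_lt_top (hm f) hp0 hp₀p (hfin f hf) _).ne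
    simp only [peetreK, iInf_lt_iff, ENNReal.ofReal_one, one_mul, ENNReal.add_lt_top] at h2
    obtain ⟨f₀, f₁, h3, h4, h5⟩ := h2
    exact ⟨f₀, f₁, h3, h4, h5⟩
  exact ⟨hspace, EqWithConst.of_le hspace rfl hup hlow'⟩

/-- The interpolation theorem together with its extrapolated form. -/
theorem exists_eqWithConst (D : DyadicGrid (volume : Measure (Fin 2 → X))) {α : ℝ}
    (hα0 : 0 < α) (hα : ENNReal.ofReal α * 4 ^ 11 ≤ 1) {p₀ : ℝ} (hp₀ : 1 ≤ p₀) :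
    ∃ C : ℝ≥0,
      (∀ θ p : ℝ, θ ∈ Ioo (0 : ℝ) 1 → 1 / p = (1 - θ) / p₀ →
        EqWithConst (lpBmoSpace X p₀ θ p) (lpBmoNorm p₀ θ p) (sharpSpace X α p) (sharpNorm α p)
          C) ∧
      (∀ Θ : ℝ → ℝ, IsGrowthFunction Θ →
        EqWithConst (sharpYudovichSpace X α p₀ Θ) (sharpYudovichNorm α p₀ Θ)
          (lpBmoDeltaSpace X p₀ Θ) (lpBmoDeltaNorm p₀ Θ) C) := by
  have hp0 : 0 < p₀ := by linarith
  obtain ⟨C, hC⟩ := exists_eqWithConst_lpBmo D hα0 hα hp₀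
  refine ⟨C, fun θ p hθ hp => (hC θ p hθ hp).2, fun Θ _ => ?_⟩
  have hsharp : ∀ θ ∈ Ioo (0 : ℝ) 1, EqWithConst (lpBmoSpace X p₀ θ (p₀ / (1 - θ)))
      (lpBmoNorm p₀ θ (p₀ / (1 - θ))) (sharpSpace X α (p₀ / (1 - θ)))
      (sharpNorm α (p₀ / (1 - θ))) C := fun θ hθ => (hC θ _ hθ (one_div_div _ _)).2
  have hmem : ∀ θ ∈ Ioo (0 : ℝ) 1, p₀ / (1 - θ) ∈ Ioi p₀ := by
    rintro θ ⟨h0, h1⟩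
    rw [mem_Ioi, lt_div_iff₀ (by linarith)]
    nlinarith
  have hparam : ∀ p ∈ Ioi p₀, ∃ θ ∈ Ioo (0 : ℝ) 1, p₀ / (1 - θ) = p := by
    intro p hp
    have hp : p₀ < p := hp
    have hp' : 0 < p := hp0.trans hp
    refine ⟨1 - p₀ / p, ⟨?_, ?_⟩, ?_⟩
    · rw [sub_pos, div_lt_one hp']; exact hp
    · have : 0 < p₀ / p := by positivity
      linarith
    · rw [sub_sub_cancel, div_div_cancel₀ hp0.ne']
  have hmemEq : ∀ f : (Fin 2 → X) →ₘ[volume] ℝ, (∀ p ∈ Ioi p₀, f ∈ sharpSpace X α p) ↔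
      ∀ θ ∈ Ioo (0 : ℝ) 1, f ∈ lpBmoSpace X p₀ θ (p₀ / (1 - θ)) := by
    intro f
    constructor
    · intro h θ hθ
      rw [(hsharp θ hθ).1]
      exact h _ (hmem θ hθ)
    · intro h p hp
      obtain ⟨θ, hθ, rfl⟩ := hparam p hp
      rw [← (hsharp θ hθ).1]
      exact h θ hθ
  have hle : ∀ f : (Fin 2 → X) →ₘ[volume] ℝ, (∀ θ ∈ Ioo (0 : ℝ) 1, f ∈ lpBmoSpace X p₀ θ (p₀ / (1 - θ))) →
      sharpYudovichNorm α p₀ Θ f ≤ C * lpBmoDeltaNorm p₀ Θ f ∧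
        lpBmoDeltaNorm p₀ Θ f ≤ C * sharpYudovichNorm α p₀ Θ f := by
    intro f hf
    constructor
    · refine iSup₂_le fun p hp => ?_
      obtain ⟨θ, hθ, rfl⟩ := hparam p hp
      refine (ENNReal.div_le_div_right ((hsharp θ hθ).2 f (hf θ hθ)).2 _).trans ?_
      rw [mul_div_assoc]
      gcongr
      exact le_iSup₂_of_le (f := fun θ (_ : θ ∈ Ioo (0 : ℝ) 1) =>
        lpBmoNorm p₀ θ (p₀ / (1 - θ)) f / ENNReal.ofReal (Θ (p₀ / (1 - θ)))) θ hθ le_rfl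
    · refine iSup₂_le fun θ hθ => ?_
      refine (ENNReal.div_le_div_right ((hsharp θ hθ).2 f (hf θ hθ)).1 _).trans ?_
      rw [mul_div_assoc]
      gcongr
      exact le_iSup₂_of_le (f := fun p (_ : p ∈ Ioi p₀) =>
        sharpNorm α p f / ENNReal.ofReal (Θ p)) _ (hmem θ hθ) le_rfl
  refine ⟨?_, fun f hf => hle f ((hmemEq f).1 hf.1)⟩
  ext f
  constructor
  · rintro ⟨h1, h2⟩
    have h3 := (hmemEq f).1 h1
    exact ⟨h3, (hle f h3).2.trans_lt (ENNReal.mul_lt_top ENNReal.coe_lt_top h2)⟩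
  · rintro ⟨h1, h2⟩
    exact ⟨(hmemEq f).2 h1, (hle f h1).1.trans_lt (ENNReal.mul_lt_top ENNReal.coe_lt_top h2)⟩

end Final

end SharpYudovich

end

theorem theorem2p1 :
    ∃ α₀ : ℝ, 0 < α₀ ∧ ∀ α : ℝ, 0 < α → α ≤ α₀ → ∀ p₀ : ℝ, 1 ≤ p₀ →
      -- the plane
      (∃ C : ℝ≥0,
        (∀ θ p : ℝ, θ ∈ Ioo (0 : ℝ) 1 → 1 / p = (1 - θ) / p₀ →
          SharpYudovich.EqWithConst
            (SharpYudovich.lpBmoSpace ℝ p₀ θ p) (SharpYudovich.lpBmoNorm p₀ θ p)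
            (SharpYudovich.sharpSpace ℝ α p) (SharpYudovich.sharpNorm α p) C) ∧
        (∀ Θ : ℝ → ℝ, SharpYudovich.IsGrowthFunction Θ →
          SharpYudovich.EqWithConst
            (SharpYudovich.sharpYudovichSpace ℝ α p₀ Θ) (SharpYudovich.sharpYudovichNorm α p₀ Θ)
            (SharpYudovich.lpBmoDeltaSpace ℝ p₀ Θ) (SharpYudovich.lpBmoDeltaNorm p₀ Θ) C)) ∧
      -- the torus
      (∃ C : ℝ≥0,
        (∀ θ p : ℝ, θ ∈ Ioo (0 : ℝ) 1 → 1 / p = (1 - θ) / p₀ →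
          SharpYudovich.EqWithConst
            (SharpYudovich.lpBmoSpace UnitAddCircle p₀ θ p) (SharpYudovich.lpBmoNorm p₀ θ p)
            (SharpYudovich.sharpSpace UnitAddCircle α p) (SharpYudovich.sharpNorm α p) C) ∧
        (∀ Θ : ℝ → ℝ, SharpYudovich.IsGrowthFunction Θ →
          SharpYudovich.EqWithConst
            (SharpYudovich.sharpYudovichSpace UnitAddCircle α p₀ Θ)
            (SharpYudovich.sharpYudovichNorm α p₀ Θ)
            (SharpYudovich.lpBmoDeltaSpace UnitAddCircle p₀ Θ)
            (SharpYudovich.lpBmoDeltaNorm p₀ Θ) C)) := by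
  refine ⟨1 / 4 ^ 11, by positivity, fun α hα0 hα p₀ hp₀ => ?_⟩
  have hα' : ENNReal.ofReal α * 4 ^ 11 ≤ 1 := by
    have h : ENNReal.ofReal α * ENNReal.ofReal (4 ^ 11) ≤ ENNReal.ofReal 1 := by
      rw [← ENNReal.ofReal_mul hα0.le]
      refine ENNReal.ofReal_le_ofReal ?_
      rwa [le_div_iff₀ (by positivity)] at hα
    rwa [ENNReal.ofReal_pow (by norm_num), ENNReal.ofReal_ofNat, ENNReal.ofReal_one] at h
  exact ⟨SharpYudovich.exists_eqWithConst SharpYudovich.realLine.toGrid hα0 hα' hp₀,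
    SharpYudovich.exists_eqWithConst SharpYudovich.circleLine.toGrid hα0 hα' hp₀⟩
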